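/- **Setting.** A *first-order cubical algebra* is a category $\mathcal C$ with a (chosen) terminal object and a locally representable presheaf $\mathbb I$ (with chosen representing objects $\Gamma.\mathbb I$) having two global elements $0,1$; morphisms preserve all this structure strictly. Let $\square$ be the initial first-order cubical algebra. A *higher-order model* of minimal cubical type theory (CTT) consists of a set $\mathbb I$ with points $0,1$; a set $\mathsf{Ty}$ and a family $\mathsf{Tm}:\mathsf{Ty}\to\mathrm{Set}$; $\Pi$-types, i.e. $\Pi(A,B)\in\mathsf{Ty}$ for $A\in\mathsf{Ty}$, $B:\mathsf{Tm}(A)\to\mathsf{Ty}$, with a bijection $\mathsf{app}:\mathsf{Tm}(\Pi(A,B))\cong\prod_{a:\mathsf{Tm}(A)}\mathsf{Tm}(B(a))$ with inverse $\mathsf{lam}$; and path types $\mathsf{Path}(A,x,y)\in\mathsf{Ty}$ for $A:\mathbb I\to\mathsf{Ty}$, $x:\mathsf{Tm}(A(0))$, $y:\mathsf{Tm}(A(1))$, with $\mathsf{papp}:\mathsf{Tm}(\mathsf{Path}(A,x,y))\to\prod_{i:\mathbb I}\mathsf{Tm}(A(i))$ satisfying $\mathsf{papp}(p,0)=x$,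 $\mathsf{papp}(p,1)=y$, and $\mathsf{plam}(p):\mathsf{Tm}(\mathsf{Path}(A,p(0),p(1)))$ for $p:\prod_{i:\mathbb I}\mathsf{Tm}(A(i))$. Throughout, one may either require, or not require, the rules $\mathsf{papp}(\mathsf{plam}(p),i)=p(i)$ and $\mathsf{plam}(\lambda i.\,\mathsf{papp}(p,i))=p$; the statement holds for both versions of the theory (the same choice being made for first-order and for displayed models). A *first-order model* is a category with a chosen terminal object and a global higher-order model in presheaves over it whose $\mathbb I$ and $\mathsf{Tm}$ are locally representable (with chosen context extensions $\Gamma.\mathbb I$ and $\Gamma.A$); morphisms preserve everything strictly. Let $\mathcal S$ be the initial first-order model of CTT. (Both initialities are meant with respect to possibly large algebras and models as well.) Let $F:\square\to\mathcal S$ be the morphism of first-order cubical algebras, and write $\mathsf{int}$ for its action on interval elements. Let $\mathcal S_F=F^*(\mathsf{Tele}_{\mathbb S})$ be the first-order model internal to $\mathbf{Psh}(\square)$ which at stage $c$ is the contextual slice $\mathcal S/\!/F(c)$: its objects are the telescopes (iterated context extensions by types and by $\mathbb I$) over $F(c)$, and its morphisms, types, terms and interval elements are those of $\mathcal S$ over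 the total contexts (morphisms being over $F(c)$), stages being related by substitution. A *displayed higher-order model* $\mathbb S^\bullet$ over $\mathcal S_F$ consists, internally to $\mathbf{Psh}(\square)$, of families $\mathbb I^\bullet:\mathcal S_F.\mathbb I(1)\to\mathrm{Set}$ with $0^\bullet:\mathbb I^\bullet(0)$, $1^\bullet:\mathbb I^\bullet(1)$; $\mathsf{Ty}^\bullet:\mathcal S_F.\mathsf{Ty}(1)\to\mathrm{Set}$; $\mathsf{Tm}^\bullet:(A:\mathcal S_F.\mathsf{Ty}(1))\to\mathsf{Ty}^\bullet(A)\to\mathcal S_F.\mathsf{Tm}(1,A)\to\mathrm{Set}$; and operations $\Pi^\bullet,\mathsf{app}^\bullet,\mathsf{lam}^\bullet,\mathsf{Path}^\bullet,\mathsf{papp}^\bullet,\mathsf{plam}^\bullet$ lying over those of $\mathcal S_F$ and satisfying the displayed versions of the equations; a bound variable $a$ of type $A$ (resp. interval variable $i$) is replaced by a pair of a closed term $a$ and an $a^\bullet:\mathsf{Tm}^\bullet(A^\bullet,a)$ (resp. a closed interval element $i$ and an $i^\bullet:\mathbb I^\bullet(i)$), e.g. $\Pi^\bullet(A^\bullet,B^\bullet):\mathsf{Ty}^\bullet(\Pi(A,B))$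 for $A^\bullet:\mathsf{Ty}^\bullet(A)$, $B:\mathcal S_F.\mathsf{Ty}(1.A)$ and $B^\bullet:\forall a\,(a^\bullet:\mathsf{Tm}^\bullet(A^\bullet,a))\to\mathsf{Ty}^\bullet(B[a])$. A *section* $[\![-]\!]$ of the displayed contextualization $\mathbf{Scone}_{\mathbb S^\bullet}$ consists, internally to $\mathbf{Psh}(\square)$, of: for every object $\Gamma$ of $\mathcal S_F$ and closing substitution $\gamma:1\to\Gamma$, a set $[\![\Gamma]\!](\gamma)$; for $f:\Gamma\to\Delta$, maps $[\![f]\!]:[\![\Gamma]\!](\gamma)\to[\![\Delta]\!](f\circ\gamma)$; and for $\gamma^\bullet\in[\![\Gamma]\!](\gamma)$ elements $[\![A]\!](\gamma^\bullet):\mathsf{Ty}^\bullet(A[\gamma])$, $[\![a]\!](\gamma^\bullet):\mathsf{Tm}^\bullet([\![A]\!](\gamma^\bullet),a[\gamma])$, $[\![i]\!](\gamma^\bullet):\mathbb I^\bullet(i[\gamma])$ for types $A$, terms $a$ of type $A$ and interval elements $i$ over $\Gamma$; functorial and compatible with substitution, strictly preserving the empty context and context extensions, i.e. $[\![1]\!](\star)=\{\star\}$,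 $[\![\Gamma.A]\!](\gamma,a)=(\gamma^\bullet:[\![\Gamma]\!](\gamma))\times\mathsf{Tm}^\bullet([\![A]\!](\gamma^\bullet),a)$, $[\![\Gamma.\mathbb I]\!](\gamma,i)=[\![\Gamma]\!](\gamma)\times\mathbb I^\bullet(i)$ with the evident projections and variables, and sending $0,1,\Pi,\mathsf{app},\mathsf{lam},\mathsf{Path},\mathsf{papp},\mathsf{plam}$ to the corresponding operations of $\mathbb S^\bullet$, e.g. $[\![\Pi(A,B)]\!](\gamma^\bullet)=\Pi^\bullet([\![A]\!](\gamma^\bullet),\lambda a^\bullet.\,[\![B]\!](\gamma^\bullet,a^\bullet))$. **Theorem** (Induction principle relative to $F:\square\to\mathcal S$). Let $\mathbb S^\bullet$ be a displayed higher-order model of CTT over $\mathcal S_F$ in $\mathbf{Psh}(\square)$, together with a (natural) function $$\mathsf{int}^\bullet:(i:\square.\mathbb I)\to\mathbb I^\bullet(\mathsf{int}(i))\qquad\text{such that}\qquad \mathsf{int}^\bullet(0)=0^\bullet,\quad \mathsf{int}^\bullet(1)=1^\bullet.$$ Then $\mathbf{Scone}_{\mathbb S^\bullet}$ has a section $[\![-]\!]$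 such that $[\![\mathsf{int}(i)]\!]=\mathsf{int}^\bullet(i)$ for all $i:\square.\mathbb I$ (the interpretation of the closed interval element $\mathsf{int}(i)$ in the empty environment). -/

import Mathlib

open CategoryTheory

universe o m o' m' u w

/-! # First-order cubical algebras -/

/-- A first-order cubical algebra: a category with a (chosen) terminal object `one` and a locally
representable presheaf `I` (the interval) with two global elements `i0`, `i1`.  Local
representability of `I` is the choice, for every object `Γ`, of an object `extI Γ` (the context
`Γ.𝕀`) representing the presheaf `Δ ↦ Hom(Δ, Γ) × I Δ`. -/
structure CubAlg where
  Ob : Type o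
  [cat : Category.{m} Ob]
  one : Ob
  bang : ∀ Γ : Ob, Γ ⟶ one
  bang_uniq : ∀ {Γ : Ob} (f : Γ ⟶ one), f = bang Γ
  I : Ob → Type m
  subI : ∀ {Δ Γ : Ob}, (Δ ⟶ Γ) → I Γ → I Δ
  subI_id : ∀ {Γ : Ob} (i : I Γ), subI (𝟙 Γ) i = i
  subI_comp : ∀ {Θ Δ Γ : Ob} (g : Θ ⟶ Δ) (f : Δ ⟶ Γ) (i : I Γ),
    subI (g ≫ f) i = subI g (subI f i)
  i0 : ∀ Γ : Ob, I Γ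
  i1 : ∀ Γ : Ob, I Γ
  subI_i0 : ∀ {Δ Γ : Ob} (f : Δ ⟶ Γ), subI f (i0 Γ) = i0 Δ
  subI_i1 : ∀ {Δ Γ : Ob} (f : Δ ⟶ Γ), subI f (i1 Γ) = i1 Δ
  extI : Ob → Ob
  pI : ∀ Γ : Ob, extI Γ ⟶ Γ
  qI : ∀ Γ : Ob, I (extI Γ)
  pairI : ∀ {Δ Γ : Ob}, (Δ ⟶ Γ) → I Δ → (Δ ⟶ extI Γ)
  pairI_p : ∀ {Δ Γ : Ob} (f : Δ ⟶ Γ) (i : I Δ), pairI f i ≫ pI Γ = f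
  pairI_q : ∀ {Δ Γ : Ob} (f : Δ ⟶ Γ) (i : I Δ), subI (pairI f i) (qI Γ) = i
  pairI_eta : ∀ {Δ Γ : Ob} (g : Δ ⟶ extI Γ), pairI (g ≫ pI Γ) (subI g (qI Γ)) = g

attribute [instance] CubAlg.cat

namespace CubAlg

variable (C : CubAlg.{o, m})

theorem hom_extI_ext {Δ Γ : C.Ob} {g h : Δ ⟶ C.extI Γ} (hp : g ≫ C.pI Γ = h ≫ C.pI Γ)
    (hq : C.subI g (C.qI Γ) = C.subI h (C.qI Γ)) : g = h := by
  rw [← C.pairI_eta g, ← C.pairI_eta h, hp, hq]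

/-- The substitution `⟨id, i⟩ : Γ ⟶ Γ.𝕀`. -/
def instI {Γ : C.Ob} (i : C.I Γ) : Γ ⟶ C.extI Γ := C.pairI (𝟙 Γ) i

/-- The weakening `f⁺ = ⟨f ∘ p, q⟩ : Δ.𝕀 ⟶ Γ.𝕀` of `f : Δ ⟶ Γ`. -/
def upI {Δ Γ : C.Ob} (f : Δ ⟶ Γ) : C.extI Δ ⟶ C.extI Γ := C.pairI (C.pI Δ ≫ f) (C.qI Δ)

theorem comp_pairI {Θ Δ Γ : C.Ob} (g : Θ ⟶ Δ) (f : Δ ⟶ Γ) (i : C.I Δ) :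
    g ≫ C.pairI f i = C.pairI (g ≫ f) (C.subI g i) := by
  apply C.hom_extI_ext
  · rw [Category.assoc, pairI_p, pairI_p]
  · rw [subI_comp, pairI_q, pairI_q]

theorem pairI_upI {Θ Δ Γ : C.Ob} (g : Θ ⟶ Δ) (f : Δ ⟶ Γ) (i : C.I Θ) :
    C.pairI g i ≫ C.upI f = C.pairI (g ≫ f) i := by
  rw [upI, comp_pairI, ← Category.assoc, pairI_p, pairI_q]

theorem instI_upI {Δ Γ : C.Ob} (f : Δ ⟶ Γ) (i : C.I Γ) :
    C.instI (C.subI f i) ≫ C.upI f = f ≫ C.instI i := by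
  rw [instI, instI, pairI_upI, comp_pairI, Category.id_comp, Category.comp_id]

/-- Morphisms of first-order cubical algebras: functors with an action on interval elements
preserving all the structure, including the chosen terminal object and extensions, strictly. -/
structure Hom (C : CubAlg.{o, m}) (D : CubAlg.{o', m'}) extends C.Ob ⥤ D.Ob where
  onI : ∀ {Γ : C.Ob}, C.I Γ → D.I (obj Γ)
  onI_sub : ∀ {Δ Γ : C.Ob} (f : Δ ⟶ Γ) (i : C.I Γ), onI (C.subI f i) = D.subI (map f) (onI i)
  onI_i0 : ∀ Γ : C.Ob, onI (C.i0 Γ) = D.i0 (obj Γ)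
  onI_i1 : ∀ Γ : C.Ob, onI (C.i1 Γ) = D.i1 (obj Γ)
  obj_one : obj C.one = D.one
  obj_extI : ∀ Γ : C.Ob, obj (C.extI Γ) = D.extI (obj Γ)
  map_pI : ∀ Γ : C.Ob, map (C.pI Γ) = eqToHom (obj_extI Γ) ≫ D.pI (obj Γ)
  onI_qI : ∀ Γ : C.Ob, onI (C.qI Γ) = D.subI (eqToHom (obj_extI Γ)) (D.qI (obj Γ))

/-- `C` is initial: there is exactly one morphism from `C` to every first-order cubical algebra
(in the universes `o'`, `m'`). -/
def IsInitial (C : CubAlg.{o, m}) : Prop :=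
  ∀ D : CubAlg.{o', m'}, Nonempty (Unique (Hom C D))

end CubAlg

/-! # First-order models -/

/-- The judgemental part of a first-order model of cubical type theory: a first-order cubical
algebra with a presheaf `Ty` of types and a locally representable dependent presheaf of terms.
The latter is presented by its total presheaf `Tm` with the projection `typ : Tm → Ty` (terms of
type `A` are the `a` with `typ a = A`); `ext A` is the context extension. -/
structure CwF extends CubAlg.{o, m} where
  Ty : Ob → Type m
  subTy : ∀ {Δ Γ : Ob}, (Δ ⟶ Γ) → Ty Γ → Ty Δ
  subTy_id : ∀ {Γ : Ob} (A : Ty Γ), subTy (𝟙 Γ) A = A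
  subTy_comp : ∀ {Θ Δ Γ : Ob} (g : Θ ⟶ Δ) (f : Δ ⟶ Γ) (A : Ty Γ),
    subTy (g ≫ f) A = subTy g (subTy f A)
  Tm : Ob → Type m
  subTm : ∀ {Δ Γ : Ob}, (Δ ⟶ Γ) → Tm Γ → Tm Δ
  subTm_id : ∀ {Γ : Ob} (a : Tm Γ), subTm (𝟙 Γ) a = a
  subTm_comp : ∀ {Θ Δ Γ : Ob} (g : Θ ⟶ Δ) (f : Δ ⟶ Γ) (a : Tm Γ),
    subTm (g ≫ f) a = subTm g (subTm f a)
  typ : ∀ {Γ : Ob}, Tm Γ → Ty Γ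
  typ_sub : ∀ {Δ Γ : Ob} (f : Δ ⟶ Γ) (a : Tm Γ), typ (subTm f a) = subTy f (typ a)
  ext : ∀ {Γ : Ob}, Ty Γ → Ob
  p : ∀ {Γ : Ob} (A : Ty Γ), ext A ⟶ Γ
  q : ∀ {Γ : Ob} (A : Ty Γ), Tm (ext A)
  typ_q : ∀ {Γ : Ob} (A : Ty Γ), typ (q A) = subTy (p A) A
  pair : ∀ {Δ Γ : Ob} (f : Δ ⟶ Γ) (A : Ty Γ) (a : Tm Δ), typ a = subTy f A → (Δ ⟶ ext A)
  pair_p : ∀ {Δ Γ : Ob} (f : Δ ⟶ Γ) (A : Ty Γ) (a : Tm Δ) (h : typ a = subTy f A),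
    pair f A a h ≫ p A = f
  pair_q : ∀ {Δ Γ : Ob} (f : Δ ⟶ Γ) (A : Ty Γ) (a : Tm Δ) (h : typ a = subTy f A),
    subTm (pair f A a h) (q A) = a
  pair_eta : ∀ {Δ Γ : Ob} (A : Ty Γ) (g : Δ ⟶ ext A),
    pair (g ≫ p A) A (subTm g (q A)) (by rw [typ_sub, typ_q, subTy_comp]) = g

namespace CwF

variable (M : CwF.{o, m})

theorem hom_ext_ext {Δ Γ : M.Ob} {A : M.Ty Γ} {g h : Δ ⟶ M.ext A}
    (hp : g ≫ M.p A = h ≫ M.p A) (hq : M.subTm g (M.q A) = M.subTm h (M.q A)) : g = h := by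
  rw [← M.pair_eta A g, ← M.pair_eta A h]
  congr 1

/-- The substitution `⟨id, a⟩ : Γ ⟶ Γ.A`. -/
def inst {Γ : M.Ob} (A : M.Ty Γ) (a : M.Tm Γ) (h : M.typ a = A) : Γ ⟶ M.ext A :=
  M.pair (𝟙 Γ) A a (by rw [M.subTy_id, h])

/-- The weakening `f⁺ = ⟨f ∘ p, q⟩ : Δ.A[f] ⟶ Γ.A` of `f : Δ ⟶ Γ`. -/
def up {Δ Γ : M.Ob} (f : Δ ⟶ Γ) (A : M.Ty Γ) : M.ext (M.subTy f A) ⟶ M.ext A :=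
  M.pair (M.p _ ≫ f) A (M.q _) (by rw [M.typ_q, M.subTy_comp])

theorem comp_pair {Θ Δ Γ : M.Ob} (g : Θ ⟶ Δ) (f : Δ ⟶ Γ) (A : M.Ty Γ) (a : M.Tm Δ)
    (h : M.typ a = M.subTy f A) (h' : M.typ (M.subTm g a) = M.subTy (g ≫ f) A) :
    g ≫ M.pair f A a h = M.pair (g ≫ f) A (M.subTm g a) h' := by
  apply M.hom_ext_ext
  · rw [Category.assoc, pair_p, pair_p]
  · rw [subTm_comp, pair_q, pair_q]

theorem pair_up {Θ Δ Γ : M.Ob} (g : Θ ⟶ Δ) (f : Δ ⟶ Γ) (A : M.Ty Γ) (a : M.Tm Θ)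
    (h : M.typ a = M.subTy g (M.subTy f A)) (h' : M.typ a = M.subTy (g ≫ f) A) :
    M.pair g (M.subTy f A) a h ≫ M.up f A = M.pair (g ≫ f) A a h' := by
  apply M.hom_ext_ext
  · rw [Category.assoc, up, pair_p, pair_p, ← Category.assoc, pair_p]
  · rw [subTm_comp, up, pair_q, pair_q, pair_q]

theorem typ_sub_end {Δ Γ : M.Ob} (f : Δ ⟶ Γ) (A : M.Ty (M.extI Γ)) (x : M.Tm Γ) (i : M.I Γ)
    (j : M.I Δ) (hj : M.subI f i = j) (hx : M.typ x = M.subTy (M.instI i) A) :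
    M.typ (M.subTm f x) = M.subTy (M.instI j) (M.subTy (M.upI f) A) := by
  subst hj
  rw [M.typ_sub, hx, ← M.subTy_comp, ← M.subTy_comp, CubAlg.instI_upI]

/-- Strict morphisms, on the judgemental part. -/
structure Hom (M : CwF.{o, m}) (N : CwF.{o', m'}) extends
    toCubHom : CubAlg.Hom M.toCubAlg N.toCubAlg where
  onTy : ∀ {Γ : M.Ob}, M.Ty Γ → N.Ty (obj Γ)
  onTy_sub : ∀ {Δ Γ : M.Ob} (f : Δ ⟶ Γ) (A : M.Ty Γ),
    onTy (M.subTy f A) = N.subTy (map f) (onTy A)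
  onTm : ∀ {Γ : M.Ob}, M.Tm Γ → N.Tm (obj Γ)
  onTm_sub : ∀ {Δ Γ : M.Ob} (f : Δ ⟶ Γ) (a : M.Tm Γ),
    onTm (M.subTm f a) = N.subTm (map f) (onTm a)
  typ_onTm : ∀ {Γ : M.Ob} (a : M.Tm Γ), N.typ (onTm a) = onTy (M.typ a)
  obj_ext : ∀ {Γ : M.Ob} (A : M.Ty Γ), obj (M.ext A) = N.ext (onTy A)
  map_p : ∀ {Γ : M.Ob} (A : M.Ty Γ), map (M.p A) = eqToHom (obj_ext A) ≫ N.p (onTy A)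
  onTm_q : ∀ {Γ : M.Ob} (A : M.Ty Γ),
    onTm (M.q A) = N.subTm (eqToHom (obj_ext A)) (N.q (onTy A))

namespace Hom

variable {M} {N : CwF.{o', m'}} (G : Hom M N)

/-- The action on a type over `Γ.A`, as a type over `G(Γ).G(A)`. -/
def onTyExt {Γ : M.Ob} (A : M.Ty Γ) (B : M.Ty (M.ext A)) : N.Ty (N.ext (G.onTy A)) :=
  N.subTy (eqToHom (G.obj_ext A).symm) (G.onTy B)

/-- The action on a term over `Γ.A`, as a term over `G(Γ).G(A)`. -/
def onTmExt {Γ : M.Ob} (A : M.Ty Γ) (b : M.Tm (M.ext A)) : N.Tm (N.ext (G.onTy A)) :=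
  N.subTm (eqToHom (G.obj_ext A).symm) (G.onTm b)

/-- The action on a type over `Γ.𝕀`, as a type over `G(Γ).𝕀`. -/
def onTyExtI {Γ : M.Ob} (A : M.Ty (M.extI Γ)) : N.Ty (N.extI (G.obj Γ)) :=
  N.subTy (eqToHom (G.obj_extI Γ).symm) (G.onTy A)

/-- The action on a term over `Γ.𝕀`, as a term over `G(Γ).𝕀`. -/
def onTmExtI {Γ : M.Ob} (b : M.Tm (M.extI Γ)) : N.Tm (N.extI (G.obj Γ)) :=
  N.subTm (eqToHom (G.obj_extI Γ).symm) (G.onTm b)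

theorem map_instI {Γ : M.Ob} (i : M.I Γ) :
    G.map (M.instI i) = N.instI (G.onI i) ≫ eqToHom (G.obj_extI Γ).symm := by
  have h : G.map (M.instI i) ≫ eqToHom (G.obj_extI Γ) = N.instI (G.onI i) := by
    apply N.hom_extI_ext
    · rw [Category.assoc, ← G.map_pI, ← G.map_comp, CubAlg.instI, CubAlg.instI, M.pairI_p,
        N.pairI_p, G.map_id]
    · rw [N.subI_comp, ← G.onI_qI, ← G.onI_sub, CubAlg.instI, CubAlg.instI, M.pairI_q, N.pairI_q]
  rw [← h, Category.assoc, eqToHom_trans, eqToHom_refl, Category.comp_id]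

theorem typ_end {Γ : M.Ob} (A : M.Ty (M.extI Γ)) (x : M.Tm Γ) (i : M.I Γ) (j : N.I (G.obj Γ))
    (hj : G.onI i = j) (hx : M.typ x = M.subTy (M.instI i) A) :
    N.typ (G.onTm x) = N.subTy (N.instI j) (G.onTyExtI A) := by
  subst hj
  rw [G.typ_onTm, hx, G.onTy_sub, G.map_instI, N.subTy_comp]
  rfl

end Hom

end CwF

/-- A first-order model of minimal cubical type theory: a category with terminal object together
with a global higher-order model in its presheaf category, whose interval and terms are locally
representable.  There are `Π`-types with `β` and `η`, and path types.

The parameter `βη` says whether path types are moreover required to satisfy the `β`- and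
`η`-rules `papp(plam(b), i) = b(i)` and `plam(λ i ↦ papp(t, i)) = t`. -/
structure CTTModel (βη : Prop) extends CwF.{o, m} where
  pi : ∀ {Γ : Ob} (A : Ty Γ) (_ : Ty (ext A)), Ty Γ
  pi_sub : ∀ {Δ Γ : Ob} (f : Δ ⟶ Γ) (A : Ty Γ) (B : Ty (ext A)),
    subTy f (pi A B) = pi (subTy f A) (subTy (toCwF.up f A) B)
  lam : ∀ {Γ : Ob} (A : Ty Γ) (_ : Tm (ext A)), Tm Γ
  typ_lam : ∀ {Γ : Ob} (A : Ty Γ) (b : Tm (ext A)), typ (lam A b) = pi A (typ b)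
  lam_sub : ∀ {Δ Γ : Ob} (f : Δ ⟶ Γ) (A : Ty Γ) (b : Tm (ext A)),
    subTm f (lam A b) = lam (subTy f A) (subTm (toCwF.up f A) b)
  app : ∀ {Γ : Ob} (A : Ty Γ) (B : Ty (ext A)) (t a : Tm Γ),
    typ t = pi A B → typ a = A → Tm Γ
  typ_app : ∀ {Γ : Ob} (A : Ty Γ) (B : Ty (ext A)) (t a : Tm Γ)
    (ht : typ t = pi A B) (ha : typ a = A),
    typ (app A B t a ht ha) = subTy (toCwF.inst A a ha) B
  app_sub : ∀ {Δ Γ : Ob} (f : Δ ⟶ Γ) (A : Ty Γ) (B : Ty (ext A)) (t a : Tm Γ)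
    (ht : typ t = pi A B) (ha : typ a = A),
    subTm f (app A B t a ht ha) =
      app (subTy f A) (subTy (toCwF.up f A) B) (subTm f t) (subTm f a)
        (by rw [typ_sub, ht, pi_sub]) (by rw [typ_sub, ha])
  pi_beta : ∀ {Γ : Ob} (A : Ty Γ) (b : Tm (ext A)) (a : Tm Γ) (ha : typ a = A),
    app A (typ b) (lam A b) a (typ_lam A b) ha = subTm (toCwF.inst A a ha) b
  pi_eta : ∀ {Γ : Ob} (A : Ty Γ) (B : Ty (ext A)) (t : Tm Γ) (ht : typ t = pi A B),
    lam A (app (subTy (p A) A) (subTy (toCwF.up (p A) A) B) (subTm (p A) t) (q A)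
      (by rw [typ_sub, ht, pi_sub]) (typ_q A)) = t
  path : ∀ {Γ : Ob} (A : Ty (extI Γ)) (x y : Tm Γ),
    typ x = subTy (toCubAlg.instI (i0 Γ)) A → typ y = subTy (toCubAlg.instI (i1 Γ)) A → Ty Γ
  path_sub : ∀ {Δ Γ : Ob} (f : Δ ⟶ Γ) (A : Ty (extI Γ)) (x y : Tm Γ)
    (hx : typ x = subTy (toCubAlg.instI (i0 Γ)) A)
    (hy : typ y = subTy (toCubAlg.instI (i1 Γ)) A),
    subTy f (path A x y hx hy) =
      path (subTy (toCubAlg.upI f) A) (subTm f x) (subTm f y)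
        (toCwF.typ_sub_end f A x _ _ (subI_i0 f) hx)
        (toCwF.typ_sub_end f A y _ _ (subI_i1 f) hy)
  papp : ∀ {Γ : Ob} (A : Ty (extI Γ)) (x y : Tm Γ)
    (hx : typ x = subTy (toCubAlg.instI (i0 Γ)) A)
    (hy : typ y = subTy (toCubAlg.instI (i1 Γ)) A)
    (t : Tm Γ) (_ : typ t = path A x y hx hy) (_ : I Γ), Tm Γ
  typ_papp : ∀ {Γ : Ob} (A : Ty (extI Γ)) (x y : Tm Γ)
    (hx : typ x = subTy (toCubAlg.instI (i0 Γ)) A)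
    (hy : typ y = subTy (toCubAlg.instI (i1 Γ)) A)
    (t : Tm Γ) (ht : typ t = path A x y hx hy) (i : I Γ),
    typ (papp A x y hx hy t ht i) = subTy (toCubAlg.instI i) A
  papp_sub : ∀ {Δ Γ : Ob} (f : Δ ⟶ Γ) (A : Ty (extI Γ)) (x y : Tm Γ)
    (hx : typ x = subTy (toCubAlg.instI (i0 Γ)) A)
    (hy : typ y = subTy (toCubAlg.instI (i1 Γ)) A)
    (t : Tm Γ) (ht : typ t = path A x y hx hy) (i : I Γ),
    subTm f (papp A x y hx hy t ht i) =
      papp (subTy (toCubAlg.upI f) A) (subTm f x) (subTm f y)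
        (toCwF.typ_sub_end f A x _ _ (subI_i0 f) hx)
        (toCwF.typ_sub_end f A y _ _ (subI_i1 f) hy)
        (subTm f t) (by rw [typ_sub, ht, path_sub]) (subI f i)
  papp_i0 : ∀ {Γ : Ob} (A : Ty (extI Γ)) (x y : Tm Γ)
    (hx : typ x = subTy (toCubAlg.instI (i0 Γ)) A)
    (hy : typ y = subTy (toCubAlg.instI (i1 Γ)) A)
    (t : Tm Γ) (ht : typ t = path A x y hx hy), papp A x y hx hy t ht (i0 Γ) = x
  papp_i1 : ∀ {Γ : Ob} (A : Ty (extI Γ)) (x y : Tm Γ)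
    (hx : typ x = subTy (toCubAlg.instI (i0 Γ)) A)
    (hy : typ y = subTy (toCubAlg.instI (i1 Γ)) A)
    (t : Tm Γ) (ht : typ t = path A x y hx hy), papp A x y hx hy t ht (i1 Γ) = y
  plam : ∀ {Γ : Ob}, Tm (extI Γ) → Tm Γ
  typ_plam : ∀ {Γ : Ob} (b : Tm (extI Γ)),
    typ (plam b) = path (typ b) (subTm (toCubAlg.instI (i0 Γ)) b)
      (subTm (toCubAlg.instI (i1 Γ)) b) (typ_sub _ _) (typ_sub _ _)
  plam_sub : ∀ {Δ Γ : Ob} (f : Δ ⟶ Γ) (b : Tm (extI Γ)),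
    subTm f (plam b) = plam (subTm (toCubAlg.upI f) b)
  path_beta : βη → ∀ {Γ : Ob} (b : Tm (extI Γ)) (i : I Γ),
    papp (typ b) _ _ (typ_sub _ _) (typ_sub _ _) (plam b) (typ_plam b) i =
      subTm (toCubAlg.instI i) b
  path_eta : βη → ∀ {Γ : Ob} (A : Ty (extI Γ)) (x y : Tm Γ)
    (hx : typ x = subTy (toCubAlg.instI (i0 Γ)) A)
    (hy : typ y = subTy (toCubAlg.instI (i1 Γ)) A)
    (t : Tm Γ) (ht : typ t = path A x y hx hy),
    plam (papp (subTy (toCubAlg.upI (pI Γ)) A) (subTm (pI Γ) x) (subTm (pI Γ) y)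
      (toCwF.typ_sub_end (pI Γ) A x _ _ (subI_i0 (pI Γ)) hx)
      (toCwF.typ_sub_end (pI Γ) A y _ _ (subI_i1 (pI Γ)) hy)
      (subTm (pI Γ) t) (by rw [typ_sub, ht, path_sub]) (qI Γ)) = t

namespace CTTModel

variable {βη : Prop}

/-- Morphisms of first-order models: they preserve all the structure strictly. -/
structure Hom (M : CTTModel.{o, m} βη) (N : CTTModel.{o', m'} βη) extends
    toCwFHom : CwF.Hom M.toCwF N.toCwF where
  on_pi : ∀ {Γ : M.Ob} (A : M.Ty Γ) (B : M.Ty (M.ext A)),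
    onTy (M.pi A B) = N.pi (onTy A) (toCwFHom.onTyExt A B)
  on_lam : ∀ {Γ : M.Ob} (A : M.Ty Γ) (b : M.Tm (M.ext A)),
    onTm (M.lam A b) = N.lam (onTy A) (toCwFHom.onTmExt A b)
  on_app : ∀ {Γ : M.Ob} (A : M.Ty Γ) (B : M.Ty (M.ext A)) (t a : M.Tm Γ)
    (ht : M.typ t = M.pi A B) (ha : M.typ a = A),
    onTm (M.app A B t a ht ha) = N.app (onTy A) (toCwFHom.onTyExt A B) (onTm t) (onTm a)
      (by rw [typ_onTm, ht, on_pi]) (by rw [typ_onTm, ha])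
  on_path : ∀ {Γ : M.Ob} (A : M.Ty (M.extI Γ)) (x y : M.Tm Γ)
    (hx : M.typ x = M.subTy (M.instI (M.i0 Γ)) A) (hy : M.typ y = M.subTy (M.instI (M.i1 Γ)) A),
    onTy (M.path A x y hx hy) = N.path (toCwFHom.onTyExtI A) (onTm x) (onTm y)
      (toCwFHom.typ_end A x _ _ (onI_i0 Γ) hx) (toCwFHom.typ_end A y _ _ (onI_i1 Γ) hy)
  on_papp : ∀ {Γ : M.Ob} (A : M.Ty (M.extI Γ)) (x y : M.Tm Γ)
    (hx : M.typ x = M.subTy (M.instI (M.i0 Γ)) A) (hy : M.typ y = M.subTy (M.instI (M.i1 Γ)) A)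
    (t : M.Tm Γ) (ht : M.typ t = M.path A x y hx hy) (i : M.I Γ),
    onTm (M.papp A x y hx hy t ht i) = N.papp (toCwFHom.onTyExtI A) (onTm x) (onTm y)
      (toCwFHom.typ_end A x _ _ (onI_i0 Γ) hx) (toCwFHom.typ_end A y _ _ (onI_i1 Γ) hy)
      (onTm t) (by rw [typ_onTm, ht, on_path]) (onI i)
  on_plam : ∀ {Γ : M.Ob} (b : M.Tm (M.extI Γ)),
    onTm (M.plam b) = N.plam (toCwFHom.onTmExtI b)

/-- `M` is initial: there is exactly one morphism from `M` to every first-order model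
(in the universes `o'`, `m'`). -/
def IsInitial (M : CTTModel.{o, m} βη) : Prop :=
  ∀ N : CTTModel.{o', m'} βη, Nonempty (Unique (Hom M N))

end CTTModel

/-! # Telescopes and contextual slices -/

namespace CwF

/-- `Tele M Γ Δ`: telescopes (iterated context extensions, by types and by the interval) over `Γ`,
whose total context is `Δ`.  These are the objects of the contextual slice `M ⫽ Γ`. -/
inductive Tele (M : CwF.{o, m}) (Γ : M.Ob) : M.Ob → Type (max o m)
  | nil : Tele M Γ Γ
  | snoc {Δ : M.Ob} (T : Tele M Γ Δ) (A : M.Ty Δ) : Tele M Γ (M.ext A)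
  | snocI {Δ : M.Ob} (T : Tele M Γ Δ) : Tele M Γ (M.extI Δ)

variable {M : CwF.{o, m}}

/-- The projection from the total context of a telescope to its base. -/
def Tele.proj {Γ : M.Ob} : ∀ {Δ : M.Ob}, Tele M Γ Δ → (Δ ⟶ Γ)
  | _, .nil => 𝟙 Γ
  | _, .snoc T A => M.p A ≫ T.proj
  | _, .snocI T => M.pI _ ≫ T.proj

/-- A telescope over `Θ`, with a map to the total context `Δ` of a telescope `T` over `Γ`, lying
over `f : Θ ⟶ Γ`. -/
structure Pulled {Γ Δ Θ : M.Ob} (T : Tele M Γ Δ) (f : Θ ⟶ Γ) where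
  ctx : M.Ob
  tele : Tele M Θ ctx
  map : ctx ⟶ Δ
  comm : map ≫ T.proj = tele.proj ≫ f

/-- Substitution `T[f]` of a telescope along `f : Θ ⟶ Γ`, with the canonical map
`Θ.T[f] ⟶ Γ.T`. -/
def Tele.pull {Γ Θ : M.Ob} (f : Θ ⟶ Γ) : ∀ {Δ : M.Ob} (T : Tele M Γ Δ), Pulled T f
  | _, .nil => ⟨Θ, .nil, f, by rw [proj, proj, Category.comp_id, Category.id_comp]⟩
  | _, .snoc T A =>
    ⟨M.ext (M.subTy (T.pull f).map A), .snoc (T.pull f).tele _, M.up (T.pull f).map A, by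
      rw [proj, proj, Category.assoc, ← (T.pull f).comm, CwF.up, ← Category.assoc, pair_p,
        Category.assoc]⟩
  | _, .snocI T =>
    ⟨M.extI (T.pull f).ctx, .snocI (T.pull f).tele, M.upI (T.pull f).map, by
      rw [proj, proj, Category.assoc, ← (T.pull f).comm, CubAlg.upI, ← Category.assoc,
        CubAlg.pairI_p, Category.assoc]⟩

/-- `Θ.T[f]` is a pullback of `Γ.T` along `f`: maps into it. -/
def Tele.lift {Γ Θ Ξ : M.Ob} (f : Θ ⟶ Γ) (a : Ξ ⟶ Θ) : ∀ {Δ : M.Ob} (T : Tele M Γ Δ) (b : Ξ ⟶ Δ),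
    b ≫ T.proj = a ≫ f →
      {s : Ξ ⟶ (T.pull f).ctx // s ≫ (T.pull f).tele.proj = a ∧ s ≫ (T.pull f).map = b}
  | _, .nil, b, h => ⟨a, by
      constructor
      · exact Category.comp_id a
      · rw [proj, Category.comp_id] at h
        exact h.symm⟩
  | _, .snoc T A, b, h =>
    let s := T.lift f a (b ≫ M.p A) (by rw [Category.assoc]; exact h)
    have hs : M.typ (M.subTm b (M.q A)) = M.subTy s.1 (M.subTy (T.pull f).map A) := by
      rw [← M.subTy_comp, s.2.2, M.typ_sub, M.typ_q, M.subTy_comp]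
    ⟨M.pair s.1 _ (M.subTm b (M.q A)) hs, by
      constructor
      · change _ ≫ M.p _ ≫ (T.pull f).tele.proj = a
        rw [← Category.assoc, M.pair_p, s.2.1]
      · change _ ≫ M.up _ A = b
        have h' : M.typ (M.subTm b (M.q A)) = M.subTy (s.1 ≫ (T.pull f).map) A := by
          rw [hs, M.subTy_comp]
        rw [M.pair_up _ _ _ _ _ h']
        apply M.hom_ext_ext
        · rw [M.pair_p, s.2.2]
        · rw [M.pair_q]⟩
  | _, .snocI T, b, h =>
    let s := T.lift f a (b ≫ M.pI _) (by rw [Category.assoc]; exact h)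
    ⟨M.pairI s.1 (M.subI b (M.qI _)), by
      constructor
      · change _ ≫ M.pI _ ≫ (T.pull f).tele.proj = a
        rw [← Category.assoc, M.pairI_p, s.2.1]
      · change _ ≫ M.upI _ = b
        rw [M.pairI_upI]
        apply M.hom_extI_ext
        · rw [M.pairI_p, s.2.2]
        · rw [M.pairI_q]⟩

end CwF

/-! # Displayed higher-order models

We fix a first-order model `S` and a morphism `F : Q → S` of first-order cubical algebras.  The
restriction `F^*(Tele_S)` is the first-order model internal to presheaves over `Q` which at stage
`c` is the contextual slice `S ⫽ F(c)`: its objects are the telescopes over `F(c)`, and its types,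
terms and interval elements over a telescope `T` are those of `S` over the total context
`F(c).T`.  In particular its closed types at stage `c` are the elements of `S.Ty (F c)`, and
similarly for closed terms and interval elements.  An operation in the internal language of
presheaves over `Q` is given by its components at all stages, naturally in the stage. -/

section Displayed

variable {βη : Prop} {S : CTTModel.{u, u} βη} {Q : CubAlg.{u, u}}

/-- The sorts of a displayed higher-order model over `F^*(Tele_S)` in presheaves over `Q`.  A
dependent presheaf over `X` is presented by its total presheaf with the projection to `X`:
* `Ty` (representing `Ty^• : Ty(1) → Set`) with the projection `tyb` to closed types;
* `Tm` (representing `Tm^• : (A : Ty(1)) (A^• : Ty^•(A)) → Tm(1, A) → Set`) with the projections `tyOf` to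
  displayed types and `tmb` to closed terms, over the same closed type;
* `I` (representing `𝕀^• : 𝕀(1) → Set`) with the projection `ib` to closed interval elements,
  and with `0^•`, `1^•` over `0`, `1`. -/
structure DispBase (F : CubAlg.Hom Q S.toCubAlg) where
  Ty : Q.Ob → Type w
  resTy : ∀ {d c : Q.Ob}, (d ⟶ c) → Ty c → Ty d
  resTy_id : ∀ {c : Q.Ob} (A : Ty c), resTy (𝟙 c) A = A
  resTy_comp : ∀ {e d c : Q.Ob} (g : e ⟶ d) (f : d ⟶ c) (A : Ty c),
    resTy (g ≫ f) A = resTy g (resTy f A)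
  tyb : ∀ {c : Q.Ob}, Ty c → S.Ty (F.obj c)
  tyb_res : ∀ {d c : Q.Ob} (f : d ⟶ c) (A : Ty c), tyb (resTy f A) = S.subTy (F.map f) (tyb A)
  Tm : Q.Ob → Type w
  resTm : ∀ {d c : Q.Ob}, (d ⟶ c) → Tm c → Tm d
  resTm_id : ∀ {c : Q.Ob} (a : Tm c), resTm (𝟙 c) a = a
  resTm_comp : ∀ {e d c : Q.Ob} (g : e ⟶ d) (f : d ⟶ c) (a : Tm c),
    resTm (g ≫ f) a = resTm g (resTm f a)
  tyOf : ∀ {c : Q.Ob}, Tm c → Ty c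
  tyOf_res : ∀ {d c : Q.Ob} (f : d ⟶ c) (a : Tm c), tyOf (resTm f a) = resTy f (tyOf a)
  tmb : ∀ {c : Q.Ob}, Tm c → S.Tm (F.obj c)
  tmb_res : ∀ {d c : Q.Ob} (f : d ⟶ c) (a : Tm c), tmb (resTm f a) = S.subTm (F.map f) (tmb a)
  typ_tmb : ∀ {c : Q.Ob} (a : Tm c), S.typ (tmb a) = tyb (tyOf a)
  I : Q.Ob → Type w
  resI : ∀ {d c : Q.Ob}, (d ⟶ c) → I c → I d
  resI_id : ∀ {c : Q.Ob} (i : I c), resI (𝟙 c) i = i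
  resI_comp : ∀ {e d c : Q.Ob} (g : e ⟶ d) (f : d ⟶ c) (i : I c),
    resI (g ≫ f) i = resI g (resI f i)
  ib : ∀ {c : Q.Ob}, I c → S.I (F.obj c)
  ib_res : ∀ {d c : Q.Ob} (f : d ⟶ c) (i : I c), ib (resI f i) = S.subI (F.map f) (ib i)
  i0 : ∀ c : Q.Ob, I c
  i1 : ∀ c : Q.Ob, I c
  resI_i0 : ∀ {d c : Q.Ob} (f : d ⟶ c), resI f (i0 c) = i0 d
  resI_i1 : ∀ {d c : Q.Ob} (f : d ⟶ c), resI f (i1 c) = i1 d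
  ib_i0 : ∀ c : Q.Ob, ib (i0 c) = S.i0 (F.obj c)
  ib_i1 : ∀ c : Q.Ob, ib (i1 c) = S.i1 (F.obj c)

namespace DispBase

variable {F : CubAlg.Hom Q S.toCubAlg} (D : DispBase.{u, w} F)

theorem typ_inst {d c : Q.Ob} (f : d ⟶ c) {A : S.Ty (F.obj c)} {A' : D.Ty c}
    (hA : D.tyb A' = A) (a : D.Tm d) (ha : D.tyOf a = D.resTy f A') :
    S.typ (D.tmb a) = S.subTy (F.map f) A := by
  rw [D.typ_tmb, ha, D.tyb_res, hA]

theorem tyOf_resTm {e d c : Q.Ob} (g : e ⟶ d) (f : d ⟶ c) {A' : D.Ty c} {a : D.Tm d}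
    (ha : D.tyOf a = D.resTy f A') : D.tyOf (D.resTm g a) = D.resTy (g ≫ f) A' := by
  rw [D.tyOf_res, ha, D.resTy_comp]

theorem tyOf_id {c : Q.Ob} {A' : D.Ty c} {a : D.Tm c} (ha : D.tyOf a = A') :
    D.tyOf a = D.resTy (𝟙 c) A' := by
  rw [D.resTy_id, ha]

/-- Elements at stage `c` of
`B^• : ∀ (a : Tm(1, A)) (a^• : Tm^•(A^•, a)) → Ty^•(B[a])`, where `B : Ty(1.A)`. -/
structure FamTy {c : Q.Ob} (A : S.Ty (F.obj c)) (A' : D.Ty c) (hA : D.tyb A' = A)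
    (B : S.Ty (S.ext A)) where
  val : ∀ {d : Q.Ob} (f : d ⟶ c) (a : D.Tm d), D.tyOf a = D.resTy f A' → D.Ty d
  tyb_val : ∀ {d : Q.Ob} (f : d ⟶ c) (a : D.Tm d) (ha : D.tyOf a = D.resTy f A'),
    D.tyb (val f a ha) = S.subTy (S.pair (F.map f) A (D.tmb a) (D.typ_inst f hA a ha)) B
  res_val : ∀ {e d : Q.Ob} (g : e ⟶ d) (f : d ⟶ c) (a : D.Tm d)
    (ha : D.tyOf a = D.resTy f A'),
    D.resTy g (val f a ha) = val (g ≫ f) (D.resTm g a) (D.tyOf_resTm g f ha)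

/-- Elements at stage `c` of
`b^• : ∀ (a : Tm(1, A)) (a^• : Tm^•(A^•, a)) → Tm^•(B^•(a^•), b[a])`, where `b : Tm(1.A, B)`. -/
structure FamTm {c : Q.Ob} {A : S.Ty (F.obj c)} {A' : D.Ty c} {hA : D.tyb A' = A}
    {B : S.Ty (S.ext A)} (B' : D.FamTy A A' hA B) (b : S.Tm (S.ext A)) (hb : S.typ b = B) where
  val : ∀ {d : Q.Ob} (f : d ⟶ c) (a : D.Tm d), D.tyOf a = D.resTy f A' → D.Tm d
  tyOf_val : ∀ {d : Q.Ob} (f : d ⟶ c) (a : D.Tm d) (ha : D.tyOf a = D.resTy f A'),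
    D.tyOf (val f a ha) = B'.val f a ha
  tmb_val : ∀ {d : Q.Ob} (f : d ⟶ c) (a : D.Tm d) (ha : D.tyOf a = D.resTy f A'),
    D.tmb (val f a ha) = S.subTm (S.pair (F.map f) A (D.tmb a) (D.typ_inst f hA a ha)) b
  res_val : ∀ {e d : Q.Ob} (g : e ⟶ d) (f : d ⟶ c) (a : D.Tm d)
    (ha : D.tyOf a = D.resTy f A'),
    D.resTm g (val f a ha) = val (g ≫ f) (D.resTm g a) (D.tyOf_resTm g f ha)

/-- Elements at stage `c` of `A^• : ∀ (i : 𝕀(1)) (i^• : 𝕀^•(i)) → Ty^•(A[i])`, where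
`A : Ty(1.𝕀)`. -/
structure FamITy {c : Q.Ob} (A : S.Ty (S.extI (F.obj c))) where
  val : ∀ {d : Q.Ob} (_ : d ⟶ c) (_ : D.I d), D.Ty d
  tyb_val : ∀ {d : Q.Ob} (f : d ⟶ c) (i : D.I d),
    D.tyb (val f i) = S.subTy (S.pairI (F.map f) (D.ib i)) A
  res_val : ∀ {e d : Q.Ob} (g : e ⟶ d) (f : d ⟶ c) (i : D.I d),
    D.resTy g (val f i) = val (g ≫ f) (D.resI g i)

/-- Elements at stage `c` of `b^• : ∀ (i : 𝕀(1)) (i^• : 𝕀^•(i)) → Tm^•(A^•(i^•), b[i])`, where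
`b : Tm(1.𝕀, A)`. -/
structure FamITm {c : Q.Ob} {A : S.Ty (S.extI (F.obj c))} (A' : D.FamITy A)
    (b : S.Tm (S.extI (F.obj c))) (hb : S.typ b = A) where
  val : ∀ {d : Q.Ob} (_ : d ⟶ c) (_ : D.I d), D.Tm d
  tyOf_val : ∀ {d : Q.Ob} (f : d ⟶ c) (i : D.I d), D.tyOf (val f i) = A'.val f i
  tmb_val : ∀ {d : Q.Ob} (f : d ⟶ c) (i : D.I d),
    D.tmb (val f i) = S.subTm (S.pairI (F.map f) (D.ib i)) b
  res_val : ∀ {e d : Q.Ob} (g : e ⟶ d) (f : d ⟶ c) (i : D.I d),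
    D.resTm g (val f i) = val (g ≫ f) (D.resI g i)

variable {D}

/-- Restriction along `f : d ⟶ c`. -/
def FamTy.res {d c : Q.Ob} (f : d ⟶ c) {A : S.Ty (F.obj c)} {A' : D.Ty c} {hA : D.tyb A' = A}
    {B : S.Ty (S.ext A)} (B' : D.FamTy A A' hA B) :
    D.FamTy (S.subTy (F.map f) A) (D.resTy f A') (by rw [D.tyb_res, hA])
      (S.subTy (S.up (F.map f) A) B) where
  val g a ha := B'.val (g ≫ f) a (by rw [D.resTy_comp, ha])
  tyb_val g a ha := by
    rw [B'.tyb_val, ← S.subTy_comp]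
    congr 1
    have h : S.typ (D.tmb a) = S.subTy (F.map g ≫ F.map f) A := by
      rw [D.typ_tmb, ha, D.tyb_res, D.tyb_res, hA, S.subTy_comp]
    rw [S.pair_up _ _ _ _ _ h]
    congr 1
    exact F.map_comp g f
  res_val h g a ha := by
    rw [B'.res_val]
    congr 1
    exact (Category.assoc _ _ _).symm

/-- Restriction along `f : d ⟶ c`. -/
def FamTm.res {d c : Q.Ob} (f : d ⟶ c) {A : S.Ty (F.obj c)} {A' : D.Ty c} {hA : D.tyb A' = A}
    {B : S.Ty (S.ext A)} {B' : D.FamTy A A' hA B} {b : S.Tm (S.ext A)} {hb : S.typ b = B}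
    (b' : D.FamTm B' b hb) :
    D.FamTm (B'.res f) (S.subTm (S.up (F.map f) A) b) (by rw [S.typ_sub, hb]) where
  val g a ha := b'.val (g ≫ f) a (by rw [D.resTy_comp, ha])
  tyOf_val g a ha := b'.tyOf_val _ _ _
  tmb_val g a ha := by
    rw [b'.tmb_val, ← S.subTm_comp]
    congr 1
    have h : S.typ (D.tmb a) = S.subTy (F.map g ≫ F.map f) A := by
      rw [D.typ_tmb, ha, D.tyb_res, D.tyb_res, hA, S.subTy_comp]
    rw [S.pair_up _ _ _ _ _ h]
    congr 1
    exact F.map_comp g f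
  res_val h g a ha := by
    rw [b'.res_val]
    congr 1
    exact (Category.assoc _ _ _).symm

/-- Restriction along `f : d ⟶ c`. -/
def FamITy.res {d c : Q.Ob} (f : d ⟶ c) {A : S.Ty (S.extI (F.obj c))} (A' : D.FamITy A) :
    D.FamITy (S.subTy (S.upI (F.map f)) A) where
  val g i := A'.val (g ≫ f) i
  tyb_val g i := by
    rw [A'.tyb_val, ← S.subTy_comp, CubAlg.pairI_upI, F.map_comp]
  res_val h g i := by
    rw [A'.res_val, Category.assoc]

/-- Restriction along `f : d ⟶ c`. -/
def FamITm.res {d c : Q.Ob} (f : d ⟶ c) {A : S.Ty (S.extI (F.obj c))} {A' : D.FamITy A}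
    {b : S.Tm (S.extI (F.obj c))} {hb : S.typ b = A} (b' : D.FamITm A' b hb) :
    D.FamITm (A'.res f) (S.subTm (S.upI (F.map f)) b) (by rw [S.typ_sub, hb]) where
  val g i := b'.val (g ≫ f) i
  tyOf_val g i := b'.tyOf_val _ _
  tmb_val g i := by
    rw [b'.tmb_val, ← S.subTm_comp, CubAlg.pairI_upI, F.map_comp]
  res_val h g i := by
    rw [b'.res_val, Category.assoc]

/-- The value `B^•(a^•)`. -/
def FamTy.app {c : Q.Ob} {A : S.Ty (F.obj c)} {A' : D.Ty c} {hA : D.tyb A' = A}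
    {B : S.Ty (S.ext A)} (B' : D.FamTy A A' hA B) (a : D.Tm c) (ha : D.tyOf a = A') : D.Ty c :=
  B'.val (𝟙 c) a (D.tyOf_id ha)

/-- The value `b^•(a^•)`. -/
def FamTm.app {c : Q.Ob} {A : S.Ty (F.obj c)} {A' : D.Ty c} {hA : D.tyb A' = A}
    {B : S.Ty (S.ext A)} {B' : D.FamTy A A' hA B} {b : S.Tm (S.ext A)} {hb : S.typ b = B}
    (b' : D.FamTm B' b hb) (a : D.Tm c) (ha : D.tyOf a = A') : D.Tm c :=
  b'.val (𝟙 c) a (D.tyOf_id ha)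

/-- The value `A^•(i^•)`. -/
def FamITy.app {c : Q.Ob} {A : S.Ty (S.extI (F.obj c))} (A' : D.FamITy A) (i : D.I c) : D.Ty c :=
  A'.val (𝟙 c) i

/-- The value `b^•(i^•)`. -/
def FamITm.app {c : Q.Ob} {A : S.Ty (S.extI (F.obj c))} {A' : D.FamITy A}
    {b : S.Tm (S.extI (F.obj c))} {hb : S.typ b = A} (b' : D.FamITm A' b hb) (i : D.I c) :
    D.Tm c :=
  b'.val (𝟙 c) i

theorem FamITy.tyb_app {c : Q.Ob} {A : S.Ty (S.extI (F.obj c))} (A' : D.FamITy A) (i : D.I c) :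
    D.tyb (A'.app i) = S.subTy (S.instI (D.ib i)) A := by
  rw [FamITy.app, A'.tyb_val, F.map_id]
  rfl

theorem FamITy.res_app {d c : Q.Ob} (f : d ⟶ c) {A : S.Ty (S.extI (F.obj c))} (A' : D.FamITy A)
    (i : D.I c) : D.resTy f (A'.app i) = (A'.res f).app (D.resI f i) := by
  rw [FamITy.app, A'.res_val]
  change A'.val (f ≫ 𝟙 c) _ = A'.val (𝟙 d ≫ f) _
  rw [Category.comp_id, Category.id_comp]

theorem FamITy.typ_end {c : Q.Ob} {A : S.Ty (S.extI (F.obj c))} (A' : D.FamITy A) (x : D.Tm c)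
    (i : D.I c) (j : S.I (F.obj c)) (hj : D.ib i = j) (hx : D.tyOf x = A'.app i) :
    S.typ (D.tmb x) = S.subTy (S.instI j) A := by
  rw [D.typ_tmb, hx, A'.tyb_app, hj]

theorem FamITy.tyOf_res_end {d c : Q.Ob} (f : d ⟶ c) {A : S.Ty (S.extI (F.obj c))}
    (A' : D.FamITy A) (x : D.Tm c) (i : D.I c) (j : D.I d) (hj : D.resI f i = j)
    (hx : D.tyOf x = A'.app i) : D.tyOf (D.resTm f x) = (A'.res f).app j := by
  rw [D.tyOf_res, hx, A'.res_app, hj]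

theorem FamITm.tyOf_app {c : Q.Ob} {A : S.Ty (S.extI (F.obj c))} {A' : D.FamITy A}
    {b : S.Tm (S.extI (F.obj c))} {hb : S.typ b = A} (b' : D.FamITm A' b hb) (i : D.I c) :
    D.tyOf (b'.app i) = A'.app i :=
  b'.tyOf_val _ _

end DispBase

end Displayed

namespace CTTModel

variable {βη : Prop} (S : CTTModel.{o, m} βη)

/-- The open term `app(t, q)` over `Γ.A`, for `t : Π(A, B)` over `Γ`. -/
def appVar {Γ : S.Ob} (A : S.Ty Γ) (B : S.Ty (S.ext A)) (t : S.Tm Γ) (ht : S.typ t = S.pi A B) :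
    S.Tm (S.ext A) :=
  S.app (S.subTy (S.p A) A) (S.subTy (S.up (S.p A) A) B) (S.subTm (S.p A) t) (S.q A)
    (by rw [S.typ_sub, ht, S.pi_sub]) (S.typ_q A)

theorem typ_appVar {Γ : S.Ob} (A : S.Ty Γ) (B : S.Ty (S.ext A)) (t : S.Tm Γ)
    (ht : S.typ t = S.pi A B) : S.typ (S.appVar A B t ht) = B := by
  have h : S.inst (S.subTy (S.p A) A) (S.q A) (S.typ_q A) ≫ S.up (S.p A) A = 𝟙 _ := by
    apply S.hom_ext_ext
    · rw [Category.assoc, CwF.up, S.pair_p, ← Category.assoc, CwF.inst, S.pair_p,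
        Category.id_comp]
    · rw [S.subTm_comp, CwF.up, S.pair_q, CwF.inst, S.pair_q, S.subTm_id]
  rw [appVar, S.typ_app, ← S.subTy_comp, h, S.subTy_id]

/-- The open term `papp(t, q)` over `Γ.𝕀`, for `t : Path(A, x, y)` over `Γ`. -/
def pappVar {Γ : S.Ob} (A : S.Ty (S.extI Γ)) (x y : S.Tm Γ)
    (hx : S.typ x = S.subTy (S.instI (S.i0 Γ)) A) (hy : S.typ y = S.subTy (S.instI (S.i1 Γ)) A)
    (t : S.Tm Γ) (ht : S.typ t = S.path A x y hx hy) : S.Tm (S.extI Γ) :=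
  S.papp (S.subTy (S.upI (S.pI Γ)) A) (S.subTm (S.pI Γ) x) (S.subTm (S.pI Γ) y)
    (S.typ_sub_end (S.pI Γ) A x _ _ (S.subI_i0 (S.pI Γ)) hx)
    (S.typ_sub_end (S.pI Γ) A y _ _ (S.subI_i1 (S.pI Γ)) hy)
    (S.subTm (S.pI Γ) t) (by rw [S.typ_sub, ht, S.path_sub]) (S.qI Γ)

theorem typ_pappVar {Γ : S.Ob} (A : S.Ty (S.extI Γ)) (x y : S.Tm Γ)
    (hx : S.typ x = S.subTy (S.instI (S.i0 Γ)) A) (hy : S.typ y = S.subTy (S.instI (S.i1 Γ)) A)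
    (t : S.Tm Γ) (ht : S.typ t = S.path A x y hx hy) :
    S.typ (S.pappVar A x y hx hy t ht) = A := by
  have h : S.instI (S.qI Γ) ≫ S.upI (S.pI Γ) = 𝟙 _ := by
    rw [CubAlg.instI, CubAlg.pairI_upI, Category.id_comp]
    apply S.hom_extI_ext
    · rw [S.pairI_p, Category.id_comp]
    · rw [S.pairI_q, S.subI_id]
  rw [pappVar, S.typ_papp, ← S.subTy_comp, h, S.subTy_id]

end CTTModel

section DisplayedModels

variable {βη : Prop} {S : CTTModel.{u, u} βη} {Q : CubAlg.{u, u}}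

/-- A displayed higher-order model of minimal cubical type theory over `F^*(Tele_S)`, in
presheaves over `Q`. -/
structure DispModel (F : CubAlg.Hom Q S.toCubAlg) extends DispBase.{u, w} F where
  pi : ∀ {c : Q.Ob} (A : S.Ty (F.obj c)) (A' : Ty c) (hA : tyb A' = A) (B : S.Ty (S.ext A))
    (_ : toDispBase.FamTy A A' hA B), Ty c
  tyb_pi : ∀ {c : Q.Ob} (A : S.Ty (F.obj c)) (A' : Ty c) (hA : tyb A' = A) (B : S.Ty (S.ext A))
    (B' : toDispBase.FamTy A A' hA B), tyb (pi A A' hA B B') = S.pi A B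
  pi_res : ∀ {d c : Q.Ob} (f : d ⟶ c) (A : S.Ty (F.obj c)) (A' : Ty c) (hA : tyb A' = A)
    (B : S.Ty (S.ext A)) (B' : toDispBase.FamTy A A' hA B),
    resTy f (pi A A' hA B B') = pi (S.subTy (F.map f) A) (resTy f A') (by rw [tyb_res, hA])
      (S.subTy (S.up (F.map f) A) B) (B'.res f)
  app : ∀ {c : Q.Ob} (A : S.Ty (F.obj c)) (A' : Ty c) (hA : tyb A' = A) (B : S.Ty (S.ext A))
    (B' : toDispBase.FamTy A A' hA B) (t a : Tm c) (_ : tyOf t = pi A A' hA B B')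
    (_ : tyOf a = A'), Tm c
  tyOf_app : ∀ {c : Q.Ob} (A : S.Ty (F.obj c)) (A' : Ty c) (hA : tyb A' = A)
    (B : S.Ty (S.ext A)) (B' : toDispBase.FamTy A A' hA B) (t a : Tm c)
    (ht : tyOf t = pi A A' hA B B') (ha : tyOf a = A'),
    tyOf (app A A' hA B B' t a ht ha) = B'.app a ha
  tmb_app : ∀ {c : Q.Ob} (A : S.Ty (F.obj c)) (A' : Ty c) (hA : tyb A' = A)
    (B : S.Ty (S.ext A)) (B' : toDispBase.FamTy A A' hA B) (t a : Tm c)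
    (ht : tyOf t = pi A A' hA B B') (ha : tyOf a = A'),
    tmb (app A A' hA B B' t a ht ha) = S.app A B (tmb t) (tmb a)
      (by rw [typ_tmb, ht, tyb_pi]) (by rw [typ_tmb, ha, hA])
  app_res : ∀ {d c : Q.Ob} (f : d ⟶ c) (A : S.Ty (F.obj c)) (A' : Ty c) (hA : tyb A' = A)
    (B : S.Ty (S.ext A)) (B' : toDispBase.FamTy A A' hA B) (t a : Tm c)
    (ht : tyOf t = pi A A' hA B B') (ha : tyOf a = A'),
    resTm f (app A A' hA B B' t a ht ha) =
      app (S.subTy (F.map f) A) (resTy f A') (by rw [tyb_res, hA])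
        (S.subTy (S.up (F.map f) A) B) (B'.res f) (resTm f t) (resTm f a)
        (by rw [tyOf_res, ht, pi_res]) (by rw [tyOf_res, ha])
  lam : ∀ {c : Q.Ob} (A : S.Ty (F.obj c)) (A' : Ty c) (hA : tyb A' = A) (B : S.Ty (S.ext A))
    (B' : toDispBase.FamTy A A' hA B) (b : S.Tm (S.ext A)) (hb : S.typ b = B)
    (_ : toDispBase.FamTm B' b hb), Tm c
  tyOf_lam : ∀ {c : Q.Ob} (A : S.Ty (F.obj c)) (A' : Ty c) (hA : tyb A' = A)
    (B : S.Ty (S.ext A)) (B' : toDispBase.FamTy A A' hA B) (b : S.Tm (S.ext A))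
    (hb : S.typ b = B) (b' : toDispBase.FamTm B' b hb),
    tyOf (lam A A' hA B B' b hb b') = pi A A' hA B B'
  tmb_lam : ∀ {c : Q.Ob} (A : S.Ty (F.obj c)) (A' : Ty c) (hA : tyb A' = A)
    (B : S.Ty (S.ext A)) (B' : toDispBase.FamTy A A' hA B) (b : S.Tm (S.ext A))
    (hb : S.typ b = B) (b' : toDispBase.FamTm B' b hb),
    tmb (lam A A' hA B B' b hb b') = S.lam A b
  lam_res : ∀ {d c : Q.Ob} (f : d ⟶ c) (A : S.Ty (F.obj c)) (A' : Ty c) (hA : tyb A' = A)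
    (B : S.Ty (S.ext A)) (B' : toDispBase.FamTy A A' hA B) (b : S.Tm (S.ext A))
    (hb : S.typ b = B) (b' : toDispBase.FamTm B' b hb),
    resTm f (lam A A' hA B B' b hb b') =
      lam (S.subTy (F.map f) A) (resTy f A') (by rw [tyb_res, hA])
        (S.subTy (S.up (F.map f) A) B) (B'.res f) (S.subTm (S.up (F.map f) A) b)
        (by rw [S.typ_sub, hb]) (b'.res f)
  pi_beta : ∀ {c : Q.Ob} (A : S.Ty (F.obj c)) (A' : Ty c) (hA : tyb A' = A)
    (B : S.Ty (S.ext A)) (B' : toDispBase.FamTy A A' hA B) (b : S.Tm (S.ext A))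
    (hb : S.typ b = B) (b' : toDispBase.FamTm B' b hb) (a : Tm c) (ha : tyOf a = A'),
    app A A' hA B B' (lam A A' hA B B' b hb b') a (tyOf_lam A A' hA B B' b hb b') ha =
      b'.app a ha
  /-- `lam^•(λ a^• ↦ app^•(t^•, a^•)) = t^•`; here `b'` is the family `λ a^• ↦ app^•(t^•, a^•)`. -/
  pi_eta : ∀ {c : Q.Ob} (A : S.Ty (F.obj c)) (A' : Ty c) (hA : tyb A' = A)
    (B : S.Ty (S.ext A)) (B' : toDispBase.FamTy A A' hA B) (t : Tm c)
    (ht : tyOf t = pi A A' hA B B')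
    (b' : toDispBase.FamTm B'
      (S.appVar A B (tmb t) (by rw [typ_tmb, ht, tyb_pi])) (S.typ_appVar A B _ _)),
    (∀ {d : Q.Ob} (f : d ⟶ c) (a : Tm d) (ha : tyOf a = resTy f A'),
      b'.val f a ha = app (S.subTy (F.map f) A) (resTy f A') (by rw [tyb_res, hA])
        (S.subTy (S.up (F.map f) A) B) (B'.res f) (resTm f t) a
        (by rw [tyOf_res, ht, pi_res]) ha) →
    lam A A' hA B B' _ _ b' = t
  path : ∀ {c : Q.Ob} (A : S.Ty (S.extI (F.obj c))) (A' : toDispBase.FamITy A) (x y : Tm c)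
    (_ : tyOf x = A'.app (i0 c)) (_ : tyOf y = A'.app (i1 c)), Ty c
  tyb_path : ∀ {c : Q.Ob} (A : S.Ty (S.extI (F.obj c))) (A' : toDispBase.FamITy A) (x y : Tm c)
    (hx : tyOf x = A'.app (i0 c)) (hy : tyOf y = A'.app (i1 c)),
    tyb (path A A' x y hx hy) = S.path A (tmb x) (tmb y)
      (A'.typ_end x _ _ (ib_i0 c) hx) (A'.typ_end y _ _ (ib_i1 c) hy)
  path_res : ∀ {d c : Q.Ob} (f : d ⟶ c) (A : S.Ty (S.extI (F.obj c)))
    (A' : toDispBase.FamITy A) (x y : Tm c)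
    (hx : tyOf x = A'.app (i0 c)) (hy : tyOf y = A'.app (i1 c)),
    resTy f (path A A' x y hx hy) =
      path (S.subTy (S.upI (F.map f)) A) (A'.res f) (resTm f x) (resTm f y)
        (A'.tyOf_res_end f x _ _ (resI_i0 f) hx) (A'.tyOf_res_end f y _ _ (resI_i1 f) hy)
  papp : ∀ {c : Q.Ob} (A : S.Ty (S.extI (F.obj c))) (A' : toDispBase.FamITy A) (x y : Tm c)
    (hx : tyOf x = A'.app (i0 c)) (hy : tyOf y = A'.app (i1 c)) (t : Tm c)
    (_ : tyOf t = path A A' x y hx hy) (_ : I c), Tm c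
  tyOf_papp : ∀ {c : Q.Ob} (A : S.Ty (S.extI (F.obj c))) (A' : toDispBase.FamITy A)
    (x y : Tm c) (hx : tyOf x = A'.app (i0 c)) (hy : tyOf y = A'.app (i1 c)) (t : Tm c)
    (ht : tyOf t = path A A' x y hx hy) (i : I c),
    tyOf (papp A A' x y hx hy t ht i) = A'.app i
  tmb_papp : ∀ {c : Q.Ob} (A : S.Ty (S.extI (F.obj c))) (A' : toDispBase.FamITy A)
    (x y : Tm c) (hx : tyOf x = A'.app (i0 c)) (hy : tyOf y = A'.app (i1 c)) (t : Tm c)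
    (ht : tyOf t = path A A' x y hx hy) (i : I c),
    tmb (papp A A' x y hx hy t ht i) = S.papp A (tmb x) (tmb y)
      (A'.typ_end x _ _ (ib_i0 c) hx) (A'.typ_end y _ _ (ib_i1 c) hy) (tmb t)
      (by rw [typ_tmb, ht, tyb_path]) (ib i)
  papp_res : ∀ {d c : Q.Ob} (f : d ⟶ c) (A : S.Ty (S.extI (F.obj c)))
    (A' : toDispBase.FamITy A) (x y : Tm c)
    (hx : tyOf x = A'.app (i0 c)) (hy : tyOf y = A'.app (i1 c)) (t : Tm c)
    (ht : tyOf t = path A A' x y hx hy) (i : I c),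
    resTm f (papp A A' x y hx hy t ht i) =
      papp (S.subTy (S.upI (F.map f)) A) (A'.res f) (resTm f x) (resTm f y)
        (A'.tyOf_res_end f x _ _ (resI_i0 f) hx) (A'.tyOf_res_end f y _ _ (resI_i1 f) hy)
        (resTm f t) (by rw [tyOf_res, ht, path_res]) (resI f i)
  papp_i0 : ∀ {c : Q.Ob} (A : S.Ty (S.extI (F.obj c))) (A' : toDispBase.FamITy A)
    (x y : Tm c) (hx : tyOf x = A'.app (i0 c)) (hy : tyOf y = A'.app (i1 c)) (t : Tm c)
    (ht : tyOf t = path A A' x y hx hy), papp A A' x y hx hy t ht (i0 c) = x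
  papp_i1 : ∀ {c : Q.Ob} (A : S.Ty (S.extI (F.obj c))) (A' : toDispBase.FamITy A)
    (x y : Tm c) (hx : tyOf x = A'.app (i0 c)) (hy : tyOf y = A'.app (i1 c)) (t : Tm c)
    (ht : tyOf t = path A A' x y hx hy), papp A A' x y hx hy t ht (i1 c) = y
  plam : ∀ {c : Q.Ob} (A : S.Ty (S.extI (F.obj c))) (A' : toDispBase.FamITy A)
    (b : S.Tm (S.extI (F.obj c))) (hb : S.typ b = A) (_ : toDispBase.FamITm A' b hb), Tm c
  tyOf_plam : ∀ {c : Q.Ob} (A : S.Ty (S.extI (F.obj c))) (A' : toDispBase.FamITy A)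
    (b : S.Tm (S.extI (F.obj c))) (hb : S.typ b = A) (b' : toDispBase.FamITm A' b hb),
    tyOf (plam A A' b hb b') =
      path A A' (b'.app (i0 c)) (b'.app (i1 c)) (b'.tyOf_app _) (b'.tyOf_app _)
  tmb_plam : ∀ {c : Q.Ob} (A : S.Ty (S.extI (F.obj c))) (A' : toDispBase.FamITy A)
    (b : S.Tm (S.extI (F.obj c))) (hb : S.typ b = A) (b' : toDispBase.FamITm A' b hb),
    tmb (plam A A' b hb b') = S.plam b
  plam_res : ∀ {d c : Q.Ob} (f : d ⟶ c) (A : S.Ty (S.extI (F.obj c)))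
    (A' : toDispBase.FamITy A) (b : S.Tm (S.extI (F.obj c))) (hb : S.typ b = A)
    (b' : toDispBase.FamITm A' b hb),
    resTm f (plam A A' b hb b') =
      plam (S.subTy (S.upI (F.map f)) A) (A'.res f) (S.subTm (S.upI (F.map f)) b)
        (by rw [S.typ_sub, hb]) (b'.res f)
  path_beta : βη → ∀ {c : Q.Ob} (A : S.Ty (S.extI (F.obj c))) (A' : toDispBase.FamITy A)
    (b : S.Tm (S.extI (F.obj c))) (hb : S.typ b = A) (b' : toDispBase.FamITm A' b hb) (i : I c),
    papp A A' _ _ (b'.tyOf_app _) (b'.tyOf_app _) (plam A A' b hb b')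
      (tyOf_plam A A' b hb b') i = b'.app i
  /-- `plam^•(λ i^• ↦ papp^•(t^•, i^•)) = t^•`; here `b'` is the family
  `λ i^• ↦ papp^•(t^•, i^•)`. -/
  path_eta : βη → ∀ {c : Q.Ob} (A : S.Ty (S.extI (F.obj c))) (A' : toDispBase.FamITy A)
    (x y : Tm c) (hx : tyOf x = A'.app (i0 c)) (hy : tyOf y = A'.app (i1 c)) (t : Tm c)
    (ht : tyOf t = path A A' x y hx hy)
    (b' : toDispBase.FamITm A'
      (S.pappVar A (tmb x) (tmb y) (A'.typ_end x _ _ (ib_i0 c) hx)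
        (A'.typ_end y _ _ (ib_i1 c) hy) (tmb t) (by rw [typ_tmb, ht, tyb_path]))
      (S.typ_pappVar A _ _ _ _ _ _)),
    (∀ {d : Q.Ob} (f : d ⟶ c) (i : I d),
      b'.val f i = papp (S.subTy (S.upI (F.map f)) A) (A'.res f) (resTm f x) (resTm f y)
        (A'.tyOf_res_end f x _ _ (resI_i0 f) hx) (A'.tyOf_res_end f y _ _ (resI_i1 f) hy)
        (resTm f t) (by rw [tyOf_res, ht, path_res]) i) →
    plam A A' _ _ b' = t

/-! # Sections of the displayed contextualization -/

/-- A telescope `T` over `F(c)` together with a global element `sub` of `T` in the slice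
`S ⫽ F(c)` (a closing substitution), i.e. a section of the projection `F(c).T ⟶ F(c)`. -/
structure Closing (F : CubAlg.Hom Q S.toCubAlg) (c : Q.Ob) where
  ctx : S.Ob
  tele : CwF.Tele S.toCwF (F.obj c) ctx
  sub : F.obj c ⟶ ctx
  sub_proj : sub ≫ tele.proj = 𝟙 (F.obj c)

namespace Closing

variable {F : CubAlg.Hom Q S.toCubAlg}

/-- Restriction of `(T, γ)` along `f : d ⟶ c`. -/
def restr {d c : Q.Ob} (f : d ⟶ c) (x : Closing F c) : Closing F d where
  ctx := (x.tele.pull (F.map f)).ctx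
  tele := (x.tele.pull (F.map f)).tele
  sub := (x.tele.lift (F.map f) (𝟙 _) (F.map f ≫ x.sub)
    (by rw [Category.assoc, x.sub_proj, Category.comp_id, Category.id_comp])).1
  sub_proj := (x.tele.lift (F.map f) (𝟙 _) (F.map f ≫ x.sub) _).2.1

/-- The canonical map from the total context of `T[F(f)]` to that of `T`. -/
def restrMap {d c : Q.Ob} (f : d ⟶ c) (x : Closing F c) : (x.restr f).ctx ⟶ x.ctx :=
  (x.tele.pull (F.map f)).map

/-- The empty telescope, with its unique closing substitution `⋆`. -/
def nil (F : CubAlg.Hom Q S.toCubAlg) (c : Q.Ob) : Closing F c :=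
  ⟨F.obj c, .nil, 𝟙 _, Category.id_comp _⟩

/-- The telescope `T.A` with the closing substitution `⟨γ, a⟩`. -/
def snoc {c : Q.Ob} (x : Closing F c) (A : S.Ty x.ctx) (a : S.Tm (F.obj c))
    (ha : S.typ a = S.subTy x.sub A) : Closing F c :=
  ⟨S.ext A, .snoc x.tele A, S.pair x.sub A a ha, by
    change _ ≫ S.p A ≫ x.tele.proj = _
    rw [← Category.assoc, S.pair_p, x.sub_proj]⟩

/-- The telescope `T.𝕀` with the closing substitution `⟨γ, i⟩`. -/
def snocI {c : Q.Ob} (x : Closing F c) (i : S.I (F.obj c)) : Closing F c :=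
  ⟨S.extI x.ctx, .snocI x.tele, S.pairI x.sub i, by
    change _ ≫ S.pI _ ≫ x.tele.proj = _
    rw [← Category.assoc, S.pairI_p, x.sub_proj]⟩

/-- `(T', σ ∘ γ)` for a morphism `σ : T ⟶ T'` of the slice `S ⫽ F(c)`. -/
def push {c : Q.Ob} (x : Closing F c) {Δ : S.Ob} (T : CwF.Tele S.toCwF (F.obj c) Δ)
    (σ : x.ctx ⟶ Δ) (hσ : σ ≫ T.proj = x.tele.proj) : Closing F c :=
  ⟨Δ, T, x.sub ≫ σ, by rw [Category.assoc, hσ, x.sub_proj]⟩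

end Closing

/-- The restriction along `f : d ⟶ c` of a morphism `σ : T ⟶ T'` of the slice `S ⫽ F(c)`, as a
morphism `T[F(f)] ⟶ T'[F(f)]` of `S ⫽ F(d)`. -/
def restrHom {F : CubAlg.Hom Q S.toCubAlg} {d c : Q.Ob} (f : d ⟶ c) {Δ Δ' : S.Ob}
    (T : CwF.Tele S.toCwF (F.obj c) Δ) (T' : CwF.Tele S.toCwF (F.obj c) Δ') (σ : Δ ⟶ Δ')
    (hσ : σ ≫ T'.proj = T.proj) :
    {τ : (T.pull (F.map f)).ctx ⟶ (T'.pull (F.map f)).ctx //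
      τ ≫ (T'.pull (F.map f)).tele.proj = (T.pull (F.map f)).tele.proj ∧
        τ ≫ (T'.pull (F.map f)).map = (T.pull (F.map f)).map ≫ σ} :=
  T'.lift (F.map f) (T.pull (F.map f)).tele.proj ((T.pull (F.map f)).map ≫ σ)
    (by rw [Category.assoc, hσ, (T.pull (F.map f)).comm])

namespace DispModel

/-- The judgemental part of a section of the displayed contextualization `Scone_D` (see
`SconeSection`). -/
structure SconeSectionBase {F : CubAlg.Hom Q S.toCubAlg} (D : DispModel.{u, w} F) where
  /-- The environments `⟦T⟧(γ)`. -/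
  Env : ∀ {c : Q.Ob}, Closing F c → Type w
  res : ∀ {d c : Q.Ob} (f : d ⟶ c) (x : Closing F c), Env x → Env (x.restr f)
  res_id : ∀ {c : Q.Ob} (x : Closing F c) (e : Env x), HEq (res (𝟙 c) x e) e
  res_comp : ∀ {d' d c : Q.Ob} (g : d' ⟶ d) (f : d ⟶ c) (x : Closing F c) (e : Env x),
    HEq (res (g ≫ f) x e) (res g (x.restr f) (res f x e))
  /-- The interpretation `⟦σ⟧ : ⟦T⟧(γ) → ⟦T'⟧(σ ∘ γ)` of a morphism `σ : T ⟶ T'`. -/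
  hom : ∀ {c : Q.Ob} (x : Closing F c) {Δ : S.Ob} (T' : CwF.Tele S.toCwF (F.obj c) Δ)
    (σ : x.ctx ⟶ Δ) (hσ : σ ≫ T'.proj = x.tele.proj), Env x → Env (x.push T' σ hσ)
  hom_res : ∀ {d c : Q.Ob} (f : d ⟶ c) (x : Closing F c) {Δ : S.Ob}
    (T' : CwF.Tele S.toCwF (F.obj c) Δ) (σ : x.ctx ⟶ Δ) (hσ : σ ≫ T'.proj = x.tele.proj)
    (e : Env x),
    HEq (res f _ (hom x T' σ hσ e))
      (hom (x.restr f) (T'.pull (F.map f)).tele (restrHom f x.tele T' σ hσ).1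
        (restrHom f x.tele T' σ hσ).2.1 (res f x e))
  hom_id : ∀ {c : Q.Ob} (x : Closing F c) (e : Env x),
    HEq (hom x x.tele (𝟙 x.ctx) (Category.id_comp _) e) e
  hom_comp : ∀ {c : Q.Ob} (x : Closing F c) {Δ Δ' : S.Ob}
    (T' : CwF.Tele S.toCwF (F.obj c) Δ) (T'' : CwF.Tele S.toCwF (F.obj c) Δ')
    (σ : x.ctx ⟶ Δ) (τ : Δ ⟶ Δ') (hσ : σ ≫ T'.proj = x.tele.proj) (hτ : τ ≫ T''.proj = T'.proj)
    (e : Env x),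
    HEq (hom x T'' (σ ≫ τ) (by rw [Category.assoc, hτ, hσ]) e)
      (hom (x.push T' σ hσ) T'' τ hτ (hom x T' σ hσ e))
  /-- The interpretation of a type over `T`. -/
  ty : ∀ {c : Q.Ob} (x : Closing F c) (_ : S.Ty x.ctx), Env x → D.Ty c
  tyb_ty : ∀ {c : Q.Ob} (x : Closing F c) (A : S.Ty x.ctx) (e : Env x),
    D.tyb (ty x A e) = S.subTy x.sub A
  ty_res : ∀ {d c : Q.Ob} (f : d ⟶ c) (x : Closing F c) (A : S.Ty x.ctx) (e : Env x),
    D.resTy f (ty x A e) = ty (x.restr f) (S.subTy (x.restrMap f) A) (res f x e)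
  ty_sub : ∀ {c : Q.Ob} (x : Closing F c) {Δ : S.Ob} (T' : CwF.Tele S.toCwF (F.obj c) Δ)
    (σ : x.ctx ⟶ Δ) (hσ : σ ≫ T'.proj = x.tele.proj) (A : S.Ty Δ) (e : Env x),
    ty x (S.subTy σ A) e = ty (x.push T' σ hσ) A (hom x T' σ hσ e)
  /-- The interpretation of a term over `T`. -/
  tm : ∀ {c : Q.Ob} (x : Closing F c) (_ : S.Tm x.ctx), Env x → D.Tm c
  tyOf_tm : ∀ {c : Q.Ob} (x : Closing F c) (a : S.Tm x.ctx) (e : Env x),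
    D.tyOf (tm x a e) = ty x (S.typ a) e
  tmb_tm : ∀ {c : Q.Ob} (x : Closing F c) (a : S.Tm x.ctx) (e : Env x),
    D.tmb (tm x a e) = S.subTm x.sub a
  tm_res : ∀ {d c : Q.Ob} (f : d ⟶ c) (x : Closing F c) (a : S.Tm x.ctx) (e : Env x),
    D.resTm f (tm x a e) = tm (x.restr f) (S.subTm (x.restrMap f) a) (res f x e)
  tm_sub : ∀ {c : Q.Ob} (x : Closing F c) {Δ : S.Ob} (T' : CwF.Tele S.toCwF (F.obj c) Δ)
    (σ : x.ctx ⟶ Δ) (hσ : σ ≫ T'.proj = x.tele.proj) (a : S.Tm Δ) (e : Env x),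
    tm x (S.subTm σ a) e = tm (x.push T' σ hσ) a (hom x T' σ hσ e)
  /-- The interpretation of an interval element over `T`. -/
  int : ∀ {c : Q.Ob} (x : Closing F c) (_ : S.I x.ctx), Env x → D.I c
  ib_int : ∀ {c : Q.Ob} (x : Closing F c) (i : S.I x.ctx) (e : Env x),
    D.ib (int x i e) = S.subI x.sub i
  int_res : ∀ {d c : Q.Ob} (f : d ⟶ c) (x : Closing F c) (i : S.I x.ctx) (e : Env x),
    D.resI f (int x i e) = int (x.restr f) (S.subI (x.restrMap f) i) (res f x e)
  int_sub : ∀ {c : Q.Ob} (x : Closing F c) {Δ : S.Ob} (T' : CwF.Tele S.toCwF (F.obj c) Δ)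
    (σ : x.ctx ⟶ Δ) (hσ : σ ≫ T'.proj = x.tele.proj) (i : S.I Δ) (e : Env x),
    int x (S.subI σ i) e = int (x.push T' σ hσ) i (hom x T' σ hσ e)
  /-- `⟦1⟧(⋆) = {⋆}`. -/
  env_nil : ∀ c : Q.Ob, Env (Closing.nil F c) = PUnit.{w + 1}
  /-- `⟦T.A⟧(γ, a) = (γ^• : ⟦T⟧(γ)) × Tm^•(⟦A⟧(γ^•), a)`. -/
  env_snoc : ∀ {c : Q.Ob} (x : Closing F c) (A : S.Ty x.ctx) (a : S.Tm (F.obj c))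
    (ha : S.typ a = S.subTy x.sub A),
    Env (x.snoc A a ha) =
      ((e : Env x) × {a' : D.Tm c // D.tyOf a' = ty x A e ∧ D.tmb a' = a})
  /-- `⟦T.𝕀⟧(γ, i) = ⟦T⟧(γ) × 𝕀^•(i)`. -/
  env_snocI : ∀ {c : Q.Ob} (x : Closing F c) (i : S.I (F.obj c)),
    Env (x.snocI i) = (Env x × {i' : D.I c // D.ib i' = i})

namespace SconeSectionBase

variable {F : CubAlg.Hom Q S.toCubAlg} {D : DispModel.{u, w} F} (s : SconeSectionBase D)

theorem typ_tmb_of_tyOf {c : Q.Ob} (x : Closing F c) (A : S.Ty x.ctx) (e : s.Env x) (a : D.Tm c)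
    (ha : D.tyOf a = s.ty x A e) : S.typ (D.tmb a) = S.subTy x.sub A := by
  rw [D.typ_tmb, ha, s.tyb_ty]

/-- The environment `(γ^•, a^•)` of `T.A`. -/
def pair {c : Q.Ob} (x : Closing F c) (A : S.Ty x.ctx) (e : s.Env x) (a : D.Tm c)
    (ha : D.tyOf a = s.ty x A e) :
    s.Env (x.snoc A (D.tmb a) (s.typ_tmb_of_tyOf x A e a ha)) :=
  cast (s.env_snoc x A (D.tmb a) _).symm ⟨e, a, ha, rfl⟩

/-- The environment `(γ^•, i^•)` of `T.𝕀`. -/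
def pairI {c : Q.Ob} (x : Closing F c) (e : s.Env x) (i : D.I c) :
    s.Env (x.snocI (D.ib i)) :=
  cast (s.env_snocI x (D.ib i)).symm ⟨e, i, rfl⟩

theorem tyOf_restr {d c : Q.Ob} (f : d ⟶ c) (x : Closing F c) (A : S.Ty x.ctx) (e : s.Env x)
    (a : D.Tm d) (ha : D.tyOf a = D.resTy f (s.ty x A e)) :
    D.tyOf a = s.ty (x.restr f) (S.subTy (x.restrMap f) A) (s.res f x e) := by
  rw [ha, s.ty_res]

end SconeSectionBase

/-- A section `⟦-⟧` of the displayed contextualization `Scone_D` over `F^*(Tele_S)`, in presheaves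
over `Q`.  Objects of `Scone_D` over a telescope `T` are dependent presheaves over the closing
substitutions of `T`; a (global) family of those for all `T` is a dependent presheaf `Env` over
the presheaf `Closing F` of pairs `(T, γ)`.  All operations of the section are natural in the
stage, and all structure is preserved strictly. -/
structure SconeSection {F : CubAlg.Hom Q S.toCubAlg} (D : DispModel.{u, w} F) extends
    SconeSectionBase D where
  /-- `⟦p⟧(γ^•, a^•) = γ^•` and `⟦q⟧(γ^•, a^•) = a^•`. -/
  hom_p : ∀ {c : Q.Ob} (x : Closing F c) (A : S.Ty x.ctx) (e : Env x) (a : D.Tm c)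
    (ha : D.tyOf a = ty x A e),
    HEq (hom _ x.tele (S.p A) rfl (toSconeSectionBase.pair x A e a ha)) e
  tm_q : ∀ {c : Q.Ob} (x : Closing F c) (A : S.Ty x.ctx) (e : Env x) (a : D.Tm c)
    (ha : D.tyOf a = ty x A e),
    tm _ (S.q A) (toSconeSectionBase.pair x A e a ha) = a
  /-- `⟦p⟧(γ^•, i^•) = γ^•` and `⟦q⟧(γ^•, i^•) = i^•`. -/
  hom_pI : ∀ {c : Q.Ob} (x : Closing F c) (e : Env x) (i : D.I c),
    HEq (hom _ x.tele (S.pI x.ctx) rfl (toSconeSectionBase.pairI x e i)) e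
  int_qI : ∀ {c : Q.Ob} (x : Closing F c) (e : Env x) (i : D.I c),
    int _ (S.qI x.ctx) (toSconeSectionBase.pairI x e i) = i
  int_i0 : ∀ {c : Q.Ob} (x : Closing F c) (e : Env x), int x (S.i0 x.ctx) e = D.i0 c
  int_i1 : ∀ {c : Q.Ob} (x : Closing F c) (e : Env x), int x (S.i1 x.ctx) e = D.i1 c
  /-- The family `λ a^• ↦ ⟦B⟧(γ^•, a^•)`, for a type `B` over `T.A`. -/
  bodyTy : ∀ {c : Q.Ob} (x : Closing F c) (A : S.Ty x.ctx) (B : S.Ty (S.ext A)) (e : Env x),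
    D.FamTy (S.subTy x.sub A) (ty x A e) (tyb_ty x A e) (S.subTy (S.up x.sub A) B)
  bodyTy_val : ∀ {d c : Q.Ob} (f : d ⟶ c) (x : Closing F c) (A : S.Ty x.ctx)
    (B : S.Ty (S.ext A)) (e : Env x) (a : D.Tm d) (ha : D.tyOf a = D.resTy f (ty x A e)),
    (bodyTy x A B e).val f a ha =
      ty _ (S.subTy (S.up (x.restrMap f) A) B)
        (toSconeSectionBase.pair (x.restr f) (S.subTy (x.restrMap f) A) (res f x e) a
          (toSconeSectionBase.tyOf_restr f x A e a ha))
  /-- The family `λ a^• ↦ ⟦b⟧(γ^•, a^•)`, for a term `b` over `T.A`. -/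
  bodyTm : ∀ {c : Q.Ob} (x : Closing F c) (A : S.Ty x.ctx) (b : S.Tm (S.ext A)) (e : Env x),
    D.FamTm (bodyTy x A (S.typ b) e) (S.subTm (S.up x.sub A) b) (S.typ_sub _ _)
  bodyTm_val : ∀ {d c : Q.Ob} (f : d ⟶ c) (x : Closing F c) (A : S.Ty x.ctx)
    (b : S.Tm (S.ext A)) (e : Env x) (a : D.Tm d) (ha : D.tyOf a = D.resTy f (ty x A e)),
    (bodyTm x A b e).val f a ha =
      tm _ (S.subTm (S.up (x.restrMap f) A) b)
        (toSconeSectionBase.pair (x.restr f) (S.subTy (x.restrMap f) A) (res f x e) a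
          (toSconeSectionBase.tyOf_restr f x A e a ha))
  /-- The family `λ i^• ↦ ⟦A⟧(γ^•, i^•)`, for a type `A` over `T.𝕀`. -/
  bodyITy : ∀ {c : Q.Ob} (x : Closing F c) (A : S.Ty (S.extI x.ctx)) (_ : Env x),
    D.FamITy (S.subTy (S.upI x.sub) A)
  bodyITy_val : ∀ {d c : Q.Ob} (f : d ⟶ c) (x : Closing F c) (A : S.Ty (S.extI x.ctx))
    (e : Env x) (i : D.I d),
    (bodyITy x A e).val f i =
      ty _ (S.subTy (S.upI (x.restrMap f)) A)
        (toSconeSectionBase.pairI (x.restr f) (res f x e) i)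
  /-- The family `λ i^• ↦ ⟦b⟧(γ^•, i^•)`, for a term `b` over `T.𝕀`. -/
  bodyITm : ∀ {c : Q.Ob} (x : Closing F c) (b : S.Tm (S.extI x.ctx)) (e : Env x),
    D.FamITm (bodyITy x (S.typ b) e) (S.subTm (S.upI x.sub) b) (S.typ_sub _ _)
  bodyITm_val : ∀ {d c : Q.Ob} (f : d ⟶ c) (x : Closing F c) (b : S.Tm (S.extI x.ctx))
    (e : Env x) (i : D.I d),
    (bodyITm x b e).val f i =
      tm _ (S.subTm (S.upI (x.restrMap f)) b)
        (toSconeSectionBase.pairI (x.restr f) (res f x e) i)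
  ty_pi : ∀ {c : Q.Ob} (x : Closing F c) (A : S.Ty x.ctx) (B : S.Ty (S.ext A)) (e : Env x),
    ty x (S.pi A B) e = D.pi (S.subTy x.sub A) (ty x A e) (tyb_ty x A e)
      (S.subTy (S.up x.sub A) B) (bodyTy x A B e)
  tm_lam : ∀ {c : Q.Ob} (x : Closing F c) (A : S.Ty x.ctx) (b : S.Tm (S.ext A)) (e : Env x),
    tm x (S.lam A b) e = D.lam (S.subTy x.sub A) (ty x A e) (tyb_ty x A e)
      (S.subTy (S.up x.sub A) (S.typ b)) (bodyTy x A (S.typ b) e)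
      (S.subTm (S.up x.sub A) b) (S.typ_sub _ _) (bodyTm x A b e)
  tm_app : ∀ {c : Q.Ob} (x : Closing F c) (A : S.Ty x.ctx) (B : S.Ty (S.ext A))
    (t a : S.Tm x.ctx) (ht : S.typ t = S.pi A B) (ha : S.typ a = A) (e : Env x),
    tm x (S.app A B t a ht ha) e = D.app (S.subTy x.sub A) (ty x A e) (tyb_ty x A e)
      (S.subTy (S.up x.sub A) B) (bodyTy x A B e) (tm x t e) (tm x a e)
      (by rw [tyOf_tm, ht, ty_pi]) (by rw [tyOf_tm, ha])
  /-- The endpoint `x` of `Path(A, x, y)` is interpreted in type `⟦A⟧(γ^•, 0^•)`. -/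
  tyOf_end0 : ∀ {c : Q.Ob} (x : Closing F c) (A : S.Ty (S.extI x.ctx)) (a : S.Tm x.ctx)
    (_ : S.typ a = S.subTy (S.instI (S.i0 x.ctx)) A) (e : Env x),
    D.tyOf (tm x a e) = (bodyITy x A e).app (D.i0 c)
  /-- The endpoint `y` of `Path(A, x, y)` is interpreted in type `⟦A⟧(γ^•, 1^•)`. -/
  tyOf_end1 : ∀ {c : Q.Ob} (x : Closing F c) (A : S.Ty (S.extI x.ctx)) (a : S.Tm x.ctx)
    (_ : S.typ a = S.subTy (S.instI (S.i1 x.ctx)) A) (e : Env x),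
    D.tyOf (tm x a e) = (bodyITy x A e).app (D.i1 c)
  ty_path : ∀ {c : Q.Ob} (x : Closing F c) (A : S.Ty (S.extI x.ctx)) (a b : S.Tm x.ctx)
    (ha : S.typ a = S.subTy (S.instI (S.i0 x.ctx)) A)
    (hb : S.typ b = S.subTy (S.instI (S.i1 x.ctx)) A) (e : Env x),
    ty x (S.path A a b ha hb) e = D.path (S.subTy (S.upI x.sub) A) (bodyITy x A e)
      (tm x a e) (tm x b e) (tyOf_end0 x A a ha e) (tyOf_end1 x A b hb e)
  tm_papp : ∀ {c : Q.Ob} (x : Closing F c) (A : S.Ty (S.extI x.ctx)) (a b : S.Tm x.ctx)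
    (ha : S.typ a = S.subTy (S.instI (S.i0 x.ctx)) A)
    (hb : S.typ b = S.subTy (S.instI (S.i1 x.ctx)) A) (t : S.Tm x.ctx)
    (ht : S.typ t = S.path A a b ha hb) (i : S.I x.ctx) (e : Env x),
    tm x (S.papp A a b ha hb t ht i) e = D.papp (S.subTy (S.upI x.sub) A) (bodyITy x A e)
      (tm x a e) (tm x b e) (tyOf_end0 x A a ha e) (tyOf_end1 x A b hb e) (tm x t e)
      (by rw [tyOf_tm, ht, ty_path]) (int x i e)
  tm_plam : ∀ {c : Q.Ob} (x : Closing F c) (b : S.Tm (S.extI x.ctx)) (e : Env x),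
    tm x (S.plam b) e = D.plam (S.subTy (S.upI x.sub) (S.typ b)) (bodyITy x (S.typ b) e)
      (S.subTm (S.upI x.sub) b) (S.typ_sub _ _) (bodyITm x b e)

end DispModel

end DisplayedModels

/-! # Substitution calculus in first-order models -/

namespace CwF

variable (M : CwF.{o, m})

/-! The proof is a gluing argument that uses the initiality of `S` and then, separately, the
initiality of `Q`.

Every object Γ of `S` has a nerve, the presheaf c ↦ S(F c, Γ) on `Q`. Gluing along the nerve gives a
category whose objects are an object Γ with a presheaf of environments over its nerve. A type there
is a type A of `S` with, for each environment over γ, a displayed type over the closed type A[γ],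
naturally in the stage; terms and interval elements are treated alike. Each operation of `D` acts on
closed data and families over them, which is what evaluation at an environment produces, so the
glued category is a first-order model `glueModel D`. Initiality of `S` yields a morphism into it,
and uniqueness forces its projection back to `S` to be the canonical lift of `S` to larger
universes. Hence it is a section, and reading off its values gives an interpretation (`Interp`, by
`CTTModel.IsInitial.nonempty_interp`): presheaves of environments `J.E Γ` over the nerves, in which
all of `S` is interpreted.

This is not yet a section of the displayed contextualization. There the contexts at stage c are
telescopes over F(c), and the empty telescope must have exactly one environment, whereas `J.E (F.obj
c) c` may have many. What is missing is an element of `J.E (F.obj c) c` over the identity, natural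
in c. Objects of `Q` equipped with such an element form a cubical algebra over `Q` (`pointAlg`) when
its interval elements are restricted to those whose interpretation is prescribed by `intD`; the
compatibility of `intD` with 0, 1, restriction and projection to `S` makes the construction close
up. Initiality of `Q` gives a section of this algebra (`CubAlg.IsInitial.exists_point`), that is,
the natural family of points together with the equation on interval elements that the theorem asks
for.

The environments of a telescope T over γ are then the elements of `J.E` at the total context that
lie over γ and project to the chosen point. To make the equations for context extension hold
strictly they are defined by recursion on T, with an injection `incl` into `J.E`. The laws of the
section are checked after applying `incl`, where they become laws of `J`; restriction uses that
`J.E` turns substituted telescopes into pullbacks (`exists_env_pull`, `env_pull_ext`). -/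

theorem subTy_eqToHom_heq {Γ Δ : M.Ob} (h : Δ = Γ) (A : M.Ty Γ) :
    HEq (M.subTy (eqToHom h) A) A := by
  subst h; rw [eqToHom_refl, M.subTy_id]

theorem subTm_eqToHom_heq {Γ Δ : M.Ob} (h : Δ = Γ) (a : M.Tm Γ) :
    HEq (M.subTm (eqToHom h) a) a := by
  subst h; rw [eqToHom_refl, M.subTm_id]

theorem pair_congr {Δ Γ : M.Ob} {f f' : Δ ⟶ Γ} {A : M.Ty Γ} {a a' : M.Tm Δ} (hf : f = f')
    (ha : a = a') (h : M.typ a = M.subTy f A) (h' : M.typ a' = M.subTy f' A) :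
    M.pair f A a h = M.pair f' A a' h' := by
  subst hf ha; rfl

/-- The two sides start at contexts that agree only by functoriality of substitution, hence the
`eqToHom`. The composite is a free variable `k`, because in use it is the closing substitution of a
restricted environment, which is a composite only propositionally. -/
theorem up_comp {Θ Δ Γ : M.Ob} (g : Θ ⟶ Δ) (f : Δ ⟶ Γ) {k : Θ ⟶ Γ} (hk : k = g ≫ f)
    (A : M.Ty Γ) :
    M.up g (M.subTy f A) ≫ M.up f A =
      eqToHom (by rw [hk, M.subTy_comp]) ≫ M.up k A := by
  -- With the type replaced by a variable `A'`, the equality of types can be eliminated and the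
  -- `eqToHom` becomes an identity.
  have key : ∀ (A' : M.Ty Θ) (h : A' = M.subTy k A) (h' : M.ext A' = M.ext (M.subTy k A)),
      eqToHom h' ≫ M.up k A = M.pair (M.p A' ≫ k) A (M.q A')
        (by rw [M.typ_q, h, M.subTy_comp]) := by
    intro A' h h'
    subst h
    rw [eqToHom_refl, Category.id_comp]
    rfl
  rw [key _ (by rw [hk, M.subTy_comp])]
  apply M.hom_ext_ext
  · rw [Category.assoc, up, up, M.pair_p, ← Category.assoc, M.pair_p, M.pair_p, hk, Category.assoc]
  · rw [M.subTm_comp, up, up, M.pair_q, M.pair_q, M.pair_q]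

theorem subTy_up_comp {Θ Δ Γ : M.Ob} (g : Θ ⟶ Δ) (f : Δ ⟶ Γ) {k : Θ ⟶ Γ} (hk : k = g ≫ f)
    (A : M.Ty Γ) (B : M.Ty (M.ext A)) :
    HEq (M.subTy (M.up k A) B) (M.subTy (M.up g (M.subTy f A)) (M.subTy (M.up f A) B)) := by
  rw [← M.subTy_comp (M.up g (M.subTy f A)), M.up_comp g f hk, M.subTy_comp]
  exact (M.subTy_eqToHom_heq _ _).symm

theorem subTm_up_comp {Θ Δ Γ : M.Ob} (g : Θ ⟶ Δ) (f : Δ ⟶ Γ) {k : Θ ⟶ Γ} (hk : k = g ≫ f)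
    (A : M.Ty Γ) (b : M.Tm (M.ext A)) :
    HEq (M.subTm (M.up k A) b) (M.subTm (M.up g (M.subTy f A)) (M.subTm (M.up f A) b)) := by
  rw [← M.subTm_comp (M.up g (M.subTy f A)), M.up_comp g f hk, M.subTm_comp]
  exact (M.subTm_eqToHom_heq _ _).symm

theorem subTy_upI_comp {Θ Δ Γ : M.Ob} (g : Θ ⟶ Δ) (f : Δ ⟶ Γ) {k : Θ ⟶ Γ} (hk : k = g ≫ f)
    (A : M.Ty (M.extI Γ)) :
    M.subTy (M.upI k) A = M.subTy (M.upI g) (M.subTy (M.upI f) A) := by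
  rw [← M.subTy_comp, hk, CubAlg.upI, CubAlg.upI, CubAlg.pairI_upI, Category.assoc]

theorem subTm_upI_comp {Θ Δ Γ : M.Ob} (g : Θ ⟶ Δ) (f : Δ ⟶ Γ) {k : Θ ⟶ Γ} (hk : k = g ≫ f)
    (a : M.Tm (M.extI Γ)) :
    M.subTm (M.upI k) a = M.subTm (M.upI g) (M.subTm (M.upI f) a) := by
  rw [← M.subTm_comp, hk, CubAlg.upI, CubAlg.upI, CubAlg.pairI_upI, Category.assoc]

theorem subTy_pair_up {Θ Δ Γ : M.Ob} (g : Θ ⟶ Δ) (f : Δ ⟶ Γ) {k : Θ ⟶ Γ} (hk : k = g ≫ f)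
    (A : M.Ty Γ) (B : M.Ty (M.ext A)) (a : M.Tm Θ) (h : M.typ a = M.subTy g (M.subTy f A))
    (h' : M.typ a = M.subTy k A) :
    M.subTy (M.pair k A a h') B = M.subTy (M.pair g (M.subTy f A) a h) (M.subTy (M.up f A) B) := by
  subst hk
  rw [← M.subTy_comp, M.pair_up _ _ _ _ _ h']

theorem subTm_pair_up {Θ Δ Γ : M.Ob} (g : Θ ⟶ Δ) (f : Δ ⟶ Γ) {k : Θ ⟶ Γ} (hk : k = g ≫ f)
    (A : M.Ty Γ) (b : M.Tm (M.ext A)) (a : M.Tm Θ) (h : M.typ a = M.subTy g (M.subTy f A))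
    (h' : M.typ a = M.subTy k A) :
    M.subTm (M.pair k A a h') b = M.subTm (M.pair g (M.subTy f A) a h) (M.subTm (M.up f A) b) := by
  subst hk
  rw [← M.subTm_comp, M.pair_up _ _ _ _ _ h']

end CwF

namespace CTTModel

variable {βη : Prop} (S : CTTModel.{o, m} βη)

/-- The later arguments and the typing proofs depend on `A`, so rewriting inside an application is
ill-typed. The congruence lemmas here and for displayed models replace all arguments at once. -/
theorem app_congr {Γ : S.Ob} {A A' : S.Ty Γ} (hA : A = A') {B : S.Ty (S.ext A)}
    {B' : S.Ty (S.ext A')} (hB : HEq B B') {t t' : S.Tm Γ} (ht : t = t') {a a' : S.Tm Γ}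
    (ha : a = a') (h1 : S.typ t = S.pi A B) (h2 : S.typ a = A) (h1' : S.typ t' = S.pi A' B')
    (h2' : S.typ a' = A') : S.app A B t a h1 h2 = S.app A' B' t' a' h1' h2' := by
  subst hA ht ha; cases hB; rfl

theorem path_congr {Γ : S.Ob} {A A' : S.Ty (S.extI Γ)} (hA : A = A') {x x' y y' : S.Tm Γ}
    (hx : x = x') (hy : y = y')
    (h1 : S.typ x = S.subTy (S.instI (S.i0 Γ)) A) (h2 : S.typ y = S.subTy (S.instI (S.i1 Γ)) A)
    (h1' : S.typ x' = S.subTy (S.instI (S.i0 Γ)) A')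
    (h2' : S.typ y' = S.subTy (S.instI (S.i1 Γ)) A') :
    S.path A x y h1 h2 = S.path A' x' y' h1' h2' := by
  subst hA hx hy; rfl

theorem papp_congr {Γ : S.Ob} {A A' : S.Ty (S.extI Γ)} (hA : A = A') {x x' y y' t t' : S.Tm Γ}
    (hx : x = x') (hy : y = y') (ht : t = t') {i i' : S.I Γ} (hi : i = i')
    (h1 : S.typ x = S.subTy (S.instI (S.i0 Γ)) A) (h2 : S.typ y = S.subTy (S.instI (S.i1 Γ)) A)
    (h3 : S.typ t = S.path A x y h1 h2)
    (h1' : S.typ x' = S.subTy (S.instI (S.i0 Γ)) A')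
    (h2' : S.typ y' = S.subTy (S.instI (S.i1 Γ)) A')
    (h3' : S.typ t' = S.path A' x' y' h1' h2') :
    S.papp A x y h1 h2 t h3 i = S.papp A' x' y' h1' h2' t' h3' i' := by
  subst hA hx hy ht hi; rfl

/-- Needed for η in the glued model: the displayed η-rule speaks of the η-expansion of a closed
instance of `t`, the glued one of an instance of the η-expansion. -/
theorem appVar_sub {Δ Γ : S.Ob} (f : Δ ⟶ Γ) (A : S.Ty Γ) (B : S.Ty (S.ext A)) (t : S.Tm Γ)
    (ht : S.typ t = S.pi A B) :
    S.subTm (S.up f A) (S.appVar A B t ht) =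
      S.appVar (S.subTy f A) (S.subTy (S.up f A) B) (S.subTm f t)
        (by rw [S.typ_sub, ht, S.pi_sub]) := by
  have h : S.up f A ≫ S.p A = S.p (S.subTy f A) ≫ f := by rw [CwF.up, S.pair_p]
  have hA : S.subTy (S.up f A) (S.subTy (S.p A) A) = S.subTy (S.p (S.subTy f A)) (S.subTy f A) := by
    rw [← S.subTy_comp, h, S.subTy_comp]
  rw [appVar, appVar, S.app_sub]
  refine S.app_congr hA ?_ ?_ ?_ _ _ _ _
  -- Both sides are `B` reindexed along the weakening of one substitution, since p ∘ f⁺ = f ∘ p.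
  · exact (S.subTy_up_comp _ _ rfl A B).symm.trans (by rw [h]; exact S.subTy_up_comp _ _ rfl A B)
  · rw [← S.subTm_comp, h, S.subTm_comp]
  · rw [CwF.up, S.pair_q]

theorem pappVar_sub {Δ Γ : S.Ob} (f : Δ ⟶ Γ) (A : S.Ty (S.extI Γ)) (x y : S.Tm Γ)
    (hx : S.typ x = S.subTy (S.instI (S.i0 Γ)) A) (hy : S.typ y = S.subTy (S.instI (S.i1 Γ)) A)
    (t : S.Tm Γ) (ht : S.typ t = S.path A x y hx hy) :
    S.subTm (S.upI f) (S.pappVar A x y hx hy t ht) =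
      S.pappVar (S.subTy (S.upI f) A) (S.subTm f x) (S.subTm f y)
        (S.typ_sub_end f A x _ _ (S.subI_i0 f) hx) (S.typ_sub_end f A y _ _ (S.subI_i1 f) hy)
        (S.subTm f t) (by rw [S.typ_sub, ht, S.path_sub]) := by
  have h : S.upI f ≫ S.pI Γ = S.pI Δ ≫ f := by rw [CubAlg.upI, S.pairI_p]
  have hm : ∀ a : S.Tm Γ, S.subTm (S.upI f) (S.subTm (S.pI Γ) a) =
      S.subTm (S.pI Δ) (S.subTm f a) := by
    intro a; rw [← S.subTm_comp, h, S.subTm_comp]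
  rw [pappVar, pappVar, S.papp_sub]
  refine S.papp_congr ?_ (hm x) (hm y) (hm t) ?_ _ _ _ _ _ _
  · rw [← S.subTy_upI_comp _ _ rfl, h, S.subTy_upI_comp _ _ rfl]
  · rw [CubAlg.upI, S.pairI_q]

end CTTModel

/-! # Congruence for the operations of displayed models -/

namespace DispModel

variable {βη : Prop} {S : CTTModel.{u, u} βη} {Q : CubAlg.{u, u}} {F : CubAlg.Hom Q S.toCubAlg}
  (D : DispModel.{u, w} F)

section Pi

variable {c : Q.Ob} {A₁ A₂ : S.Ty (F.obj c)} {A₁' A₂' : D.Ty c} (hA' : A₁' = A₂')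
  {hA₁ : D.tyb A₁' = A₁} {hA₂ : D.tyb A₂' = A₂} {B₁ : S.Ty (S.ext A₁)} {B₂ : S.Ty (S.ext A₂)}
  (hB : HEq B₁ B₂) {B₁' : D.FamTy A₁ A₁' hA₁ B₁} {B₂' : D.FamTy A₂ A₂' hA₂ B₂}
  (hB' : ∀ {d : Q.Ob} (f : d ⟶ c) (a : D.Tm d) (h₁ : D.tyOf a = D.resTy f A₁')
    (h₂ : D.tyOf a = D.resTy f A₂'), B₁'.val f a h₁ = B₂'.val f a h₂)

include hA' hB hB'

/-- The closed types are determined by the displayed ones through `tyb`, so equating the latter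
suffices. A family is determined by its `val`, the other fields being proofs, so pointwise agreement
identifies families. -/
theorem pi_congr : D.pi A₁ A₁' hA₁ B₁ B₁' = D.pi A₂ A₂' hA₂ B₂ B₂' := by
  subst hA' hA₁ hA₂
  cases hB
  obtain rfl : B₁' = B₂' := by
    cases B₁'; cases B₂'; congr 1; funext d f a h; exact hB' f a h h
  rfl

theorem app_congr {t₁ t₂ a₁ a₂ : D.Tm c} (ht : t₁ = t₂) (ha : a₁ = a₂)
    (ht₁ : D.tyOf t₁ = D.pi A₁ A₁' hA₁ B₁ B₁') (ht₂ : D.tyOf t₂ = D.pi A₂ A₂' hA₂ B₂ B₂')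
    (ha₁ : D.tyOf a₁ = A₁') (ha₂ : D.tyOf a₂ = A₂') :
    D.app A₁ A₁' hA₁ B₁ B₁' t₁ a₁ ht₁ ha₁ = D.app A₂ A₂' hA₂ B₂ B₂' t₂ a₂ ht₂ ha₂ := by
  subst hA' hA₁ hA₂ ht ha
  cases hB
  obtain rfl : B₁' = B₂' := by
    cases B₁'; cases B₂'; congr 1; funext d f a h; exact hB' f a h h
  rfl

theorem lam_congr {b₁ : S.Tm (S.ext A₁)} {b₂ : S.Tm (S.ext A₂)} (hb : HEq b₁ b₂)
    {hb₁ : S.typ b₁ = B₁} {hb₂ : S.typ b₂ = B₂}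
    {b₁' : D.FamTm B₁' b₁ hb₁} {b₂' : D.FamTm B₂' b₂ hb₂}
    (hb' : ∀ {d : Q.Ob} (f : d ⟶ c) (a : D.Tm d) (h₁ : D.tyOf a = D.resTy f A₁')
      (h₂ : D.tyOf a = D.resTy f A₂'), b₁'.val f a h₁ = b₂'.val f a h₂) :
    D.lam A₁ A₁' hA₁ B₁ B₁' b₁ hb₁ b₁' = D.lam A₂ A₂' hA₂ B₂ B₂' b₂ hb₂ b₂' := by
  subst hA' hA₁ hA₂
  cases hB
  cases hb
  obtain rfl : B₁' = B₂' := by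
    cases B₁'; cases B₂'; congr 1; funext d f a h; exact hB' f a h h
  obtain rfl : b₁' = b₂' := by
    cases b₁'; cases b₂'; congr 1; funext d f a h; exact hb' f a h h
  rfl

end Pi

section Path

variable {c : Q.Ob} {A₁ A₂ : S.Ty (S.extI (F.obj c))} (hA : A₁ = A₂) {A₁' : D.FamITy A₁}
  {A₂' : D.FamITy A₂}
  (hA' : ∀ {d : Q.Ob} (f : d ⟶ c) (i : D.I d), A₁'.val f i = A₂'.val f i)

include hA hA'

theorem path_congr {x₁ x₂ y₁ y₂ : D.Tm c} (hx : x₁ = x₂) (hy : y₁ = y₂)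
    (hx₁ : D.tyOf x₁ = A₁'.app (D.i0 c)) (hy₁ : D.tyOf y₁ = A₁'.app (D.i1 c))
    (hx₂ : D.tyOf x₂ = A₂'.app (D.i0 c)) (hy₂ : D.tyOf y₂ = A₂'.app (D.i1 c)) :
    D.path A₁ A₁' x₁ y₁ hx₁ hy₁ = D.path A₂ A₂' x₂ y₂ hx₂ hy₂ := by
  subst hA hx hy
  obtain rfl : A₁' = A₂' := by
    cases A₁'; cases A₂'; congr 1; funext d f i; exact hA' f i
  rfl

theorem papp_congr {x₁ x₂ y₁ y₂ t₁ t₂ : D.Tm c} (hx : x₁ = x₂) (hy : y₁ = y₂) (ht : t₁ = t₂)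
    {i₁ i₂ : D.I c} (hi : i₁ = i₂)
    (hx₁ : D.tyOf x₁ = A₁'.app (D.i0 c)) (hy₁ : D.tyOf y₁ = A₁'.app (D.i1 c))
    (hx₂ : D.tyOf x₂ = A₂'.app (D.i0 c)) (hy₂ : D.tyOf y₂ = A₂'.app (D.i1 c))
    (ht₁ : D.tyOf t₁ = D.path A₁ A₁' x₁ y₁ hx₁ hy₁)
    (ht₂ : D.tyOf t₂ = D.path A₂ A₂' x₂ y₂ hx₂ hy₂) :
    D.papp A₁ A₁' x₁ y₁ hx₁ hy₁ t₁ ht₁ i₁ = D.papp A₂ A₂' x₂ y₂ hx₂ hy₂ t₂ ht₂ i₂ := by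
  subst hA hx hy ht hi
  obtain rfl : A₁' = A₂' := by
    cases A₁'; cases A₂'; congr 1; funext d f i; exact hA' f i
  rfl

theorem plam_congr {b₁ b₂ : S.Tm (S.extI (F.obj c))} (hb : b₁ = b₂)
    {hb₁ : S.typ b₁ = A₁} {hb₂ : S.typ b₂ = A₂}
    {b₁' : D.FamITm A₁' b₁ hb₁} {b₂' : D.FamITm A₂' b₂ hb₂}
    (hb' : ∀ {d : Q.Ob} (f : d ⟶ c) (i : D.I d), b₁'.val f i = b₂'.val f i) :
    D.plam A₁ A₁' b₁ hb₁ b₁' = D.plam A₂ A₂' b₂ hb₂ b₂' := by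
  subst hA hb
  obtain rfl : A₁' = A₂' := by
    cases A₁'; cases A₂'; congr 1; funext d f i; exact hA' f i
  obtain rfl : b₁' = b₂' := by
    cases b₁'; cases b₂'; congr 1; funext d f i; exact hb' f i
  rfl

end Path

/-- A family of terms, regarded over an equal family of types. -/
def FamTm.copy {c : Q.Ob} {A : S.Ty (F.obj c)} {A' : D.Ty c} {hA : D.tyb A' = A}
    {B₁ B₂ : S.Ty (S.ext A)} {B₁' : D.FamTy A A' hA B₁} (B₂' : D.FamTy A A' hA B₂)
    {b₁ b₂ : S.Tm (S.ext A)} {hb₁ : S.typ b₁ = B₁} (b' : D.FamTm B₁' b₁ hb₁)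
    (hb₂ : S.typ b₂ = B₂) (hb : b₁ = b₂)
    (hB' : ∀ {d : Q.Ob} (f : d ⟶ c) (a : D.Tm d) (h : D.tyOf a = D.resTy f A'),
      B₁'.val f a h = B₂'.val f a h) : D.FamTm B₂' b₂ hb₂ where
  val := b'.val
  tyOf_val f a h := by rw [b'.tyOf_val, hB']
  tmb_val f a h := by rw [b'.tmb_val, hb]
  res_val := b'.res_val

/-- A family of terms over the interval, regarded over an equal family of types. -/
def FamITm.copy {c : Q.Ob} {A₁ A₂ : S.Ty (S.extI (F.obj c))} {A₁' : D.FamITy A₁}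
    (A₂' : D.FamITy A₂) {b₁ b₂ : S.Tm (S.extI (F.obj c))} {hb₁ : S.typ b₁ = A₁}
    (b' : D.FamITm A₁' b₁ hb₁) (hb₂ : S.typ b₂ = A₂) (hb : b₁ = b₂)
    (hA' : ∀ {d : Q.Ob} (f : d ⟶ c) (i : D.I d), A₁'.val f i = A₂'.val f i) :
    D.FamITm A₂' b₂ hb₂ where
  val := b'.val
  tyOf_val f i := by rw [b'.tyOf_val, hA']
  tmb_val f i := by rw [b'.tmb_val, hb]
  res_val := b'.res_val

end DispModel

/-! # The glued model

The objects over `Γ` are the presheaves over the elements of the nerve `S(F -, Γ)`, and the types,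
terms and interval elements are given by elements of the displayed model. -/

section Glue

variable {βη : Prop} {S : CTTModel.{u, u} βη} {Q : CubAlg.{u, u}}

/-- An object `base` of `S` with a presheaf `El` over its nerve. -/
structure GlueOb (F : CubAlg.Hom Q S.toCubAlg) : Type (max u (w + 1)) where
  base : S.Ob
  El : Q.Ob → Type w
  res : ∀ {d c : Q.Ob}, (d ⟶ c) → El c → El d
  res_id : ∀ {c : Q.Ob} (e : El c), res (𝟙 c) e = e
  res_comp : ∀ {d' d c : Q.Ob} (g : d' ⟶ d) (f : d ⟶ c) (e : El c),
    res (g ≫ f) e = res g (res f e)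
  sub : ∀ {c : Q.Ob}, El c → (F.obj c ⟶ base)
  sub_res : ∀ {d c : Q.Ob} (f : d ⟶ c) (e : El c), sub (res f e) = F.map f ≫ sub e

variable {F : CubAlg.Hom Q S.toCubAlg}

-- Morphisms of the comma category: `sub_fn` is the commuting square over the nerves.
@[ext]
structure GlueHom (X Y : GlueOb.{u, w} F) : Type (max u w) where
  base : X.base ⟶ Y.base
  fn : ∀ c : Q.Ob, X.El c → Y.El c
  res_fn : ∀ {d c : Q.Ob} (f : d ⟶ c) (e : X.El c), Y.res f (fn c e) = fn d (X.res f e)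
  sub_fn : ∀ {c : Q.Ob} (e : X.El c), Y.sub (fn c e) = X.sub e ≫ base

instance : Category.{max u w} (GlueOb.{u, w} F) where
  Hom := GlueHom
  id X := ⟨𝟙 _, fun _ e => e, fun _ _ => rfl, fun _ => (Category.comp_id _).symm⟩
  comp g f := ⟨g.base ≫ f.base, fun c e => f.fn c (g.fn c e),
    fun h e => by rw [f.res_fn, g.res_fn], fun e => by rw [f.sub_fn, g.sub_fn, Category.assoc]⟩
  id_comp f := GlueHom.ext (Category.id_comp _) rfl
  comp_id f := GlueHom.ext (Category.comp_id _) rfl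
  assoc f g h := GlueHom.ext (Category.assoc _ _ _) rfl

namespace GlueOb

theorem eqToHom_base {X Y : GlueOb.{u, w} F} (h : X = Y) :
    GlueHom.base (eqToHom h) = eqToHom (congrArg base h) := by
  subst h; rfl

end GlueOb

variable (D : DispModel.{u, w} F)

-- A displayed type is assigned to each environment, not to each closing substitution: different
-- environments over the same γ may receive different displayed types over A[γ].
@[ext]
structure GlueTy (X : GlueOb.{u, w} F) : Type (max u w) where
  base : S.Ty X.base
  val : ∀ c : Q.Ob, X.El c → D.Ty c
  tyb_val : ∀ {c : Q.Ob} (e : X.El c), D.tyb (val c e) = S.subTy (X.sub e) base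
  res_val : ∀ {d c : Q.Ob} (f : d ⟶ c) (e : X.El c), D.resTy f (val c e) = val d (X.res f e)

@[ext]
structure GlueTm (X : GlueOb.{u, w} F) : Type (max u w) where
  base : S.Tm X.base
  val : ∀ c : Q.Ob, X.El c → D.Tm c
  tmb_val : ∀ {c : Q.Ob} (e : X.El c), D.tmb (val c e) = S.subTm (X.sub e) base
  res_val : ∀ {d c : Q.Ob} (f : d ⟶ c) (e : X.El c), D.resTm f (val c e) = val d (X.res f e)

@[ext]
structure GlueI (X : GlueOb.{u, w} F) : Type (max u w) where
  base : S.I X.base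
  val : ∀ c : Q.Ob, X.El c → D.I c
  ib_val : ∀ {c : Q.Ob} (e : X.El c), D.ib (val c e) = S.subI (X.sub e) base
  res_val : ∀ {d c : Q.Ob} (f : d ⟶ c) (e : X.El c), D.resI f (val c e) = val d (X.res f e)

variable {D}

abbrev GlueTy.sub {Y X : GlueOb.{u, w} F} (f : Y ⟶ X) (A : GlueTy D X) : GlueTy D Y where
  base := S.subTy f.base A.base
  val c e := A.val c (f.fn c e)
  tyb_val e := by rw [A.tyb_val, f.sub_fn, S.subTy_comp]
  res_val g e := by rw [A.res_val, f.res_fn]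

abbrev GlueTm.sub {Y X : GlueOb.{u, w} F} (f : Y ⟶ X) (a : GlueTm D X) : GlueTm D Y where
  base := S.subTm f.base a.base
  val c e := a.val c (f.fn c e)
  tmb_val e := by rw [a.tmb_val, f.sub_fn, S.subTm_comp]
  res_val g e := by rw [a.res_val, f.res_fn]

abbrev GlueI.sub {Y X : GlueOb.{u, w} F} (f : Y ⟶ X) (i : GlueI D X) : GlueI D Y where
  base := S.subI f.base i.base
  val c e := i.val c (f.fn c e)
  ib_val e := by rw [i.ib_val, f.sub_fn, S.subI_comp]
  res_val g e := by rw [i.res_val, f.res_fn]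

abbrev GlueTm.typ {X : GlueOb.{u, w} F} (a : GlueTm D X) : GlueTy D X where
  base := S.typ a.base
  val c e := D.tyOf (a.val c e)
  tyb_val e := by rw [← D.typ_tmb, a.tmb_val, S.typ_sub]
  res_val f e := by rw [← D.tyOf_res, a.res_val]

/-- The closed term underlying `a` is left free, since the presheaf contains the environments over
all closing substitutions; `sub` reads it off. It is fixed only in the fibres used for the section.
-/
abbrev GlueTy.ext' {X : GlueOb.{u, w} F} (A : GlueTy D X) : GlueOb.{u, w} F where
  base := S.ext A.base
  El c := (e : X.El c) × {a : D.Tm c // D.tyOf a = A.val c e}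
  res f e := ⟨X.res f e.1, D.resTm f e.2.1, by rw [D.tyOf_res, e.2.2, A.res_val]⟩
  res_id e := by
    obtain ⟨e, a, ha⟩ := e
    refine Sigma.subtype_ext (X.res_id e) (D.resTm_id a)
  res_comp g f e := Sigma.subtype_ext (X.res_comp g f _) (D.resTm_comp g f _)
  sub e := S.pair (X.sub e.1) A.base (D.tmb e.2.1) (by rw [D.typ_tmb, e.2.2, A.tyb_val])
  sub_res f e := by
    rw [S.comp_pair _ _ _ _ _ (by
      rw [← D.tmb_res, D.typ_tmb, D.tyOf_res, e.2.2, A.res_val, A.tyb_val, X.sub_res])]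
    exact S.pair_congr (X.sub_res _ _) (D.tmb_res _ _) _ _

/-- The new variable ranges over all displayed interval elements. The interval of `Q` plays no role
in the glued model; it enters only with the choice of points. -/
abbrev GlueOb.extI (D : DispModel.{u, w} F) (X : GlueOb.{u, w} F) : GlueOb.{u, w} F where
  base := S.extI X.base
  El c := X.El c × D.I c
  res f e := ⟨X.res f e.1, D.resI f e.2⟩
  res_id e := Prod.ext (X.res_id _) (D.resI_id _)
  res_comp g f e := Prod.ext (X.res_comp g f _) (D.resI_comp g f _)
  sub e := S.pairI (X.sub e.1) (D.ib e.2)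
  sub_res f e := by rw [S.comp_pairI, X.sub_res, D.ib_res]


abbrev GlueOb.one (F : CubAlg.Hom Q S.toCubAlg) : GlueOb.{u, w} F where
  base := S.one
  El _ := PUnit
  res _ e := e
  res_id _ := rfl
  res_comp _ _ _ := rfl
  sub {c} _ := S.bang (F.obj c)
  sub_res _ _ := (S.bang_uniq _).symm

abbrev GlueHom.bang (X : GlueOb.{u, w} F) : GlueHom X (GlueOb.one F) where
  base := S.bang _
  fn _ _ := ⟨⟩
  res_fn _ _ := rfl
  sub_fn _ := (S.bang_uniq _).symm

abbrev GlueHom.pI (X : GlueOb.{u, w} F) : GlueHom (X.extI D) X where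
  base := S.pI _
  fn _ e := e.1
  res_fn _ _ := rfl
  sub_fn _ := (S.pairI_p _ _).symm

abbrev GlueI.qI (X : GlueOb.{u, w} F) : GlueI D (X.extI D) where
  base := S.qI _
  val _ e := e.2
  ib_val _ := (S.pairI_q _ _).symm
  res_val _ _ := rfl

abbrev GlueHom.pairI {Y X : GlueOb.{u, w} F} (f : GlueHom Y X) (i : GlueI D Y) :
    GlueHom Y (X.extI D) where
  base := S.pairI f.base i.base
  fn c e := ⟨f.fn c e, i.val c e⟩
  res_fn g e := Prod.ext (f.res_fn g e) (i.res_val g e)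
  sub_fn e := by
    rw [S.comp_pairI, ← f.sub_fn, ← i.ib_val]

abbrev GlueHom.p {X : GlueOb.{u, w} F} (A : GlueTy D X) : GlueHom A.ext' X where
  base := S.p _
  fn _ e := e.1
  res_fn _ _ := rfl
  sub_fn _ := (S.pair_p _ _ _ _).symm

abbrev GlueTm.q {X : GlueOb.{u, w} F} (A : GlueTy D X) : GlueTm D A.ext' where
  base := S.q _
  val _ e := e.2.1
  tmb_val _ := (S.pair_q _ _ _ _).symm
  res_val _ _ := rfl

theorem GlueTm.val_typ {X : GlueOb.{u, w} F} {a : GlueTm D X} {A : GlueTy D X} (h : a.typ = A)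
    {c : Q.Ob} (e : X.El c) : D.tyOf (a.val c e) = A.val c e := by
  subst h; rfl

theorem GlueTm.base_typ {X : GlueOb.{u, w} F} {a : GlueTm D X} {A : GlueTy D X}
    (h : a.typ = A) : S.typ a.base = A.base := by
  subst h; rfl

abbrev GlueHom.pair {Y X : GlueOb.{u, w} F} (f : GlueHom Y X) (A : GlueTy D X) (a : GlueTm D Y)
    (h : a.typ = A.sub f) : GlueHom Y A.ext' where
  base := S.pair f.base A.base a.base (GlueTm.base_typ h)
  fn c e := ⟨f.fn c e, a.val c e, GlueTm.val_typ h e⟩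
  res_fn g e := Sigma.subtype_ext (f.res_fn g e) (a.res_val g e)
  sub_fn e := by
    rw [S.comp_pair _ _ _ _ _ (by
      rw [S.typ_sub, GlueTm.base_typ h, S.subTy_comp])]
    exact S.pair_congr (f.sub_fn _) (a.tmb_val _) _ _

variable (D)

/-- The cubical algebra of the glued model. -/
abbrev glueCubAlg : CubAlg.{max u (w + 1), max u w} where
  Ob := GlueOb.{u, w} F
  one := GlueOb.one F
  bang X := GlueHom.bang X
  bang_uniq f := GlueHom.ext (S.bang_uniq _) rfl
  I := GlueI D
  subI f i := i.sub f
  subI_id i := GlueI.ext (S.subI_id _) rfl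
  subI_comp g f i := GlueI.ext (S.subI_comp _ _ _) rfl
  i0 X := ⟨S.i0 _, fun c _ => D.i0 c, fun _ => by rw [D.ib_i0, S.subI_i0], fun _ _ => D.resI_i0 _⟩
  i1 X := ⟨S.i1 _, fun c _ => D.i1 c, fun _ => by rw [D.ib_i1, S.subI_i1], fun _ _ => D.resI_i1 _⟩
  subI_i0 f := GlueI.ext (S.subI_i0 _) rfl
  subI_i1 f := GlueI.ext (S.subI_i1 _) rfl
  extI X := X.extI D
  pI X := GlueHom.pI X
  qI X := GlueI.qI X
  pairI f i := GlueHom.pairI f i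
  pairI_p f i := GlueHom.ext (S.pairI_p _ _) rfl
  pairI_q f i := GlueI.ext (S.pairI_q _ _) rfl
  pairI_eta g := GlueHom.ext (S.pairI_eta _) rfl

/-- The judgemental part of the glued model. -/
abbrev glueCwF : CwF.{max u (w + 1), max u w} where
  toCubAlg := glueCubAlg D
  Ty := GlueTy D
  subTy f A := A.sub f
  subTy_id A := GlueTy.ext (S.subTy_id _) rfl
  subTy_comp g f A := GlueTy.ext (S.subTy_comp _ _ _) rfl
  Tm := GlueTm D
  subTm f A := A.sub f
  subTm_id A := GlueTm.ext (S.subTm_id _) rfl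
  subTm_comp g f A := GlueTm.ext (S.subTm_comp _ _ _) rfl
  typ a := a.typ
  typ_sub f a := GlueTy.ext (S.typ_sub _ _) rfl
  ext A := A.ext'
  p A := GlueHom.p A
  q A := GlueTm.q A
  typ_q A := GlueTy.ext (S.typ_q _) (by funext c e; exact e.2.2)
  pair f A a h := GlueHom.pair f A a h
  pair_p f A a h := GlueHom.ext (S.pair_p _ _ _ _) rfl
  pair_q f A a h := GlueTm.ext (S.pair_q _ _ _ _) rfl
  pair_eta A g := GlueHom.ext (S.pair_eta _ _) rfl

end Glue

/-! ### Π-types in the glued model -/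

section Glue

variable {βη : Prop} {S : CTTModel.{u, u} βη} {Q : CubAlg.{u, u}}
  {F : CubAlg.Hom Q S.toCubAlg} {D : DispModel.{u, w} F}

namespace GlueTy

variable {X : GlueOb.{u, w} F}

/-- The family `λ a^• ↦ B^•(e, a^•)`. -/
def fam (A : GlueTy D X) (B : GlueTy D A.ext') {c : Q.Ob} (e : X.El c) :
    D.FamTy (S.subTy (X.sub e) A.base) (A.val c e) (A.tyb_val e)
      (S.subTy (S.up (X.sub e) A.base) B.base) where
  val {d} f a ha := B.val d ⟨X.res f e, a, by rw [ha, A.res_val]⟩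
  tyb_val f a ha := by
    rw [B.tyb_val]
    exact S.subTy_pair_up _ _ (X.sub_res _ _) _ _ _ _ _
  res_val g f a ha := by
    rw [B.res_val]
    exact congrArg (B.val _) (Sigma.subtype_ext (X.res_comp g f e).symm rfl)

/-- The family `λ a^• ↦ b^•(e, a^•)`. -/
def famTm (A : GlueTy D X) (b : GlueTm D A.ext') {c : Q.Ob} (e : X.El c) :
    D.FamTm (A.fam b.typ e) (S.subTm (S.up (X.sub e) A.base) b.base) (S.typ_sub _ _) where
  val {d} f a ha := b.val d ⟨X.res f e, a, by rw [ha, A.res_val]⟩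
  tyOf_val f a ha := rfl
  tmb_val f a ha := by
    rw [b.tmb_val]
    exact S.subTm_pair_up _ _ (X.sub_res _ _) _ _ _ _ _
  res_val g f a ha := by
    rw [b.res_val]
    exact congrArg (b.val _) (Sigma.subtype_ext (X.res_comp g f e).symm rfl)

/-- The family `λ i^• ↦ A^•(e, i^•)`. -/
def famI (A : GlueTy D (X.extI D)) {c : Q.Ob} (e : X.El c) :
    D.FamITy (S.subTy (S.upI (X.sub e)) A.base) where
  val {d} f i := A.val d ⟨X.res f e, i⟩
  tyb_val f i := by
    rw [A.tyb_val, ← S.subTy_comp, CubAlg.pairI_upI, ← X.sub_res]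
  res_val g f i := by
    rw [A.res_val]
    exact congrArg (A.val _) (Prod.ext (X.res_comp g f e).symm rfl)

/-- The family `λ i^• ↦ b^•(e, i^•)`. -/
def famITm (b : GlueTm D (X.extI D)) {c : Q.Ob} (e : X.El c) :
    D.FamITm (famI b.typ e) (S.subTm (S.upI (X.sub e)) b.base) (S.typ_sub _ _) where
  val {d} f i := b.val d ⟨X.res f e, i⟩
  tyOf_val f i := rfl
  tmb_val f i := by
    rw [b.tmb_val, ← S.subTm_comp, CubAlg.pairI_upI, ← X.sub_res]
  res_val g f i := by
    rw [b.res_val]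
    exact congrArg (b.val _) (Prod.ext (X.res_comp g f e).symm rfl)

/-- Applying a family means taking its component at the identity of the stage, so the environment is
restricted along an identity; this and the next three lemmas remove that restriction. -/
theorem fam_app (A : GlueTy D X) (B : GlueTy D A.ext') {c : Q.Ob} (e : X.El c) (a : D.Tm c)
    (ha : D.tyOf a = A.val c e) : (A.fam B e).app a ha = B.val c ⟨e, a, ha⟩ :=
  congrArg (B.val c) (Sigma.subtype_ext (X.res_id e) rfl)

theorem famTm_app (A : GlueTy D X) (b : GlueTm D A.ext') {c : Q.Ob} (e : X.El c) (a : D.Tm c)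
    (ha : D.tyOf a = A.val c e) : (A.famTm b e).app a ha = b.val c ⟨e, a, ha⟩ :=
  congrArg (b.val c) (Sigma.subtype_ext (X.res_id e) rfl)

theorem famI_app (A : GlueTy D (X.extI D)) {c : Q.Ob} (e : X.El c) (i : D.I c) :
    (A.famI e).app i = A.val c ⟨e, i⟩ :=
  congrArg (A.val c) (Prod.ext (X.res_id e) rfl)

theorem famITm_app (b : GlueTm D (X.extI D)) {c : Q.Ob} (e : X.El c) (i : D.I c) :
    (famITm b e).app i = b.val c ⟨e, i⟩ :=
  congrArg (b.val c) (Prod.ext (X.res_id e) rfl)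

/-- Computed environment by environment: over `e`, the domain and codomain become displayed data
over their closed instances along `X.sub e`, to which `D.pi` applies. Restricting `e` composes
closing substitutions, so naturality is functoriality of reindexing. -/
abbrev pi (A : GlueTy D X) (B : GlueTy D A.ext') : GlueTy D X where
  base := S.pi A.base B.base
  val c e := D.pi _ (A.val c e) (A.tyb_val e) _ (A.fam B e)
  tyb_val e := by rw [D.tyb_pi, S.pi_sub]
  res_val f e := by
    rw [D.pi_res]
    refine D.pi_congr (A.res_val f e) ?_ ?_
    · exact (S.subTy_up_comp _ _ (X.sub_res f e) _ _).symm
    · intro d g a h₁ h₂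
      exact congrArg (B.val _) (Sigma.subtype_ext (X.res_comp g f e) rfl)

end GlueTy

namespace GlueTm

variable {X : GlueOb.{u, w} F}

abbrev lam (A : GlueTy D X) (b : GlueTm D A.ext') : GlueTm D X where
  base := S.lam A.base b.base
  val c e := D.lam _ (A.val c e) (A.tyb_val e) _ (A.fam b.typ e) _ _ (A.famTm b e)
  tmb_val e := by rw [D.tmb_lam, S.lam_sub]
  res_val f e := by
    rw [D.lam_res]
    refine D.lam_congr (A.res_val f e) ?_ ?_ ?_ ?_
    · exact (S.subTy_up_comp _ _ (X.sub_res f e) _ _).symm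
    · intro d g a h₁ h₂
      exact congrArg (b.typ.val _) (Sigma.subtype_ext (X.res_comp g f e) rfl)
    · exact (S.subTm_up_comp _ _ (X.sub_res f e) _ _).symm
    · intro d g a h₁ h₂
      exact congrArg (b.val _) (Sigma.subtype_ext (X.res_comp g f e) rfl)

abbrev app (A : GlueTy D X) (B : GlueTy D A.ext') (t a : GlueTm D X) (ht : t.typ = A.pi B)
    (ha : a.typ = A) : GlueTm D X where
  base := S.app A.base B.base t.base a.base (base_typ ht) (base_typ ha)
  val c e := D.app _ (A.val c e) (A.tyb_val e) _ (A.fam B e) (t.val c e) (a.val c e)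
    (val_typ ht e) (val_typ ha e)
  tmb_val e := by
    rw [D.tmb_app, S.app_sub]
    exact S.app_congr rfl HEq.rfl (t.tmb_val e) (a.tmb_val e) _ _ _ _
  res_val f e := by
    rw [D.app_res]
    refine D.app_congr (A.res_val f e) ?_ ?_ (t.res_val f e) (a.res_val f e) _ _ _ _
    · exact (S.subTy_up_comp _ _ (X.sub_res f e) _ _).symm
    · intro d g a h₁ h₂
      exact congrArg (B.val _) (Sigma.subtype_ext (X.res_comp g f e) rfl)

end GlueTm

section Sub

variable {Y X : GlueOb.{u, w} F} (f : GlueHom Y X)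

theorem GlueTy.pi_sub (A : GlueTy D X) (B : GlueTy D A.ext') :
    (A.pi B).sub f = (A.sub f).pi (B.sub ((glueCwF D).up f A)) := by
  refine GlueTy.ext (S.pi_sub _ _ _) ?_
  funext c e
  refine D.pi_congr rfl ?_ ?_
  · exact S.subTy_up_comp _ _ (f.sub_fn e) _ _
  · intro d g a h₁ h₂
    exact congrArg (B.val _) (Sigma.subtype_ext (f.res_fn _ _) rfl)

theorem GlueTm.lam_sub (A : GlueTy D X) (b : GlueTm D A.ext') :
    (lam A b).sub f = lam (A.sub f) (b.sub ((glueCwF D).up f A)) := by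
  refine GlueTm.ext (S.lam_sub _ _ _) ?_
  funext c e
  refine D.lam_congr rfl ?_ ?_ ?_ ?_
  -- The codomain on the right is the type of the substituted body, on the left the substituted type
  -- of the body; `typ_sub` bridges them.
  · exact (S.subTy_up_comp _ _ (f.sub_fn e) _ _).trans
      (heq_of_eq (congrArg _ (S.typ_sub _ _).symm))
  · intro d g a h₁ h₂
    exact congrArg (b.typ.val _) (Sigma.subtype_ext (f.res_fn _ _) rfl)
  · exact S.subTm_up_comp _ _ (f.sub_fn e) _ _
  · intro d g a h₁ h₂
    exact congrArg (b.val _) (Sigma.subtype_ext (f.res_fn _ _) rfl)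

theorem GlueTm.app_sub (A : GlueTy D X) (B : GlueTy D A.ext') (t a : GlueTm D X)
    (ht : t.typ = A.pi B) (ha : a.typ = A)
    (ht' : (t.sub f).typ = (A.sub f).pi (B.sub ((glueCwF D).up f A)))
    (ha' : (a.sub f).typ = A.sub f) :
    (app A B t a ht ha).sub f =
      app (A.sub f) (B.sub ((glueCwF D).up f A)) (t.sub f) (a.sub f) ht' ha' := by
  refine GlueTm.ext (S.app_sub _ _ _ _ _ _ _) ?_
  funext c e
  refine D.app_congr rfl ?_ ?_ rfl rfl _ _ _ _
  · exact S.subTy_up_comp _ _ (f.sub_fn e) _ _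
  · intro d g a h₁ h₂
    exact congrArg (B.val _) (Sigma.subtype_ext (f.res_fn _ _) rfl)

end Sub

namespace GlueTm

variable {X : GlueOb.{u, w} F}

theorem typ_lam (A : GlueTy D X) (b : GlueTm D A.ext') : (lam A b).typ = A.pi b.typ := by
  refine GlueTy.ext (S.typ_lam _ _) ?_
  funext c e
  exact D.tyOf_lam _ _ _ _ _ _ _ _

theorem typ_app (A : GlueTy D X) (B : GlueTy D A.ext') (t a : GlueTm D X)
    (ht : t.typ = A.pi B) (ha : a.typ = A) :
    (app A B t a ht ha).typ = B.sub ((glueCwF D).inst A a ha) := by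
  refine GlueTy.ext (S.typ_app _ _ _ _ _ _) ?_
  funext c e
  exact (D.tyOf_app _ _ _ _ _ _ _ _ _).trans (A.fam_app B e _ _)

theorem pi_beta (A : GlueTy D X) (b : GlueTm D A.ext') (a : GlueTm D X) (ha : a.typ = A) :
    app A b.typ (lam A b) a (typ_lam A b) ha = b.sub ((glueCwF D).inst A a ha) := by
  refine GlueTm.ext (S.pi_beta _ _ _ _) ?_
  funext c e
  exact (D.pi_beta _ _ _ _ _ _ _ _ _ _).trans (A.famTm_app b e _ _)

/-- The displayed η-rule at each environment gives the result, after reconciling two presentations: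
the body of the glued η-expansion has type `B` and base `appVar` only up to propositional equality,
while the displayed rule wants a family over exactly these. -/
theorem pi_eta (A : GlueTy D X) (B : GlueTy D A.ext') (t : GlueTm D X) (ht : t.typ = A.pi B)
    (h₁ : (t.sub (GlueHom.p A)).typ =
      (A.sub (GlueHom.p A)).pi (B.sub ((glueCwF D).up (GlueHom.p A) A)))
    (h₂ : (q A).typ = A.sub (GlueHom.p A)) :
    lam A (app (A.sub (GlueHom.p A)) (B.sub ((glueCwF D).up (GlueHom.p A) A))
      (t.sub (GlueHom.p A)) (q A) h₁ h₂) = t := by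
  refine GlueTm.ext (S.pi_eta _ _ _ (base_typ ht)) ?_
  funext c e
  set b := app (A.sub (GlueHom.p A)) (B.sub ((glueCwF D).up (GlueHom.p A) A))
      (t.sub (GlueHom.p A)) (q A) h₁ h₂ with hb
  -- The type is B[p⁺][⟨id, q⟩]. Its base reduces to that of `B` as for `appVar`; its values are
  -- those of `B` by definition.
  have hB : b.typ = B := by
    refine (typ_app _ _ _ _ _ _).trans (GlueTy.ext ?_ ?_)
    · refine Eq.trans ?_ (S.typ_appVar A.base B.base t.base (base_typ ht))
      exact (S.typ_app _ _ _ _ _ _).symm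
    · funext d x
      rfl
  have hbb : S.subTm (S.up (X.sub e) A.base) b.base =
      S.appVar (S.subTy (X.sub e) A.base) (S.subTy (S.up (X.sub e) A.base) B.base)
        (D.tmb (t.val c e)) (by rw [D.typ_tmb, val_typ ht, D.tyb_pi]) := by
    refine (S.appVar_sub (X.sub e) A.base B.base t.base (base_typ ht)).trans ?_
    exact S.app_congr rfl HEq.rfl (by rw [t.tmb_val]) rfl _ _ _ _
  have hv : ∀ {d : Q.Ob} (f : d ⟶ c) (a : D.Tm d) (h : D.tyOf a = D.resTy f (A.val c e)),
      (A.fam b.typ e).val f a h = (A.fam B e).val f a h := by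
    intro d f a h; rw [hB]
  -- The family of values of the body, relabelled by `copy` over the type and term that the
  -- displayed rule expects; the values themselves do not change.
  have := D.pi_eta _ _ (A.tyb_val e) _ (A.fam B e) (t.val c e) (val_typ ht e)
    (DispModel.FamTm.copy D (A.fam B e) (A.famTm b e) (S.typ_appVar _ _ _ _) hbb hv) ?_
  · refine Eq.trans ?_ this
    refine D.lam_congr rfl ?_ ?_ (heq_of_eq hbb) ?_
    · rw [hB]
    · intro d f a h _; exact hv f a h
    · intro d f a h _; rfl
  · intro d f a ha
    refine D.app_congr (A.res_val f e).symm ?_ ?_ (t.res_val f e).symm rfl _ _ _ _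
    -- The closing substitution of the extended environment, followed by p, is that of the
    -- restricted environment `X.res f e`, so both codomains are instances of `B` along the same
    -- weakening.
    · exact (S.subTy_up_comp _ _ (S.pair_p _ _ _ _).symm _ _).symm.trans
        (S.subTy_up_comp _ _ (X.sub_res f e) _ _)
    · intro d' g a' h h'
      exact congrArg (B.val _) (Sigma.subtype_ext (X.res_comp g f e).symm rfl)

end GlueTm

/-! ### Path types in the glued model -/

section Path

variable {X : GlueOb.{u, w} F}

/-- Instantiation at `i` acts on environments by e ↦ (e, i(e)), which turns the glued endpoint
condition into the displayed one. -/
theorem GlueTm.val_end {A : GlueTy D (X.extI D)} {x : GlueTm D X} {i : GlueI D X}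
    (hx : x.typ = A.sub ((glueCwF D).instI i)) {c : Q.Ob} (e : X.El c) :
    D.tyOf (x.val c e) = (A.famI e).app (i.val c e) :=
  (val_typ hx e).trans (A.famI_app e _).symm

abbrev GlueTy.path (A : GlueTy D (X.extI D)) (x y : GlueTm D X)
    (hx : x.typ = A.sub ((glueCwF D).instI ((glueCwF D).i0 X)))
    (hy : y.typ = A.sub ((glueCwF D).instI ((glueCwF D).i1 X))) : GlueTy D X where
  base := S.path A.base x.base y.base (GlueTm.base_typ hx) (GlueTm.base_typ hy)
  val c e := D.path _ (A.famI e) (x.val c e) (y.val c e) (GlueTm.val_end hx e)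
    (GlueTm.val_end hy e)
  tyb_val e := by
    rw [D.tyb_path]
    refine Eq.trans ?_ (S.path_sub _ _ _ _ _ _).symm
    exact S.path_congr rfl (x.tmb_val e) (y.tmb_val e) _ _ _ _
  res_val f e := by
    rw [D.path_res]
    refine D.path_congr ?_ ?_ (x.res_val f e) (y.res_val f e) _ _ _ _
    · exact (S.subTy_upI_comp _ _ (X.sub_res f e) _).symm
    · intro d g i
      exact congrArg (A.val _) (Prod.ext (X.res_comp g f e) rfl)

abbrev GlueTm.papp (A : GlueTy D (X.extI D)) (x y : GlueTm D X)
    (hx : x.typ = A.sub ((glueCwF D).instI ((glueCwF D).i0 X)))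
    (hy : y.typ = A.sub ((glueCwF D).instI ((glueCwF D).i1 X)))
    (t : GlueTm D X) (ht : t.typ = GlueTy.path A x y hx hy) (i : GlueI D X) : GlueTm D X where
  base := S.papp A.base x.base y.base (base_typ hx) (base_typ hy) t.base (base_typ ht) i.base
  val c e := D.papp _ (A.famI e) (x.val c e) (y.val c e) (val_end hx e) (val_end hy e)
    (t.val c e) (val_typ ht e) (i.val c e)
  tmb_val e := by
    rw [D.tmb_papp]
    refine Eq.trans ?_ (S.papp_sub _ _ _ _ _ _ _ _ _).symm
    exact S.papp_congr rfl (x.tmb_val e) (y.tmb_val e) (t.tmb_val e) (i.ib_val e) _ _ _ _ _ _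
  res_val f e := by
    rw [D.papp_res]
    refine D.papp_congr ?_ ?_ (x.res_val f e) (y.res_val f e) (t.res_val f e) (i.res_val f e)
      _ _ _ _ _ _
    · exact (S.subTy_upI_comp _ _ (X.sub_res f e) _).symm
    · intro d g i
      exact congrArg (A.val _) (Prod.ext (X.res_comp g f e) rfl)

abbrev GlueTm.plam (b : GlueTm D (X.extI D)) : GlueTm D X where
  base := S.plam b.base
  val c e := D.plam _ (b.typ.famI e) _ _ (GlueTy.famITm b e)
  tmb_val e := by rw [D.tmb_plam, S.plam_sub]
  res_val f e := by
    rw [D.plam_res]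
    refine D.plam_congr ?_ ?_ ?_ ?_
    · exact (S.subTy_upI_comp _ _ (X.sub_res f e) _).symm
    · intro d g i
      exact congrArg (b.typ.val _) (Prod.ext (X.res_comp g f e) rfl)
    · exact (S.subTm_upI_comp _ _ (X.sub_res f e) _).symm
    · intro d g i
      exact congrArg (b.val _) (Prod.ext (X.res_comp g f e) rfl)

theorem GlueTy.path_sub {Y : GlueOb.{u, w} F} (f : GlueHom Y X) (A : GlueTy D (X.extI D))
    (x y : GlueTm D X)
    (hx : x.typ = A.sub ((glueCwF D).instI ((glueCwF D).i0 X)))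
    (hy : y.typ = A.sub ((glueCwF D).instI ((glueCwF D).i1 X)))
    (hx' : (x.sub f).typ =
      GlueTy.sub ((glueCwF D).instI ((glueCwF D).i0 Y)) (A.sub ((glueCwF D).upI f)))
    (hy' : (y.sub f).typ =
      GlueTy.sub ((glueCwF D).instI ((glueCwF D).i1 Y)) (A.sub ((glueCwF D).upI f))) :
    (path A x y hx hy).sub f = path (A.sub ((glueCwF D).upI f)) (x.sub f) (y.sub f) hx' hy' := by
  refine GlueTy.ext (S.path_sub _ _ _ _ _ _) ?_
  funext c e
  refine D.path_congr ?_ ?_ rfl rfl _ _ _ _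
  · exact S.subTy_upI_comp _ _ (f.sub_fn e) _
  · intro d g i
    exact congrArg (A.val _) (Prod.ext (f.res_fn g e) rfl)

theorem GlueTm.papp_sub {Y : GlueOb.{u, w} F} (f : GlueHom Y X) (A : GlueTy D (X.extI D))
    (x y : GlueTm D X)
    (hx : x.typ = A.sub ((glueCwF D).instI ((glueCwF D).i0 X)))
    (hy : y.typ = A.sub ((glueCwF D).instI ((glueCwF D).i1 X)))
    (t : GlueTm D X) (ht : t.typ = GlueTy.path A x y hx hy) (i : GlueI D X)
    (hx' : (x.sub f).typ =
      GlueTy.sub ((glueCwF D).instI ((glueCwF D).i0 Y)) (A.sub ((glueCwF D).upI f)))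
    (hy' : (y.sub f).typ =
      GlueTy.sub ((glueCwF D).instI ((glueCwF D).i1 Y)) (A.sub ((glueCwF D).upI f)))
    (ht' : (t.sub f).typ =
      GlueTy.path (A.sub ((glueCwF D).upI f)) (x.sub f) (y.sub f) hx' hy') :
    (papp A x y hx hy t ht i).sub f =
      papp (A.sub ((glueCwF D).upI f)) (x.sub f) (y.sub f) hx' hy' (t.sub f) ht' (i.sub f) := by
  refine GlueTm.ext (S.papp_sub _ _ _ _ _ _ _ _ _) ?_
  funext c e
  refine D.papp_congr ?_ ?_ rfl rfl rfl rfl _ _ _ _ _ _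
  · exact S.subTy_upI_comp _ _ (f.sub_fn e) _
  · intro d g i
    exact congrArg (A.val _) (Prod.ext (f.res_fn g e) rfl)

theorem GlueTm.plam_sub {Y : GlueOb.{u, w} F} (f : GlueHom Y X) (b : GlueTm D (X.extI D)) :
    (plam b).sub f = plam (b.sub ((glueCwF D).upI f)) := by
  refine GlueTm.ext (S.plam_sub _ _) ?_
  funext c e
  refine D.plam_congr ?_ ?_ ?_ ?_
  · exact (S.subTy_upI_comp _ _ (f.sub_fn e) _).trans (congrArg _ (S.typ_sub _ _).symm)
  · intro d g i
    exact congrArg (b.typ.val _) (Prod.ext (f.res_fn g e) rfl)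
  · exact S.subTm_upI_comp _ _ (f.sub_fn e) _
  · intro d g i
    exact congrArg (b.val _) (Prod.ext (f.res_fn g e) rfl)

theorem GlueTm.typ_papp (A : GlueTy D (X.extI D)) (x y : GlueTm D X)
    (hx : x.typ = A.sub ((glueCwF D).instI ((glueCwF D).i0 X)))
    (hy : y.typ = A.sub ((glueCwF D).instI ((glueCwF D).i1 X)))
    (t : GlueTm D X) (ht : t.typ = GlueTy.path A x y hx hy) (i : GlueI D X) :
    (papp A x y hx hy t ht i).typ = A.sub ((glueCwF D).instI i) := by
  refine GlueTy.ext (S.typ_papp _ _ _ _ _ _ _ _) ?_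
  funext c e
  exact (D.tyOf_papp _ _ _ _ _ _ _ _ _).trans (A.famI_app e _)

theorem GlueTm.typ_plam (b : GlueTm D (X.extI D))
    (h₀ : (b.sub ((glueCwF D).instI ((glueCwF D).i0 X))).typ =
      b.typ.sub ((glueCwF D).instI ((glueCwF D).i0 X)))
    (h₁ : (b.sub ((glueCwF D).instI ((glueCwF D).i1 X))).typ =
      b.typ.sub ((glueCwF D).instI ((glueCwF D).i1 X))) :
    (plam b).typ = GlueTy.path b.typ (b.sub ((glueCwF D).instI ((glueCwF D).i0 X)))
      (b.sub ((glueCwF D).instI ((glueCwF D).i1 X))) h₀ h₁ := by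
  refine GlueTy.ext (S.typ_plam _) ?_
  funext c e
  refine (D.tyOf_plam _ _ _ _ _).trans ?_
  -- The endpoints of the displayed path are applications of the family, those of the glued path are
  -- values at (e, 0) and (e, 1).
  exact D.path_congr rfl (fun _ _ => rfl) (GlueTy.famITm_app b e _) (GlueTy.famITm_app b e _)
    _ _ _ _

/-- The rule is demanded of the glued model only under `βη`, and in that case `S` supplies it for
the bases and `D` for the values. The same holds for η. -/
theorem GlueTm.path_beta (hβη : βη) (b : GlueTm D (X.extI D)) (i : GlueI D X)
    (h₀ : (b.sub ((glueCwF D).instI ((glueCwF D).i0 X))).typ =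
      b.typ.sub ((glueCwF D).instI ((glueCwF D).i0 X)))
    (h₁ : (b.sub ((glueCwF D).instI ((glueCwF D).i1 X))).typ =
      b.typ.sub ((glueCwF D).instI ((glueCwF D).i1 X))) :
    papp b.typ _ _ h₀ h₁ (plam b) (typ_plam b h₀ h₁) i = b.sub ((glueCwF D).instI i) := by
  refine GlueTm.ext (S.path_beta hβη _ _) ?_
  funext c e
  refine Eq.trans ?_ ((D.path_beta hβη _ _ _ _ (GlueTy.famITm b e) (i.val c e)).trans
    (GlueTy.famITm_app b e _))
  exact D.papp_congr rfl (fun _ _ => rfl) (GlueTy.famITm_app b e _).symm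
    (GlueTy.famITm_app b e _).symm rfl rfl _ _ _ _ _ _

/-- Same mechanism as η for Π-types, with `pappVar` in place of `appVar`. -/
theorem GlueTm.path_eta (hβη : βη) (A : GlueTy D (X.extI D)) (x y : GlueTm D X)
    (hx : x.typ = A.sub ((glueCwF D).instI ((glueCwF D).i0 X)))
    (hy : y.typ = A.sub ((glueCwF D).instI ((glueCwF D).i1 X)))
    (t : GlueTm D X) (ht : t.typ = GlueTy.path A x y hx hy)
    (h₀ : (x.sub (GlueHom.pI X)).typ =
      GlueTy.sub ((glueCwF D).instI ((glueCwF D).i0 _)) (A.sub ((glueCwF D).upI (GlueHom.pI X))))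
    (h₁ : (y.sub (GlueHom.pI X)).typ =
      GlueTy.sub ((glueCwF D).instI ((glueCwF D).i1 _)) (A.sub ((glueCwF D).upI (GlueHom.pI X))))
    (h₂ : (t.sub (GlueHom.pI X)).typ =
      GlueTy.path (A.sub ((glueCwF D).upI (GlueHom.pI X))) (x.sub (GlueHom.pI X))
        (y.sub (GlueHom.pI X)) h₀ h₁) :
    plam (papp (A.sub ((glueCwF D).upI (GlueHom.pI X))) (x.sub (GlueHom.pI X))
        (y.sub (GlueHom.pI X)) h₀ h₁ (t.sub (GlueHom.pI X)) h₂ (GlueI.qI X)) = t := by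
  refine GlueTm.ext (S.path_eta hβη _ _ _ _ _ _ (base_typ ht)) ?_
  funext c e
  set b := papp (A.sub ((glueCwF D).upI (GlueHom.pI X))) (x.sub (GlueHom.pI X))
        (y.sub (GlueHom.pI X)) h₀ h₁ (t.sub (GlueHom.pI X)) h₂ (GlueI.qI X) with hb
  have hA : b.typ = A := by
    refine (typ_papp _ _ _ _ _ _ _ _).trans (GlueTy.ext ?_ ?_)
    · refine Eq.trans ?_ (S.typ_pappVar A.base x.base y.base (base_typ hx) (base_typ hy) t.base
        (base_typ ht))
      exact (S.typ_papp _ _ _ _ _ _ _ _).symm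
    · funext d x
      rfl
  have hbb : S.subTm (S.upI (X.sub e)) b.base =
      S.pappVar (S.subTy (S.upI (X.sub e)) A.base) (D.tmb (x.val c e)) (D.tmb (y.val c e))
        ((A.famI e).typ_end _ _ _ (D.ib_i0 c) (val_end hx e))
        ((A.famI e).typ_end _ _ _ (D.ib_i1 c) (val_end hy e))
        (D.tmb (t.val c e)) (by rw [D.typ_tmb, val_typ ht, D.tyb_path]) := by
    refine (S.pappVar_sub (X.sub e) A.base x.base y.base (base_typ hx) (base_typ hy) t.base
      (base_typ ht)).trans ?_
    exact S.papp_congr rfl (by rw [x.tmb_val]) (by rw [y.tmb_val]) (by rw [t.tmb_val]) rfl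
      _ _ _ _ _ _
  have hv : ∀ {d : Q.Ob} (f : d ⟶ c) (i : D.I d),
      (GlueTy.famI b.typ e).val f i = (A.famI e).val f i := by
    intro d f i; rw [hA]
  have := D.path_eta hβη _ (A.famI e) (x.val c e) (y.val c e) (val_end hx e) (val_end hy e)
    (t.val c e) (val_typ ht e)
    (DispModel.FamITm.copy D (A.famI e) (GlueTy.famITm b e) (S.typ_pappVar _ _ _ _ _ _ _) hbb hv) ?_
  · refine Eq.trans ?_ this
    refine D.plam_congr ?_ hv hbb ?_
    · rw [hA]
    · intro d f i; rfl
  · intro d f i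
    refine D.papp_congr ?_ ?_ (x.res_val f e).symm (y.res_val f e).symm (t.res_val f e).symm rfl
      _ _ _ _ _ _
    · exact (S.subTy_upI_comp _ _ (S.pairI_p _ _).symm _).symm.trans
        (S.subTy_upI_comp _ _ (X.sub_res f e) _)
    · intro d' g i
      exact congrArg (A.val _) (Prod.ext (X.res_comp g f e).symm rfl)

end Path

variable (D) in
/-- The glued model. -/
abbrev glueModel : CTTModel.{max u (w + 1), max u w} βη where
  toCwF := glueCwF D
  pi A B := GlueTy.pi A B
  pi_sub f A B := GlueTy.pi_sub f A B
  lam A b := GlueTm.lam A b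
  typ_lam A b := GlueTm.typ_lam A b
  lam_sub f A b := GlueTm.lam_sub f A b
  app A B t a ht ha := GlueTm.app A B t a ht ha
  typ_app A B t a ht ha := GlueTm.typ_app A B t a ht ha
  app_sub f A B t a ht ha := GlueTm.app_sub f A B t a ht ha _ _
  pi_beta A b a ha := GlueTm.pi_beta A b a ha
  pi_eta A B t ht := GlueTm.pi_eta A B t ht _ _
  path A x y hx hy := GlueTy.path A x y hx hy
  path_sub f A x y hx hy := GlueTy.path_sub f A x y hx hy _ _
  papp A x y hx hy t ht i := GlueTm.papp A x y hx hy t ht i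
  typ_papp A x y hx hy t ht i := GlueTm.typ_papp A x y hx hy t ht i
  papp_sub f A x y hx hy t ht i := GlueTm.papp_sub f A x y hx hy t ht i _ _ _
  papp_i0 A x y hx hy t ht :=
    GlueTm.ext (S.papp_i0 _ _ _ _ _ _ _) (by funext c e; exact D.papp_i0 _ _ _ _ _ _ _ _)
  papp_i1 A x y hx hy t ht :=
    GlueTm.ext (S.papp_i1 _ _ _ _ _ _ _) (by funext c e; exact D.papp_i1 _ _ _ _ _ _ _ _)
  plam b := GlueTm.plam b
  typ_plam b := GlueTm.typ_plam b _ _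
  plam_sub f b := GlueTm.plam_sub f b
  path_beta h := fun b i => GlueTm.path_beta h b i _ _
  path_eta h := fun A x y hx hy t ht => GlueTm.path_eta h A x y hx hy t ht _ _ _

end Glue

/-! # Universe lifting -/

/-- Objects and morphisms are both lifted: `glueModel D` lives in larger universes than `S`, and
uniqueness of morphisms out of `S` is assumed for models in those universes. Projecting the glued
model therefore has to land in a lifted copy of `S`. -/
instance ULift.liftedCategory (X : Type o) [Category.{m} X] :
    Category.{max m m'} (ULift.{o'} X) where
  Hom x y := ULift.{m'} (x.down ⟶ y.down)
  id x := ⟨𝟙 x.down⟩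
  comp f g := ⟨f.down ≫ g.down⟩
  id_comp f := congrArg ULift.up (Category.id_comp f.down)
  comp_id f := congrArg ULift.up (Category.comp_id f.down)
  assoc f g h := congrArg ULift.up (Category.assoc f.down g.down h.down)

abbrev CubAlg.ulift (C : CubAlg.{o, m}) : CubAlg.{max o o', max m m'} where
  Ob := ULift.{o'} C.Ob
  cat := ULift.liftedCategory.{o, m, o', m'} C.Ob
  one := ⟨C.one⟩
  bang Γ := ⟨C.bang Γ.down⟩
  bang_uniq f := congrArg ULift.up (C.bang_uniq f.down)
  I Γ := ULift.{m'} (C.I Γ.down)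
  subI f i := ⟨C.subI f.down i.down⟩
  subI_id i := congrArg ULift.up (C.subI_id i.down)
  subI_comp g f i := congrArg ULift.up (C.subI_comp g.down f.down i.down)
  i0 Γ := ⟨C.i0 Γ.down⟩
  i1 Γ := ⟨C.i1 Γ.down⟩
  subI_i0 f := congrArg ULift.up (C.subI_i0 f.down)
  subI_i1 f := congrArg ULift.up (C.subI_i1 f.down)
  extI Γ := ⟨C.extI Γ.down⟩
  pI Γ := ⟨C.pI Γ.down⟩
  qI Γ := ⟨C.qI Γ.down⟩
  pairI f i := ⟨C.pairI f.down i.down⟩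
  pairI_p f i := congrArg ULift.up (C.pairI_p f.down i.down)
  pairI_q f i := congrArg ULift.up (C.pairI_q f.down i.down)
  pairI_eta g := congrArg ULift.up (C.pairI_eta g.down)

abbrev CwF.ulift (M : CwF.{o, m}) : CwF.{max o o', max m m'} where
  toCubAlg := CubAlg.ulift.{o, m, o', m'} M.toCubAlg
  Ty Γ := ULift.{m'} (M.Ty Γ.down)
  subTy f A := ⟨M.subTy f.down A.down⟩
  subTy_id A := congrArg ULift.up (M.subTy_id A.down)
  subTy_comp g f A := congrArg ULift.up (M.subTy_comp g.down f.down A.down)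
  Tm Γ := ULift.{m'} (M.Tm Γ.down)
  subTm f a := ⟨M.subTm f.down a.down⟩
  subTm_id a := congrArg ULift.up (M.subTm_id a.down)
  subTm_comp g f a := congrArg ULift.up (M.subTm_comp g.down f.down a.down)
  typ a := ⟨M.typ a.down⟩
  typ_sub f a := congrArg ULift.up (M.typ_sub f.down a.down)
  ext A := ⟨M.ext A.down⟩
  p A := ⟨M.p A.down⟩
  q A := ⟨M.q A.down⟩
  typ_q A := congrArg ULift.up (M.typ_q A.down)
  pair f A a h := ⟨M.pair f.down A.down a.down (congrArg ULift.down h)⟩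
  pair_p f A a h := congrArg ULift.up (M.pair_p f.down A.down a.down (congrArg ULift.down h))
  pair_q f A a h := congrArg ULift.up (M.pair_q f.down A.down a.down (congrArg ULift.down h))
  pair_eta A g := congrArg ULift.up (M.pair_eta A.down g.down)

abbrev CTTModel.ulift {βη : Prop} (S : CTTModel.{o, m} βη) :
    CTTModel.{max o o', max m m'} βη where
  toCwF := CwF.ulift.{o, m, o', m'} S.toCwF
  pi A B := ⟨S.pi A.down B.down⟩
  pi_sub f A B := congrArg ULift.up (S.pi_sub f.down A.down B.down)
  lam A b := ⟨S.lam A.down b.down⟩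
  typ_lam A b := congrArg ULift.up (S.typ_lam A.down b.down)
  lam_sub f A b := congrArg ULift.up (S.lam_sub f.down A.down b.down)
  app A B t a ht ha := ⟨S.app A.down B.down t.down a.down (congrArg ULift.down ht)
    (congrArg ULift.down ha)⟩
  typ_app A B t a ht ha := congrArg ULift.up (S.typ_app A.down B.down t.down a.down
    (congrArg ULift.down ht) (congrArg ULift.down ha))
  app_sub f A B t a ht ha := congrArg ULift.up (S.app_sub f.down A.down B.down t.down a.down
    (congrArg ULift.down ht) (congrArg ULift.down ha))
  pi_beta A b a ha := congrArg ULift.up (S.pi_beta A.down b.down a.down (congrArg ULift.down ha))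
  pi_eta A B t ht := congrArg ULift.up (S.pi_eta A.down B.down t.down (congrArg ULift.down ht))
  path A x y hx hy := ⟨S.path A.down x.down y.down (congrArg ULift.down hx)
    (congrArg ULift.down hy)⟩
  path_sub f A x y hx hy := congrArg ULift.up (S.path_sub f.down A.down x.down y.down
    (congrArg ULift.down hx) (congrArg ULift.down hy))
  papp A x y hx hy t ht i := ⟨S.papp A.down x.down y.down (congrArg ULift.down hx)
    (congrArg ULift.down hy) t.down (congrArg ULift.down ht) i.down⟩
  typ_papp A x y hx hy t ht i := congrArg ULift.up (S.typ_papp A.down x.down y.down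
    (congrArg ULift.down hx) (congrArg ULift.down hy) t.down (congrArg ULift.down ht) i.down)
  papp_sub f A x y hx hy t ht i := congrArg ULift.up (S.papp_sub f.down A.down x.down y.down
    (congrArg ULift.down hx) (congrArg ULift.down hy) t.down (congrArg ULift.down ht) i.down)
  papp_i0 A x y hx hy t ht := congrArg ULift.up (S.papp_i0 A.down x.down y.down
    (congrArg ULift.down hx) (congrArg ULift.down hy) t.down (congrArg ULift.down ht))
  papp_i1 A x y hx hy t ht := congrArg ULift.up (S.papp_i1 A.down x.down y.down
    (congrArg ULift.down hx) (congrArg ULift.down hy) t.down (congrArg ULift.down ht))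
  plam b := ⟨S.plam b.down⟩
  typ_plam b := congrArg ULift.up (S.typ_plam b.down)
  plam_sub f b := congrArg ULift.up (S.plam_sub f.down b.down)
  path_beta h := fun b i => congrArg ULift.up (S.path_beta h b.down i.down)
  path_eta h := fun A x y hx hy t ht => congrArg ULift.up (S.path_eta h A.down x.down y.down
    (congrArg ULift.down hx) (congrArg ULift.down hy) t.down (congrArg ULift.down ht))

/-- The canonical morphism to the lifted cubical algebra. -/
def CubAlg.upHom (C : CubAlg.{o, m}) : CubAlg.Hom C (CubAlg.ulift.{o, m, o', m'} C) where
  obj Γ := ⟨Γ⟩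
  map f := ⟨f⟩
  map_id _ := rfl
  map_comp _ _ := rfl
  onI i := ⟨i⟩
  onI_sub _ _ := rfl
  onI_i0 _ := rfl
  onI_i1 _ := rfl
  obj_one := rfl
  obj_extI _ := rfl
  map_pI Γ := congrArg ULift.up (Category.id_comp (C.pI Γ)).symm
  onI_qI _ := ((CubAlg.ulift.{o, m, o', m'} C).subI_id _).symm

/-- The canonical morphism to the lifted model. -/
def CTTModel.upHom {βη : Prop} (S : CTTModel.{o, m} βη) :
    CTTModel.Hom S (CTTModel.ulift.{o, m, o', m'} S) where
  toCubHom := CubAlg.upHom.{o, m, o', m'} S.toCubAlg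
  onTy A := ⟨A⟩
  onTy_sub _ _ := rfl
  onTm a := ⟨a⟩
  onTm_sub _ _ := rfl
  typ_onTm _ := rfl
  obj_ext _ := rfl
  map_p A := congrArg ULift.up (Category.id_comp (S.p A)).symm
  onTm_q _ := ((CTTModel.ulift.{o, m, o', m'} S).subTm_id _).symm
  on_pi A B := congrArg (fun B => ULift.up (S.pi A B)) (S.subTy_id B).symm
  on_lam A b := congrArg (fun b => ULift.up (S.lam A b)) (S.subTm_id b).symm
  on_app _ B _ _ _ _ := congrArg ULift.up
    (S.app_congr rfl (heq_of_eq (S.subTy_id B).symm) rfl rfl _ _ _ _)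
  on_path A _ _ _ _ := congrArg ULift.up
    (S.path_congr (S.subTy_id A).symm rfl rfl _ _ _ _)
  on_papp A _ _ _ _ _ _ _ := congrArg ULift.up
    (S.papp_congr (S.subTy_id A).symm rfl rfl rfl rfl _ _ _ _ _ _)
  on_plam b := congrArg (fun b => ULift.up (S.plam b)) (S.subTm_id b).symm

/-! ### Projecting the glued model back to the syntax -/

section Proj

variable {βη : Prop} {S : CTTModel.{u, u} βη} {Q : CubAlg.{u, u}}
  {F : CubAlg.Hom Q S.toCubAlg} {D : DispModel.{u, w} F}

/-- Strict preservation of extensions by a morphism is expressed with `eqToHom` between glued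
objects. This and the next three lemmas show that projecting such a transport gives the transport
along the equality of bases. -/
theorem GlueOb.up_eqToHom_base {X Y : GlueOb.{u, w} F} (h : X = Y) :
    (ULift.up (GlueHom.base (eqToHom h)) :
      @Quiver.Hom (CubAlg.ulift.{u, u, w + 1, w} S.toCubAlg).Ob _ ⟨X.base⟩ ⟨Y.base⟩) =
      eqToHom (congrArg (fun X : GlueOb.{u, w} F => ULift.up X.base) h) := by
  subst h; rfl

theorem GlueOb.ulift_subTy_eqToHom {X Y : GlueOb.{u, w} F} (h : X = Y) (A : S.Ty Y.base)
    (h' : (ULift.up X.base : (CwF.ulift.{u, u, w + 1, w} S.toCwF).Ob) = ULift.up Y.base) :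
    (CwF.ulift.{u, u, w + 1, w} S.toCwF).subTy (eqToHom h') ⟨A⟩ =
      ⟨S.subTy (GlueHom.base (eqToHom h)) A⟩ := by
  subst h; rfl

theorem GlueOb.ulift_subTm_eqToHom {X Y : GlueOb.{u, w} F} (h : X = Y) (a : S.Tm Y.base)
    (h' : (ULift.up X.base : (CwF.ulift.{u, u, w + 1, w} S.toCwF).Ob) = ULift.up Y.base) :
    (CwF.ulift.{u, u, w + 1, w} S.toCwF).subTm (eqToHom h') ⟨a⟩ =
      ⟨S.subTm (GlueHom.base (eqToHom h)) a⟩ := by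
  subst h; rfl

theorem GlueOb.ulift_eqToHom_comp {X Y : GlueOb.{u, w} F} (h : X = Y) {Γ : S.Ob}
    (f : Y.base ⟶ Γ)
    (h' : (ULift.up X.base : (CwF.ulift.{u, u, w + 1, w} S.toCwF).Ob) = ULift.up Y.base) :
    (eqToHom h' ≫ ⟨f⟩ : (⟨X.base⟩ : (CwF.ulift.{u, u, w + 1, w} S.toCwF).Ob) ⟶ ⟨Γ⟩) =
      ⟨GlueHom.base (eqToHom h) ≫ f⟩ := by
  subst h; rfl

/-- The composition of a morphism to the glued model with the projection to `S`. -/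
abbrev CTTModel.Hom.baseCub (σ : CTTModel.Hom S (glueModel D)) :
    CubAlg.Hom S.toCubAlg (CubAlg.ulift.{u, u, w + 1, w} S.toCubAlg) where
  obj Γ := ⟨(σ.obj Γ).base⟩
  map f := ⟨(σ.map f).base⟩
  map_id Γ := by rw [σ.map_id]; rfl
  map_comp g f := by rw [σ.map_comp]; rfl
  onI i := ⟨(σ.onI i).base⟩
  onI_sub f i := congrArg (fun i => ULift.up (GlueI.base i)) (σ.onI_sub f i)
  onI_i0 _ := by rw [σ.onI_i0]
  onI_i1 _ := by rw [σ.onI_i1]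
  obj_one := by rw [σ.obj_one]
  obj_extI _ := by rw [σ.obj_extI]
  map_pI Γ := by
    rw [σ.map_pI, ← GlueOb.up_eqToHom_base (σ.obj_extI Γ)]; rfl
  onI_qI Γ := by
    rw [σ.onI_qI, ← GlueOb.up_eqToHom_base (σ.obj_extI Γ)]

/-- The composition of a morphism to the glued model with the projection to `S`. -/
abbrev CTTModel.Hom.baseCwF (σ : CTTModel.Hom S (glueModel D)) :
    CwF.Hom S.toCwF (CwF.ulift.{u, u, w + 1, w} S.toCwF) where
  toCubHom := σ.baseCub
  onTy A := ⟨(σ.onTy A).base⟩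
  onTy_sub f A := by rw [σ.onTy_sub]
  onTm a := ⟨(σ.onTm a).base⟩
  onTm_sub f a := by rw [σ.onTm_sub]
  typ_onTm a := congrArg (fun A => ULift.up (GlueTy.base A)) (σ.typ_onTm a)
  obj_ext A := congrArg (fun X : GlueOb.{u, w} F => ULift.up X.base) (σ.obj_ext A)
  map_p A := 
    (congrArg (fun f => ULift.up (GlueHom.base f)) (σ.map_p A)).trans
      (GlueOb.ulift_eqToHom_comp (σ.obj_ext A) _ _).symm
  onTm_q A := 
    (congrArg (fun f => ULift.up (GlueTm.base f)) (σ.onTm_q A)).trans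
      (GlueOb.ulift_subTm_eqToHom (σ.obj_ext A) _ _).symm

theorem CTTModel.Hom.baseCwF_onTyExt (σ : CTTModel.Hom S (glueModel D)) {Γ : S.Ob}
    (A : S.Ty Γ) (B : S.Ty (S.ext A)) :
    σ.baseCwF.onTyExt A B = ⟨(σ.onTyExt A B).base⟩ := 
  GlueOb.ulift_subTy_eqToHom (σ.obj_ext A).symm _ _

theorem CTTModel.Hom.baseCwF_onTmExt (σ : CTTModel.Hom S (glueModel D)) {Γ : S.Ob}
    (A : S.Ty Γ) (b : S.Tm (S.ext A)) :
    σ.baseCwF.onTmExt A b = ⟨(σ.onTmExt A b).base⟩ := 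
  GlueOb.ulift_subTm_eqToHom (σ.obj_ext A).symm _ _

theorem CTTModel.Hom.baseCwF_onTyExtI (σ : CTTModel.Hom S (glueModel D)) {Γ : S.Ob}
    (A : S.Ty (S.extI Γ)) : σ.baseCwF.onTyExtI A = ⟨(σ.onTyExtI A).base⟩ := 
  GlueOb.ulift_subTy_eqToHom (σ.obj_extI Γ).symm _ _

theorem CTTModel.Hom.baseCwF_onTmExtI (σ : CTTModel.Hom S (glueModel D)) {Γ : S.Ob}
    (b : S.Tm (S.extI Γ)) : σ.baseCwF.onTmExtI b = ⟨(σ.onTmExtI b).base⟩ := 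
  GlueOb.ulift_subTm_eqToHom (σ.obj_extI Γ).symm _ _

/-- The composition of a morphism to the glued model with the projection to `S`. -/
abbrev CTTModel.Hom.baseHom (σ : CTTModel.Hom S (glueModel D)) :
    CTTModel.Hom S (CTTModel.ulift.{u, u, w + 1, w} S) where
  toCwFHom := σ.baseCwF
  on_pi A B := (congrArg (fun A => ULift.up (GlueTy.base A)) (σ.on_pi A B)).trans
    (congrArg (fun B => ULift.up (S.pi _ B))
      (congrArg ULift.down (σ.baseCwF_onTyExt A B)).symm)
  on_lam A b := (congrArg (fun a => ULift.up (GlueTm.base a)) (σ.on_lam A b)).trans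
    (congrArg (fun b => ULift.up (S.lam _ b))
      (congrArg ULift.down (σ.baseCwF_onTmExt A b)).symm)
  on_app A B t a ht ha := (congrArg (fun a => ULift.up (GlueTm.base a))
    (σ.on_app A B t a ht ha)).trans (congrArg ULift.up (S.app_congr rfl
      (heq_of_eq (congrArg ULift.down (σ.baseCwF_onTyExt A B)).symm) rfl rfl _ _ _ _))
  on_path A x y hx hy := (congrArg (fun A => ULift.up (GlueTy.base A))
    (σ.on_path A x y hx hy)).trans (congrArg ULift.up (S.path_congr
      (congrArg ULift.down (σ.baseCwF_onTyExtI A)).symm rfl rfl _ _ _ _))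
  on_papp A x y hx hy t ht i := (congrArg (fun a => ULift.up (GlueTm.base a))
    (σ.on_papp A x y hx hy t ht i)).trans (congrArg ULift.up (S.papp_congr
      (congrArg ULift.down (σ.baseCwF_onTyExtI A)).symm rfl rfl rfl rfl _ _ _ _ _ _))
  on_plam b := (congrArg (fun a => ULift.up (GlueTm.base a)) (σ.on_plam b)).trans
    (congrArg (fun b => ULift.up (S.plam b))
      (congrArg ULift.down (σ.baseCwF_onTmExtI b)).symm)

end Proj

/-! # Interpretations of the syntax in a displayed model -/

section Interp

variable {βη : Prop} {S : CTTModel.{u, u} βη} {Q : CubAlg.{u, u}} {F : CubAlg.Hom Q S.toCubAlg}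

/-- The judgemental part of an interpretation of `S` in a displayed model: a presheaf `E Γ` of
environments over the nerve of every object `Γ`, with interpretations of substitutions, types,
terms and interval elements. -/
structure InterpBase (D : DispModel.{u, w} F) where
  E : S.Ob → Q.Ob → Type w
  res : ∀ {Γ : S.Ob} {d c : Q.Ob}, (d ⟶ c) → E Γ c → E Γ d
  res_id : ∀ {Γ : S.Ob} {c : Q.Ob} (e : E Γ c), res (𝟙 c) e = e
  res_comp : ∀ {Γ : S.Ob} {d' d c : Q.Ob} (g : d' ⟶ d) (f : d ⟶ c) (e : E Γ c),
    res (g ≫ f) e = res g (res f e)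
  sub : ∀ {Γ : S.Ob} {c : Q.Ob}, E Γ c → (F.obj c ⟶ Γ)
  sub_res : ∀ {Γ : S.Ob} {d c : Q.Ob} (f : d ⟶ c) (e : E Γ c), sub (res f e) = F.map f ≫ sub e
  map : ∀ {Δ Γ : S.Ob} (_ : Δ ⟶ Γ) {c : Q.Ob}, E Δ c → E Γ c
  map_id : ∀ {Γ : S.Ob} {c : Q.Ob} (e : E Γ c), map (𝟙 Γ) e = e
  map_comp : ∀ {Θ Δ Γ : S.Ob} (g : Θ ⟶ Δ) (f : Δ ⟶ Γ) {c : Q.Ob} (e : E Θ c),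
    map (g ≫ f) e = map f (map g e)
  res_map : ∀ {Δ Γ : S.Ob} (f : Δ ⟶ Γ) {d c : Q.Ob} (g : d ⟶ c) (e : E Δ c),
    res g (map f e) = map f (res g e)
  sub_map : ∀ {Δ Γ : S.Ob} (f : Δ ⟶ Γ) {c : Q.Ob} (e : E Δ c), sub (map f e) = sub e ≫ f
  ty : ∀ {Γ : S.Ob} {c : Q.Ob}, S.Ty Γ → E Γ c → D.Ty c
  tyb_ty : ∀ {Γ : S.Ob} {c : Q.Ob} (A : S.Ty Γ) (e : E Γ c), D.tyb (ty A e) = S.subTy (sub e) A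
  ty_res : ∀ {Γ : S.Ob} {d c : Q.Ob} (f : d ⟶ c) (A : S.Ty Γ) (e : E Γ c),
    D.resTy f (ty A e) = ty A (res f e)
  ty_sub : ∀ {Δ Γ : S.Ob} {c : Q.Ob} (f : Δ ⟶ Γ) (A : S.Ty Γ) (e : E Δ c),
    ty (S.subTy f A) e = ty A (map f e)
  tm : ∀ {Γ : S.Ob} {c : Q.Ob}, S.Tm Γ → E Γ c → D.Tm c
  tyOf_tm : ∀ {Γ : S.Ob} {c : Q.Ob} (a : S.Tm Γ) (e : E Γ c), D.tyOf (tm a e) = ty (S.typ a) e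
  tmb_tm : ∀ {Γ : S.Ob} {c : Q.Ob} (a : S.Tm Γ) (e : E Γ c), D.tmb (tm a e) = S.subTm (sub e) a
  tm_res : ∀ {Γ : S.Ob} {d c : Q.Ob} (f : d ⟶ c) (a : S.Tm Γ) (e : E Γ c),
    D.resTm f (tm a e) = tm a (res f e)
  tm_sub : ∀ {Δ Γ : S.Ob} {c : Q.Ob} (f : Δ ⟶ Γ) (a : S.Tm Γ) (e : E Δ c),
    tm (S.subTm f a) e = tm a (map f e)
  int : ∀ {Γ : S.Ob} {c : Q.Ob}, S.I Γ → E Γ c → D.I c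
  ib_int : ∀ {Γ : S.Ob} {c : Q.Ob} (i : S.I Γ) (e : E Γ c), D.ib (int i e) = S.subI (sub e) i
  int_res : ∀ {Γ : S.Ob} {d c : Q.Ob} (f : d ⟶ c) (i : S.I Γ) (e : E Γ c),
    D.resI f (int i e) = int i (res f e)
  int_sub : ∀ {Δ Γ : S.Ob} {c : Q.Ob} (f : Δ ⟶ Γ) (i : S.I Γ) (e : E Δ c),
    int (S.subI f i) e = int i (map f e)
  int_i0 : ∀ {Γ : S.Ob} {c : Q.Ob} (e : E Γ c), int (S.i0 Γ) e = D.i0 c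
  int_i1 : ∀ {Γ : S.Ob} {c : Q.Ob} (e : E Γ c), int (S.i1 Γ) e = D.i1 c
  star : ∀ c : Q.Ob, E S.one c
  star_uniq : ∀ {c : Q.Ob} (e : E S.one c), e = star c
  pair : ∀ {Γ : S.Ob} {c : Q.Ob} (e : E Γ c) (A : S.Ty Γ) (a : D.Tm c), D.tyOf a = ty A e →
    E (S.ext A) c
  map_p : ∀ {Γ : S.Ob} {c : Q.Ob} (e : E Γ c) (A : S.Ty Γ) (a : D.Tm c) (ha : D.tyOf a = ty A e),
    map (S.p A) (pair e A a ha) = e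
  tm_q : ∀ {Γ : S.Ob} {c : Q.Ob} (e : E Γ c) (A : S.Ty Γ) (a : D.Tm c) (ha : D.tyOf a = ty A e),
    tm (S.q A) (pair e A a ha) = a
  pair_eta : ∀ {Γ : S.Ob} {c : Q.Ob} (A : S.Ty Γ) (e : E (S.ext A) c),
    pair (map (S.p A) e) A (tm (S.q A) e) (by rw [tyOf_tm, S.typ_q, ty_sub]) = e
  pairI : ∀ {Γ : S.Ob} {c : Q.Ob}, E Γ c → D.I c → E (S.extI Γ) c
  map_pI : ∀ {Γ : S.Ob} {c : Q.Ob} (e : E Γ c) (i : D.I c), map (S.pI Γ) (pairI e i) = e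
  int_qI : ∀ {Γ : S.Ob} {c : Q.Ob} (e : E Γ c) (i : D.I c), int (S.qI Γ) (pairI e i) = i
  pairI_eta : ∀ {Γ : S.Ob} {c : Q.Ob} (e : E (S.extI Γ) c),
    pairI (map (S.pI Γ) e) (int (S.qI Γ) e) = e

namespace InterpBase

variable {D : DispModel.{u, w} F} (J : InterpBase D)

/-- Environments in Γ.A have the universal property of substitutions into Γ.A. The calculus of
pairing, weakening and instantiation therefore repeats for environments, starting from this
extensionality principle. -/
theorem ext_env {Γ : S.Ob} {c : Q.Ob} {A : S.Ty Γ} {e e' : J.E (S.ext A) c}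
    (hp : J.map (S.p A) e = J.map (S.p A) e') (hq : J.tm (S.q A) e = J.tm (S.q A) e') :
    e = e' := by
  rw [← J.pair_eta A e, ← J.pair_eta A e']
  congr 1

theorem extI_env {Γ : S.Ob} {c : Q.Ob} {e e' : J.E (S.extI Γ) c}
    (hp : J.map (S.pI Γ) e = J.map (S.pI Γ) e') (hq : J.int (S.qI Γ) e = J.int (S.qI Γ) e') :
    e = e' := by
  rw [← J.pairI_eta e, ← J.pairI_eta e', hp, hq]

theorem pair_congr {Γ : S.Ob} {c : Q.Ob} {e e' : J.E Γ c} {A : S.Ty Γ} {a a' : D.Tm c}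
    (he : e = e') (ha : a = a') (h : D.tyOf a = J.ty A e) (h' : D.tyOf a' = J.ty A e') :
    J.pair e A a h = J.pair e' A a' h' := by
  subst he ha; rfl

theorem tyOf_res {Γ : S.Ob} {d c : Q.Ob} (f : d ⟶ c) (A : S.Ty Γ) (e : J.E Γ c) (a : D.Tm d)
    (ha : D.tyOf a = D.resTy f (J.ty A e)) : D.tyOf a = J.ty A (J.res f e) := by
  rw [ha, J.ty_res]

theorem res_pair {Γ : S.Ob} {d c : Q.Ob} (f : d ⟶ c) (e : J.E Γ c) (A : S.Ty Γ) (a : D.Tm c)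
    (ha : D.tyOf a = J.ty A e) (h : D.tyOf (D.resTm f a) = J.ty A (J.res f e)) :
    J.res f (J.pair e A a ha) = J.pair (J.res f e) A (D.resTm f a) h := by
  apply J.ext_env
  · rw [← J.res_map, J.map_p, J.map_p]
  · rw [← J.tm_res, J.tm_q, J.tm_q]

theorem res_pairI {Γ : S.Ob} {d c : Q.Ob} (f : d ⟶ c) (e : J.E Γ c) (i : D.I c) :
    J.res f (J.pairI e i) = J.pairI (J.res f e) (D.resI f i) := by
  apply J.extI_env
  · rw [← J.res_map, J.map_pI, J.map_pI]
  · rw [← J.int_res, J.int_qI, J.int_qI]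

theorem sub_pair {Γ : S.Ob} {c : Q.Ob} (e : J.E Γ c) (A : S.Ty Γ) (a : D.Tm c)
    (ha : D.tyOf a = J.ty A e) :
    J.sub (J.pair e A a ha) =
      S.pair (J.sub e) A (D.tmb a) (by rw [D.typ_tmb, ha, J.tyb_ty]) := by
  apply S.hom_ext_ext
  · rw [S.pair_p, ← J.sub_map, J.map_p]
  · rw [S.pair_q, ← J.tmb_tm, J.tm_q]

theorem sub_pairI {Γ : S.Ob} {c : Q.Ob} (e : J.E Γ c) (i : D.I c) :
    J.sub (J.pairI e i) = S.pairI (J.sub e) (D.ib i) := by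
  apply S.hom_extI_ext
  · rw [S.pairI_p, ← J.sub_map, J.map_pI]
  · rw [S.pairI_q, ← J.ib_int, J.int_qI]

theorem map_up_pair {Δ Γ : S.Ob} {c : Q.Ob} (f : Δ ⟶ Γ) (e : J.E Δ c) (A : S.Ty Γ) (a : D.Tm c)
    (ha : D.tyOf a = J.ty (S.subTy f A) e) (ha' : D.tyOf a = J.ty A (J.map f e)) :
    J.map (S.up f A) (J.pair e (S.subTy f A) a ha) = J.pair (J.map f e) A a ha' := by
  apply J.ext_env
  · rw [← J.map_comp, J.map_p, CwF.up, S.pair_p, J.map_comp, J.map_p]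
  · rw [← J.tm_sub, J.tm_q, CwF.up, S.pair_q, J.tm_q]

theorem map_upI_pairI {Δ Γ : S.Ob} {c : Q.Ob} (f : Δ ⟶ Γ) (e : J.E Δ c) (i : D.I c) :
    J.map (S.upI f) (J.pairI e i) = J.pairI (J.map f e) i := by
  apply J.extI_env
  · rw [← J.map_comp, J.map_pI, CubAlg.upI, S.pairI_p, J.map_comp, J.map_pI]
  · rw [← J.int_sub, J.int_qI, CubAlg.upI, S.pairI_q, J.int_qI]

theorem map_instI {Γ : S.Ob} {c : Q.Ob} (i : S.I Γ) (e : J.E Γ c) :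
    J.map (S.instI i) e = J.pairI e (J.int i e) := by
  apply J.extI_env
  · rw [← J.map_comp, J.map_pI, CubAlg.instI, S.pairI_p, J.map_id]
  · rw [← J.int_sub, J.int_qI, CubAlg.instI, S.pairI_q]

/-- The family `λ a^• ↦ ⟦B⟧(e, a^•)`. -/
def famTy {Γ : S.Ob} {c : Q.Ob} (e : J.E Γ c) {γ : F.obj c ⟶ Γ} (hγ : J.sub e = γ) (A : S.Ty Γ)
    (B : S.Ty (S.ext A)) :
    D.FamTy (S.subTy γ A) (J.ty A e) (by rw [J.tyb_ty, hγ]) (S.subTy (S.up γ A) B) where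
  val f a ha := J.ty B (J.pair (J.res f e) A a (J.tyOf_res f A e a ha))
  tyb_val f a ha := by
    subst hγ
    rw [J.tyb_ty, J.sub_pair]
    exact S.subTy_pair_up _ _ (J.sub_res _ _) _ _ _ _ _
  res_val g f a ha := by
    rw [J.ty_res, J.res_pair _ _ _ _ _ (by
      rw [← J.ty_res, D.tyOf_res, J.tyOf_res f A e a ha])]
    congr 1
    exact J.pair_congr (J.res_comp _ _ _).symm rfl _ _

/-- The family `λ a^• ↦ ⟦b⟧(e, a^•)`. -/
def famTm {Γ : S.Ob} {c : Q.Ob} (e : J.E Γ c) {γ : F.obj c ⟶ Γ} (hγ : J.sub e = γ) (A : S.Ty Γ)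
    (b : S.Tm (S.ext A)) :
    D.FamTm (J.famTy e hγ A (S.typ b)) (S.subTm (S.up γ A) b) (S.typ_sub _ _) where
  val f a ha := J.tm b (J.pair (J.res f e) A a (J.tyOf_res f A e a ha))
  tyOf_val f a ha := J.tyOf_tm _ _
  tmb_val f a ha := by
    subst hγ
    rw [J.tmb_tm, J.sub_pair]
    exact S.subTm_pair_up _ _ (J.sub_res _ _) _ _ _ _ _
  res_val g f a ha := by
    rw [J.tm_res, J.res_pair _ _ _ _ _ (by
      rw [← J.ty_res, D.tyOf_res, J.tyOf_res f A e a ha])]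
    congr 1
    exact J.pair_congr (J.res_comp _ _ _).symm rfl _ _

/-- The family `λ i^• ↦ ⟦A⟧(e, i^•)`. -/
def famITy {Γ : S.Ob} {c : Q.Ob} (e : J.E Γ c) {γ : F.obj c ⟶ Γ} (hγ : J.sub e = γ)
    (A : S.Ty (S.extI Γ)) : D.FamITy (S.subTy (S.upI γ) A) where
  val f i := J.ty A (J.pairI (J.res f e) i)
  tyb_val f i := by
    rw [J.tyb_ty, J.sub_pairI, ← S.subTy_comp, CubAlg.pairI_upI, J.sub_res, hγ]
  res_val g f i := by
    rw [J.ty_res, J.res_pairI, J.res_comp]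

/-- The family `λ i^• ↦ ⟦b⟧(e, i^•)`. -/
def famITm {Γ : S.Ob} {c : Q.Ob} (e : J.E Γ c) {γ : F.obj c ⟶ Γ} (hγ : J.sub e = γ)
    (b : S.Tm (S.extI Γ)) :
    D.FamITm (J.famITy e hγ (S.typ b)) (S.subTm (S.upI γ) b) (S.typ_sub _ _) where
  val f i := J.tm b (J.pairI (J.res f e) i)
  tyOf_val f i := J.tyOf_tm _ _
  tmb_val f i := by
    rw [J.tmb_tm, J.sub_pairI, ← S.subTm_comp, CubAlg.pairI_upI, J.sub_res, hγ]
  res_val g f i := by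
    rw [J.tm_res, J.res_pairI, J.res_comp]

theorem tyOf_end {Γ : S.Ob} {c : Q.Ob} (e : J.E Γ c) {γ : F.obj c ⟶ Γ} (hγ : J.sub e = γ)
    (A : S.Ty (S.extI Γ)) (a : S.Tm Γ) {i : S.I Γ} (ha : S.typ a = S.subTy (S.instI i) A)
    {j : D.I c} (hj : J.int i e = j) : D.tyOf (J.tm a e) = (J.famITy e hγ A).app j := by
  subst hj
  rw [J.tyOf_tm, ha, J.ty_sub, J.map_instI]
  -- Applying the family restricts the environment along the identity, which does nothing.
  exact congrArg (fun e' => J.ty A (J.pairI e' (J.int i e))) (J.res_id e).symm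

end InterpBase

/-- An interpretation of `S` in a displayed model. -/
structure Interp (D : DispModel.{u, w} F) extends InterpBase D where
  ty_pi : ∀ {Γ : S.Ob} {c : Q.Ob} (A : S.Ty Γ) (B : S.Ty (S.ext A)) (e : E Γ c),
    ty (S.pi A B) e = D.pi (S.subTy (sub e) A) (ty A e) (tyb_ty A e)
      (S.subTy (S.up (sub e) A) B) (toInterpBase.famTy e rfl A B)
  tm_lam : ∀ {Γ : S.Ob} {c : Q.Ob} (A : S.Ty Γ) (b : S.Tm (S.ext A)) (e : E Γ c),
    tm (S.lam A b) e = D.lam (S.subTy (sub e) A) (ty A e) (tyb_ty A e)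
      (S.subTy (S.up (sub e) A) (S.typ b)) (toInterpBase.famTy e rfl A (S.typ b))
      (S.subTm (S.up (sub e) A) b) (S.typ_sub _ _) (toInterpBase.famTm e rfl A b)
  tm_app : ∀ {Γ : S.Ob} {c : Q.Ob} (A : S.Ty Γ) (B : S.Ty (S.ext A)) (t a : S.Tm Γ)
    (ht : S.typ t = S.pi A B) (ha : S.typ a = A) (e : E Γ c),
    tm (S.app A B t a ht ha) e = D.app (S.subTy (sub e) A) (ty A e) (tyb_ty A e)
      (S.subTy (S.up (sub e) A) B) (toInterpBase.famTy e rfl A B) (tm t e) (tm a e)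
      (by rw [tyOf_tm, ht, ty_pi]) (by rw [tyOf_tm, ha])
  ty_path : ∀ {Γ : S.Ob} {c : Q.Ob} (A : S.Ty (S.extI Γ)) (a b : S.Tm Γ)
    (ha : S.typ a = S.subTy (S.instI (S.i0 Γ)) A) (hb : S.typ b = S.subTy (S.instI (S.i1 Γ)) A)
    (e : E Γ c),
    ty (S.path A a b ha hb) e = D.path (S.subTy (S.upI (sub e)) A) (toInterpBase.famITy e rfl A)
      (tm a e) (tm b e) (toInterpBase.tyOf_end e rfl A a ha (int_i0 e))
      (toInterpBase.tyOf_end e rfl A b hb (int_i1 e))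
  tm_papp : ∀ {Γ : S.Ob} {c : Q.Ob} (A : S.Ty (S.extI Γ)) (a b : S.Tm Γ)
    (ha : S.typ a = S.subTy (S.instI (S.i0 Γ)) A) (hb : S.typ b = S.subTy (S.instI (S.i1 Γ)) A)
    (t : S.Tm Γ) (ht : S.typ t = S.path A a b ha hb) (i : S.I Γ) (e : E Γ c),
    tm (S.papp A a b ha hb t ht i) e =
      D.papp (S.subTy (S.upI (sub e)) A) (toInterpBase.famITy e rfl A)
        (tm a e) (tm b e) (toInterpBase.tyOf_end e rfl A a ha (int_i0 e))
        (toInterpBase.tyOf_end e rfl A b hb (int_i1 e)) (tm t e)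
        (by rw [tyOf_tm, ht, ty_path]) (int i e)
  tm_plam : ∀ {Γ : S.Ob} {c : Q.Ob} (b : S.Tm (S.extI Γ)) (e : E Γ c),
    tm (S.plam b) e = D.plam (S.subTy (S.upI (sub e)) (S.typ b))
      (toInterpBase.famITy e rfl (S.typ b)) (S.subTm (S.upI (sub e)) b) (S.typ_sub _ _)
      (toInterpBase.famITm e rfl b)

end Interp

/-! # The interpretation given by a section of the glued model -/

section FromGlue

variable {βη : Prop} {S : CTTModel.{u, u} βη}

namespace CTTModel.Hom

variable {K : CTTModel.Hom S (CTTModel.ulift.{u, u, w + 1, w} S)}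
  (h : K = CTTModel.upHom.{u, u, w + 1, w} S)

include h

/-- `K` will be the projection of the morphism given by initiality, which is equal to the lift but
not definitionally. Stating the consequences for a variable `K` allows the equation to be
eliminated; each instance then holds up to an explicit transport. -/
theorem down_obj_of_eq_upHom (Γ : S.Ob) : (K.obj Γ).down = Γ := by
  subst h; rfl

theorem down_map_of_eq_upHom {Δ Γ : S.Ob} (f : Δ ⟶ Γ) :
    (K.map f).down ≫ eqToHom (down_obj_of_eq_upHom h Γ) =
      eqToHom (down_obj_of_eq_upHom h Δ) ≫ f := by
  subst h
  exact (Category.comp_id f).trans (Category.id_comp f).symm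

theorem down_onTy_of_eq_upHom {Γ : S.Ob} (A : S.Ty Γ) :
    (K.onTy A).down = S.subTy (eqToHom (down_obj_of_eq_upHom h Γ)) A := by
  subst h
  exact (S.subTy_id A).symm

theorem down_onTm_of_eq_upHom {Γ : S.Ob} (a : S.Tm Γ) :
    (K.onTm a).down = S.subTm (eqToHom (down_obj_of_eq_upHom h Γ)) a := by
  subst h
  exact (S.subTm_id a).symm

theorem down_onI_of_eq_upHom {Γ : S.Ob} (i : S.I Γ) :
    (K.onI i).down = S.subI (eqToHom (down_obj_of_eq_upHom h Γ)) i := by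
  subst h
  exact (S.subI_id i).symm

end CTTModel.Hom

/-- Here Γ' is the base of the glued object assigned to Γ. Since an equality of contexts stands
between them, open types over the two can be compared only heterogeneously, but their closed
instances along matching substitutions agree. -/
theorem CwF.subTy_up_heq (M : CwF.{o, m}) {Θ Γ Γ' : M.Ob} (h : Γ' = Γ) {A : M.Ty Γ} {A' : M.Ty Γ'}
    (hA : A' = M.subTy (eqToHom h) A) {B : M.Ty (M.ext A)} {B' : M.Ty (M.ext A')} (hB : HEq B' B)
    (γ : Θ ⟶ Γ') : HEq (M.subTy (M.up γ A') B') (M.subTy (M.up (γ ≫ eqToHom h) A) B) := by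
  subst h
  rw [eqToHom_refl, M.subTy_id] at hA
  subst hA
  cases hB
  rw [eqToHom_refl, Category.comp_id]

theorem CwF.subTm_up_heq (M : CwF.{o, m}) {Θ Γ Γ' : M.Ob} (h : Γ' = Γ) {A : M.Ty Γ} {A' : M.Ty Γ'}
    (hA : A' = M.subTy (eqToHom h) A) {b : M.Tm (M.ext A)} {b' : M.Tm (M.ext A')} (hb : HEq b' b)
    (γ : Θ ⟶ Γ') : HEq (M.subTm (M.up γ A') b') (M.subTm (M.up (γ ≫ eqToHom h) A) b) := by
  subst h
  rw [eqToHom_refl, M.subTy_id] at hA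
  subst hA
  cases hb
  rw [eqToHom_refl, Category.comp_id]

theorem CwF.subTy_upI_of_heq (M : CwF.{o, m}) {Θ Γ Γ' : M.Ob} (h : Γ' = Γ)
    {A : M.Ty (M.extI Γ)} {A' : M.Ty (M.extI Γ')} (hA : HEq A' A) (γ : Θ ⟶ Γ') :
    M.subTy (M.upI γ) A' = M.subTy (M.upI (γ ≫ eqToHom h)) A := by
  subst h
  cases hA
  rw [eqToHom_refl, Category.comp_id]

theorem CwF.subTm_upI_of_heq (M : CwF.{o, m}) {Θ Γ Γ' : M.Ob} (h : Γ' = Γ)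
    {a : M.Tm (M.extI Γ)} {a' : M.Tm (M.extI Γ')} (ha : HEq a' a) (γ : Θ ⟶ Γ') :
    M.subTm (M.upI γ) a' = M.subTm (M.upI (γ ≫ eqToHom h)) a := by
  subst h
  cases ha
  rw [eqToHom_refl, Category.comp_id]

variable {Q : CubAlg.{u, u}} {F : CubAlg.Hom Q S.toCubAlg} {D : DispModel.{u, w} F}

namespace GlueOb

theorem fn_eqToHom_symm {X Y : GlueOb.{u, w} F} (h : X = Y) (c : Q.Ob) (x : Y.El c) :
    GlueHom.fn (eqToHom h) c (GlueHom.fn (eqToHom h.symm) c x) = x := by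
  subst h; rfl

/-- Lets an environment of a glued extension be written as a transported pair, from which η for
environments follows. -/
theorem exists_fn_eqToHom {X Y : GlueOb.{u, w} F} (h : X = Y) (c : Q.Ob) (y : Y.El c) :
    ∃ x : X.El c, GlueHom.fn (eqToHom h) c x = y := by
  subst h; exact ⟨y, rfl⟩

end GlueOb

namespace CTTModel.Hom

variable (σ : CTTModel.Hom S (glueModel D))

theorem typ_onTmExt {Γ : S.Ob} (A : S.Ty Γ) (b : S.Tm (S.ext A)) :
    GlueTm.typ (σ.onTmExt A b) = σ.onTyExt A (S.typ b) :=
  ((glueModel D).typ_sub _ _).trans (congrArg _ (σ.typ_onTm b))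

theorem typ_onTmExtI {Γ : S.Ob} (b : S.Tm (S.extI Γ)) :
    GlueTm.typ (σ.onTmExtI b) = σ.onTyExtI (S.typ b) :=
  ((glueModel D).typ_sub _ _).trans (congrArg _ (σ.typ_onTm b))

variable (h : σ.baseHom = CTTModel.upHom.{u, u, w + 1, w} S)

include h

theorem base_obj (Γ : S.Ob) : (σ.obj Γ).base = Γ := down_obj_of_eq_upHom h Γ

/-- Two transports separate the sides: one along the preservation of the extension, one along the
identification of the base with the original context. Both are heterogeneously trivial. -/
theorem base_onTyExt_heq {Γ : S.Ob} (A : S.Ty Γ) (B : S.Ty (S.ext A)) :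
    HEq (σ.onTyExt A B).base B := by
  have h₁ : HEq (σ.onTyExt A B).base (σ.onTy B).base := by
    change HEq (S.subTy (GlueHom.base (eqToHom (σ.obj_ext A).symm)) _) _
    rw [GlueOb.eqToHom_base]
    exact S.subTy_eqToHom_heq _ _
  refine h₁.trans ?_
  rw [show (σ.onTy B).base = _ from down_onTy_of_eq_upHom h B]
  exact S.subTy_eqToHom_heq _ _

theorem base_onTmExt_heq {Γ : S.Ob} (A : S.Ty Γ) (b : S.Tm (S.ext A)) :
    HEq (σ.onTmExt A b).base b := by
  have h₁ : HEq (σ.onTmExt A b).base (σ.onTm b).base := by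
    change HEq (S.subTm (GlueHom.base (eqToHom (σ.obj_ext A).symm)) _) _
    rw [GlueOb.eqToHom_base]
    exact S.subTm_eqToHom_heq _ _
  refine h₁.trans ?_
  rw [show (σ.onTm b).base = _ from down_onTm_of_eq_upHom h b]
  exact S.subTm_eqToHom_heq _ _

theorem base_onTyExtI_heq {Γ : S.Ob} (A : S.Ty (S.extI Γ)) : HEq (σ.onTyExtI A).base A := by
  have h₁ : HEq (σ.onTyExtI A).base (σ.onTy A).base := by
    change HEq (S.subTy (GlueHom.base (eqToHom (σ.obj_extI Γ).symm)) _) _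
    rw [GlueOb.eqToHom_base]
    exact S.subTy_eqToHom_heq _ _
  refine h₁.trans ?_
  rw [show (σ.onTy A).base = _ from down_onTy_of_eq_upHom h A]
  exact S.subTy_eqToHom_heq _ _

theorem base_onTmExtI_heq {Γ : S.Ob} (b : S.Tm (S.extI Γ)) : HEq (σ.onTmExtI b).base b := by
  have h₁ : HEq (σ.onTmExtI b).base (σ.onTm b).base := by
    change HEq (S.subTm (GlueHom.base (eqToHom (σ.obj_extI Γ).symm)) _) _
    rw [GlueOb.eqToHom_base]
    exact S.subTm_eqToHom_heq _ _
  refine h₁.trans ?_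
  rw [show (σ.onTm b).base = _ from down_onTm_of_eq_upHom h b]
  exact S.subTm_eqToHom_heq _ _

/-- The judgemental part of the interpretation given by a section of the glued model. -/
def interpBase : InterpBase D where
  E Γ c := (σ.obj Γ).El c
  res f e := (σ.obj _).res f e
  res_id e := (σ.obj _).res_id e
  res_comp g f e := (σ.obj _).res_comp g f e
  -- The glued object lies over its own base, which equals Γ only propositionally.
  sub {Γ} _ e := (σ.obj Γ).sub e ≫ eqToHom (σ.base_obj h Γ)
  sub_res {Γ} _ _ f e := by rw [(σ.obj Γ).sub_res, Category.assoc]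
  map f c e := (σ.map f).fn c e
  map_id e := by rw [σ.map_id]; rfl
  map_comp g f c e := by rw [σ.map_comp]; rfl
  res_map f _ _ g e := (σ.map f).res_fn g e
  sub_map f c e := by
    rw [(σ.map f).sub_fn, Category.assoc, Category.assoc]
    exact congrArg _ (down_map_of_eq_upHom h f)
  ty {_ c} A e := (σ.onTy A).val c e
  tyb_ty A e := by
    rw [(σ.onTy A).tyb_val, S.subTy_comp]
    exact congrArg _ (down_onTy_of_eq_upHom h A)
  ty_res f A e := (σ.onTy A).res_val f e
  ty_sub f A e := by rw [σ.onTy_sub]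
  tm {_ c} a e := (σ.onTm a).val c e
  tyOf_tm a e := GlueTm.val_typ (σ.typ_onTm a) e
  tmb_tm a e := by
    rw [(σ.onTm a).tmb_val, S.subTm_comp]
    exact congrArg _ (down_onTm_of_eq_upHom h a)
  tm_res f a e := (σ.onTm a).res_val f e
  tm_sub f a e := by rw [σ.onTm_sub]
  int {_ c} i e := (σ.onI i).val c e
  ib_int i e := by
    rw [(σ.onI i).ib_val, S.subI_comp]
    exact congrArg _ (down_onI_of_eq_upHom h i)
  int_res f i e := (σ.onI i).res_val f e
  int_sub f i e := by rw [σ.onI_sub]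
  int_i0 e := by rw [σ.onI_i0]
  int_i1 e := by rw [σ.onI_i1]
  star c := GlueHom.fn (eqToHom σ.obj_one.symm) c ⟨⟩
  star_uniq {c} e := by
    obtain ⟨x, rfl⟩ := GlueOb.exists_fn_eqToHom σ.obj_one.symm c e
    rfl
  -- In the glued extension an environment is literally a pair; it is carried to the image of Γ.A
  -- along the strict preservation of extensions.
  pair {_ c} e A a ha := GlueHom.fn (eqToHom (σ.obj_ext A).symm) c ⟨e, a, ha⟩
  map_p {_ c} e A a ha := by
    have := congrArg (fun f => GlueHom.fn f c
      (GlueHom.fn (eqToHom (σ.obj_ext A).symm) c ⟨e, a, ha⟩)) (σ.map_p A)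
    refine this.trans ?_
    exact congrArg Sigma.fst (GlueOb.fn_eqToHom_symm (σ.obj_ext A) c _)
  tm_q {_ c} e A a ha := by
    have := congrArg (fun t => GlueTm.val t c
      (GlueHom.fn (eqToHom (σ.obj_ext A).symm) c ⟨e, a, ha⟩)) (σ.onTm_q A)
    refine this.trans ?_
    exact congrArg (fun x => x.2.1) (GlueOb.fn_eqToHom_symm (σ.obj_ext A) c _)
  pair_eta {_ c} A e := by
    obtain ⟨⟨e, a, ha⟩, rfl⟩ := GlueOb.exists_fn_eqToHom (σ.obj_ext A).symm c e
    refine congrArg (GlueHom.fn (eqToHom (σ.obj_ext A).symm) c) (Sigma.subtype_ext ?_ ?_)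
    · refine (congrArg (fun f => GlueHom.fn f c
        (GlueHom.fn (eqToHom (σ.obj_ext A).symm) c ⟨e, a, ha⟩)) (σ.map_p A)).trans ?_
      exact congrArg Sigma.fst (GlueOb.fn_eqToHom_symm (σ.obj_ext A) c _)
    · refine (congrArg (fun t => GlueTm.val t c
        (GlueHom.fn (eqToHom (σ.obj_ext A).symm) c ⟨e, a, ha⟩)) (σ.onTm_q A)).trans ?_
      exact congrArg (fun x => x.2.1) (GlueOb.fn_eqToHom_symm (σ.obj_ext A) c _)
  pairI {Γ c} e i := GlueHom.fn (eqToHom (σ.obj_extI Γ).symm) c ⟨e, i⟩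
  map_pI {Γ c} e i := by
    refine (congrArg (fun f => GlueHom.fn f c
        (GlueHom.fn (eqToHom (σ.obj_extI Γ).symm) c ⟨e, i⟩)) (σ.map_pI Γ)).trans ?_
    exact congrArg Prod.fst (GlueOb.fn_eqToHom_symm (σ.obj_extI Γ) c _)
  int_qI {Γ c} e i := by
    refine (congrArg (fun f => GlueI.val f c
        (GlueHom.fn (eqToHom (σ.obj_extI Γ).symm) c ⟨e, i⟩)) (σ.onI_qI Γ)).trans ?_
    exact congrArg Prod.snd (GlueOb.fn_eqToHom_symm (σ.obj_extI Γ) c _)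
  pairI_eta {Γ c} e := by
    obtain ⟨⟨e, i⟩, rfl⟩ := GlueOb.exists_fn_eqToHom (σ.obj_extI Γ).symm c e
    refine congrArg (GlueHom.fn (eqToHom (σ.obj_extI Γ).symm) c) (Prod.ext ?_ ?_)
    · refine (congrArg (fun f => GlueHom.fn f c
          (GlueHom.fn (eqToHom (σ.obj_extI Γ).symm) c ⟨e, i⟩)) (σ.map_pI Γ)).trans ?_
      exact congrArg Prod.fst (GlueOb.fn_eqToHom_symm (σ.obj_extI Γ) c _)
    · refine (congrArg (fun f => GlueI.val f c
          (GlueHom.fn (eqToHom (σ.obj_extI Γ).symm) c ⟨e, i⟩)) (σ.onI_qI Γ)).trans ?_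
      exact congrArg Prod.snd (GlueOb.fn_eqToHom_symm (σ.obj_extI Γ) c _)

/-- The interpretation given by a section of the glued model. -/
def interp : Interp D where
  toInterpBase := σ.interpBase h
  ty_pi {Γ c} A B e := by
    refine (congrArg (fun A => GlueTy.val A c e) (σ.on_pi A B)).trans ?_
    refine D.pi_congr rfl ?_ ?_
    · exact S.subTy_up_heq _ (down_onTy_of_eq_upHom h A) (σ.base_onTyExt_heq h A B) _
    -- `onTyExt` reindexes along the same `eqToHom` that defines `pair`, so the values agree by
    -- definition and only the bases need transport.
    · intro d f a _ _; rfl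
  tm_lam {Γ c} A b e := by
    refine (congrArg (fun A => GlueTm.val A c e) (σ.on_lam A b)).trans ?_
    refine D.lam_congr rfl ?_ ?_ ?_ ?_
    · refine S.subTy_up_heq _ (down_onTy_of_eq_upHom h A) ?_ _
      rw [σ.typ_onTmExt]
      exact σ.base_onTyExt_heq h A _
    · intro d f a _ _
      exact congrArg (fun A => GlueTy.val A d _) (σ.typ_onTmExt A b)
    · exact S.subTm_up_heq _ (down_onTy_of_eq_upHom h A) (σ.base_onTmExt_heq h A b) _
    · intro d f a _ _; rfl
  tm_app {Γ c} A B t a ht ha e := by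
    refine (congrArg (fun A => GlueTm.val A c e) (σ.on_app A B t a ht ha)).trans ?_
    refine D.app_congr rfl ?_ ?_ rfl rfl _ _ _ _
    · exact S.subTy_up_heq _ (down_onTy_of_eq_upHom h A) (σ.base_onTyExt_heq h A B) _
    · intro d f a _ _; rfl
  ty_path {Γ c} A a b ha hb e := by
    refine (congrArg (fun A => GlueTy.val A c e) (σ.on_path A a b ha hb)).trans ?_
    refine D.path_congr ?_ ?_ rfl rfl _ _ _ _
    · exact S.subTy_upI_of_heq _ (σ.base_onTyExtI_heq h A) _
    · intro d f i; rfl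
  tm_papp {Γ c} A a b ha hb t ht i e := by
    refine (congrArg (fun A => GlueTm.val A c e) (σ.on_papp A a b ha hb t ht i)).trans ?_
    refine D.papp_congr ?_ ?_ rfl rfl rfl rfl _ _ _ _ _ _
    · exact S.subTy_upI_of_heq _ (σ.base_onTyExtI_heq h A) _
    · intro d f i; rfl
  tm_plam {Γ c} b e := by
    refine (congrArg (fun A => GlueTm.val A c e) (σ.on_plam b)).trans ?_
    refine D.plam_congr ?_ ?_ ?_ ?_
    · refine S.subTy_upI_of_heq _ ?_ _
      rw [σ.typ_onTmExtI]
      exact σ.base_onTyExtI_heq h _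
    · intro d f i
      exact congrArg (fun A => GlueTy.val A d _) (σ.typ_onTmExtI b)
    · exact S.subTm_upI_of_heq _ (σ.base_onTmExtI_heq h b) _
    · intro d f i; rfl

end CTTModel.Hom

end FromGlue

/-- Existence in initiality gives the morphism to the glued model. Uniqueness, applied to the lifted
copy of `S`, makes it a section of the projection, so that the values obtained lie over the intended
types and terms. -/
theorem CTTModel.IsInitial.nonempty_interp {βη : Prop} {S : CTTModel.{u, u} βη}
    (hS : CTTModel.IsInitial.{u, u, max u (w + 1), max u w} S) {Q : CubAlg.{u, u}}
    {F : CubAlg.Hom Q S.toCubAlg} (D : DispModel.{u, w} F) : Nonempty (Interp D) := by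
  obtain ⟨U⟩ := hS (glueModel D)
  obtain ⟨V⟩ := hS (CTTModel.ulift.{u, u, w + 1, w} S)
  exact ⟨U.default.interp ((V.uniq _).trans (V.uniq _).symm)⟩

/-! # Generic environments -/

section Point

variable {βη : Prop} {S : CTTModel.{u, u} βη} {Q : CubAlg.{u, u}} {F : CubAlg.Hom Q S.toCubAlg}
  {D : DispModel.{u, w} F}

/-- An object of `Q` with an environment over the identity substitution. -/
structure PointOb (J : InterpBase D) : Type (max u (w + 1)) where
  pt : Q.Ob
  el : J.E (F.obj pt) pt
  sub_el : J.sub el = 𝟙 _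

namespace PointOb

variable {J : InterpBase D}

/-- The condition on morphisms, that pushing the source environment forward along F(f) agrees with
restricting the target one along f, is the naturality wanted of the chosen points. -/
instance : Category.{u} (PointOb J) where
  Hom X Y := {f : X.pt ⟶ Y.pt // J.map (F.map f) X.el = J.res f Y.el}
  id X := ⟨𝟙 _, by rw [F.map_id, J.map_id, J.res_id]⟩
  comp g f := ⟨g.1 ≫ f.1, by
    rw [F.map_comp, J.map_comp, g.2, ← J.res_map, f.2, J.res_comp]⟩
  id_comp f := Subtype.ext (Category.id_comp _)
  comp_id f := Subtype.ext (Category.comp_id _)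
  assoc f g h := Subtype.ext (Category.assoc _ _ _)

end PointOb

namespace InterpBase

variable (J : InterpBase D)

theorem env_one_ext {c : Q.Ob} (e e' : J.E (F.obj Q.one) c) : e = e' := by
  -- `F.obj Q.one` equals the terminal object propositionally; a variable in its place lets the
  -- equation be eliminated.
  have : ∀ (X : S.Ob) (_ : X = S.one) (e e' : J.E X c), e = e' := by
    rintro _ rfl e e'
    rw [J.star_uniq e, J.star_uniq e']
  exact this _ F.obj_one e e'

theorem hom_obj_one_ext {Γ : S.Ob} (f f' : Γ ⟶ F.obj Q.one) : f = f' := by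
  have : ∀ (X : S.Ob) (_ : X = S.one) (f f' : Γ ⟶ X), f = f' := by
    rintro _ rfl f f'
    rw [S.bang_uniq f, S.bang_uniq f']
  exact this _ F.obj_one f f'

/-- Since `F` preserves extensions up to a transport, F(c.𝕀) has the universal property of F(c).𝕀,
with the images of the projection and the variable from `Q`. -/
theorem hom_obj_extI_ext {c : Q.Ob} {Γ : S.Ob} {f f' : Γ ⟶ F.obj (Q.extI c)}
    (hp : f ≫ F.map (Q.pI c) = f' ≫ F.map (Q.pI c))
    (hq : S.subI f (F.onI (Q.qI c)) = S.subI f' (F.onI (Q.qI c))) : f = f' := by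
  rw [← cancel_mono (eqToHom (F.obj_extI c))]
  rw [F.map_pI] at hp
  rw [F.onI_qI] at hq
  apply S.hom_extI_ext
  · simpa only [Category.assoc] using hp
  · simpa only [S.subI_comp] using hq

/-- The extension of an environment over `F(c)` to one over `F(c.𝕀)`. -/
def pairObjI {c d : Q.Ob} (e : J.E (F.obj c) d) (i : D.I d) : J.E (F.obj (Q.extI c)) d :=
  J.map (eqToHom (F.obj_extI c).symm) (J.pairI e i)

theorem map_pairObjI {c d : Q.Ob} (e : J.E (F.obj c) d) (i : D.I d) :
    J.map (F.map (Q.pI c)) (J.pairObjI e i) = e := by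
  rw [pairObjI, ← J.map_comp, F.map_pI, ← Category.assoc, eqToHom_trans, eqToHom_refl,
    Category.id_comp, J.map_pI]

theorem int_pairObjI {c d : Q.Ob} (e : J.E (F.obj c) d) (i : D.I d) :
    J.int (F.onI (Q.qI c)) (J.pairObjI e i) = i := by
  rw [pairObjI, ← J.int_sub, F.onI_qI, ← S.subI_comp, eqToHom_trans, eqToHom_refl, S.subI_id,
    J.int_qI]

theorem env_obj_extI_ext {c d : Q.Ob} {e e' : J.E (F.obj (Q.extI c)) d}
    (hp : J.map (F.map (Q.pI c)) e = J.map (F.map (Q.pI c)) e')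
    (hq : J.int (F.onI (Q.qI c)) e = J.int (F.onI (Q.qI c)) e') : e = e' := by
  have h : ∀ e : J.E (F.obj (Q.extI c)) d,
      J.map (eqToHom (F.obj_extI c).symm) (J.map (eqToHom (F.obj_extI c)) e) = e := by
    intro e
    rw [← J.map_comp, eqToHom_trans, eqToHom_refl, J.map_id]
  rw [← h e, ← h e']
  congr 1
  rw [F.map_pI, J.map_comp, J.map_comp] at hp
  rw [F.onI_qI, J.int_sub, J.int_sub] at hq
  exact J.extI_env hp hq

variable (intD : ∀ {c : Q.Ob}, Q.I c → D.I c)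
  (intD_over : ∀ {c : Q.Ob} (i : Q.I c), D.ib (intD i) = F.onI i)
  (intD_nat : ∀ {d c : Q.Ob} (f : d ⟶ c) (i : Q.I c), D.resI f (intD i) = intD (Q.subI f i))
  (intD_i0 : ∀ c : Q.Ob, intD (Q.i0 c) = D.i0 c)
  (intD_i1 : ∀ c : Q.Ob, intD (Q.i1 c) = D.i1 c)

/-- The cubical algebra of objects of `Q` with a generic environment, in which interval elements
are interpreted by `intD`. -/
abbrev pointAlg : CubAlg.{max u (w + 1), u} where
  Ob := PointOb J
  one := ⟨Q.one, J.map (eqToHom F.obj_one.symm) (J.star _), hom_obj_one_ext _ _⟩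
  bang X := Subtype.mk (Q.bang X.pt) (J.env_one_ext _ _)
  bang_uniq f := Subtype.ext (Q.bang_uniq _)
  I X := {i : Q.I X.pt // J.int (F.onI i) X.el = intD i}
  subI f i := ⟨Q.subI f.1 i.1, by rw [F.onI_sub, J.int_sub, f.2, ← J.int_res, i.2, intD_nat]⟩
  subI_id i := Subtype.ext (Q.subI_id _)
  subI_comp g f i := Subtype.ext (Q.subI_comp _ _ _)
  i0 X := ⟨Q.i0 _, by rw [F.onI_i0, J.int_i0, intD_i0]⟩
  i1 X := ⟨Q.i1 _, by rw [F.onI_i1, J.int_i1, intD_i1]⟩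
  subI_i0 f := Subtype.ext (Q.subI_i0 _)
  subI_i1 f := Subtype.ext (Q.subI_i1 _)
  -- The environment is weakened to the stage c.𝕀 and extended by the prescribed interpretation of
  -- the generic interval variable. It lies over the identity because `intD` lies over the action of
  -- `F`.
  extI X := ⟨Q.extI X.pt, J.pairObjI (J.res (Q.pI X.pt) X.el) (intD (Q.qI X.pt)), by
    apply hom_obj_extI_ext
    · rw [← J.sub_map, J.map_pairObjI, J.sub_res, X.sub_el, Category.comp_id, Category.id_comp]
    · rw [← J.ib_int, J.int_pairObjI, intD_over, S.subI_id]⟩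
  pI X := Subtype.mk (Q.pI X.pt) (J.map_pairObjI _ _)
  qI X := ⟨Q.qI X.pt, J.int_pairObjI _ _⟩
  -- The two environments over F(c.𝕀) are compared componentwise: the first component is the
  -- condition on `f`, the second is the condition on `i` and naturality of `intD`.
  pairI {X Y} f i := Subtype.mk (Q.pairI f.1 i.1) (by
    apply J.env_obj_extI_ext
    · rw [← J.map_comp, ← F.map_comp, Q.pairI_p, f.2, ← J.res_map]
      refine Eq.trans ?_ (congrArg (J.res _) (J.map_pairObjI _ _)).symm
      rw [← J.res_comp, Q.pairI_p]
    · rw [← J.int_sub, ← F.onI_sub, Q.pairI_q, i.2, ← J.int_res]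
      refine Eq.trans ?_ (congrArg (D.resI _) (J.int_pairObjI _ _)).symm
      rw [intD_nat, Q.pairI_q])
  pairI_p f i := Subtype.ext (Q.pairI_p _ _)
  pairI_q f i := Subtype.ext (Q.pairI_q _ _)
  pairI_eta g := Subtype.ext (Q.pairI_eta _)

theorem ulift_eqToHom_pt {X Y : PointOb J} (h : X = Y)
    (h' : (ULift.up X.pt : (CubAlg.ulift.{u, u, w + 1, 0} Q).Ob) = ULift.up Y.pt) :
    eqToHom h' = ⟨(eqToHom h : X ⟶ Y).1⟩ := by
  subst h; rfl

/-- The composition of a morphism to `pointAlg` with the projection to `Q`. -/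
abbrev ptHom
    (τ : CubAlg.Hom Q (pointAlg J intD intD_over intD_nat intD_i0 intD_i1)) :
    CubAlg.Hom Q (CubAlg.ulift.{u, u, w + 1, 0} Q) where
  obj c := ⟨(τ.obj c).pt⟩
  map f := ⟨(τ.map f).1⟩
  map_id c := congrArg (fun f => ULift.up (Subtype.val f)) (τ.map_id c)
  map_comp g f := congrArg (fun f => ULift.up (Subtype.val f)) (τ.map_comp g f)
  onI i := ⟨(τ.onI i).1⟩
  onI_sub f i := congrArg (fun f => ULift.up (Subtype.val f)) (τ.onI_sub f i)
  onI_i0 c := congrArg (fun f => ULift.up (Subtype.val f)) (τ.onI_i0 c)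
  onI_i1 c := congrArg (fun f => ULift.up (Subtype.val f)) (τ.onI_i1 c)
  obj_one := congrArg (fun X => ULift.up (PointOb.pt X)) τ.obj_one
  obj_extI c := congrArg (fun X => ULift.up (PointOb.pt X)) (τ.obj_extI c)
  map_pI c := by
    rw [J.ulift_eqToHom_pt (τ.obj_extI c)]
    exact congrArg (fun f => ULift.up (Subtype.val f)) (τ.map_pI c)
  onI_qI c := by
    rw [J.ulift_eqToHom_pt (τ.obj_extI c)]
    exact congrArg (fun f => ULift.up (Subtype.val f)) (τ.onI_qI c)

end InterpBase

section Up

variable {K : CubAlg.Hom Q (CubAlg.ulift.{u, u, w + 1, 0} Q)}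
  (h : K = CubAlg.upHom.{u, u, w + 1, 0} Q)

include h

theorem CubAlg.Hom.down_obj_of_eq_upHom (c : Q.Ob) : (K.obj c).down = c := by
  subst h; rfl

theorem CubAlg.Hom.down_map_of_eq_upHom {d c : Q.Ob} (f : d ⟶ c) :
    (K.map f).down ≫ eqToHom (down_obj_of_eq_upHom h c) =
      eqToHom (down_obj_of_eq_upHom h d) ≫ f := by
  subst h
  exact (Category.comp_id f).trans (Category.id_comp f).symm

theorem CubAlg.Hom.down_onI_of_eq_upHom {c : Q.Ob} (i : Q.I c) :
    (K.onI i).down = Q.subI (eqToHom (down_obj_of_eq_upHom h c)) i := by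
  subst h
  exact (Q.subI_id i).symm

end Up

/-- The initiality of `Q` gives natural environments over the identity substitutions of the
objects `F(c)`, in which interval elements are interpreted by `intD`. -/
theorem CubAlg.IsInitial.exists_point (hQ : CubAlg.IsInitial.{u, u, max u (w + 1), u} Q)
    (J : InterpBase D) (intD : ∀ {c : Q.Ob}, Q.I c → D.I c)
    (intD_over : ∀ {c : Q.Ob} (i : Q.I c), D.ib (intD i) = F.onI i)
    (intD_nat : ∀ {d c : Q.Ob} (f : d ⟶ c) (i : Q.I c), D.resI f (intD i) = intD (Q.subI f i))
    (intD_i0 : ∀ c : Q.Ob, intD (Q.i0 c) = D.i0 c)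
    (intD_i1 : ∀ c : Q.Ob, intD (Q.i1 c) = D.i1 c) :
    ∃ pt : ∀ c : Q.Ob, J.E (F.obj c) c, (∀ c, J.sub (pt c) = 𝟙 _) ∧
      (∀ {d c : Q.Ob} (f : d ⟶ c), J.map (F.map f) (pt d) = J.res f (pt c)) ∧
      ∀ {c : Q.Ob} (i : Q.I c), J.int (F.onI i) (pt c) = intD i := by
  obtain ⟨U⟩ := hQ (InterpBase.pointAlg J intD intD_over intD_nat intD_i0 intD_i1)
  obtain ⟨V⟩ := hQ (CubAlg.ulift.{u, u, w + 1, 0} Q)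
  let τ := U.default
  -- Uniqueness for `Q`, in the universes of `pointAlg`, makes τ a section of the forgetful
  -- morphism.
  have h : InterpBase.ptHom J intD intD_over intD_nat intD_i0 intD_i1 τ = CubAlg.upHom.{u, u, w + 1, 0} Q :=
    (V.uniq _).trans (V.uniq _).symm
  have hob : ∀ c, (τ.obj c).pt = c := CubAlg.Hom.down_obj_of_eq_upHom h
  have hmap : ∀ {d c : Q.Ob} (f : d ⟶ c),
      (τ.map f).1 ≫ eqToHom (hob c) = eqToHom (hob d) ≫ f :=
    fun f => CubAlg.Hom.down_map_of_eq_upHom h f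
  have hI : ∀ {c : Q.Ob} (i : Q.I c), (τ.onI i).1 = Q.subI (eqToHom (hob c)) i :=
    fun i => CubAlg.Hom.down_onI_of_eq_upHom h i
  -- The object underlying τ(c) is c only propositionally, and it occurs both as the stage and
  -- inside the context, so the environment is restricted along one transport and mapped along the
  -- other.
  refine ⟨fun c => J.map (F.map (eqToHom (hob c))) (J.res (eqToHom (hob c).symm) (τ.obj c).el),
    ?_, ?_, ?_⟩
  · intro c
    rw [J.sub_map, J.sub_res, (τ.obj c).sub_el, Category.comp_id, ← F.map_comp, eqToHom_trans,
      eqToHom_refl, F.map_id]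
  · intro d c f
    have h₁ : eqToHom (hob d).symm ≫ (τ.map f).1 = f ≫ eqToHom (hob c).symm := by
      rw [← cancel_mono (eqToHom (hob c)), Category.assoc, hmap]
      simp
    rw [← J.map_comp, ← F.map_comp, ← hmap, F.map_comp, J.map_comp, ← J.res_map, (τ.map f).2,
      ← J.res_comp, h₁, J.res_comp, J.res_map]
  · intro c i
    rw [← J.int_sub, ← F.onI_sub, ← hI, ← J.int_res, (τ.onI i).2, intD_nat, hI, ← Q.subI_comp,
      eqToHom_trans, eqToHom_refl, Q.subI_id]

end Point

/-! # Environments of telescopes -/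

namespace CwF

variable {M : CwF.{o, m}}

/-- Induction step for uniqueness of maps into a substituted telescope: the weakened map preserves
the last variable, so that variable is already determined by the composite to the original
telescope. -/
theorem Pulled.ext_hom_ext {Γ Δ Θ Ξ : M.Ob} {T : Tele M Γ Δ} {f : Θ ⟶ Γ} {P : Pulled T f}
    (hP : ∀ s t : Ξ ⟶ P.ctx, s ≫ P.tele.proj = t ≫ P.tele.proj → s ≫ P.map = t ≫ P.map → s = t)
    (A : M.Ty Δ) (s t : Ξ ⟶ M.ext (M.subTy P.map A))
    (h : s ≫ M.p _ ≫ P.tele.proj = t ≫ M.p _ ≫ P.tele.proj)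
    (h' : s ≫ M.up P.map A = t ≫ M.up P.map A) : s = t := by
  have hp : M.up P.map A ≫ M.p A = M.p _ ≫ P.map := M.pair_p _ _ _ _
  have hq : M.subTm (M.up P.map A) (M.q A) = M.q _ := M.pair_q _ _ _ _
  apply M.hom_ext_ext
  · apply hP
    · simpa only [Category.assoc] using h
    · rw [Category.assoc, Category.assoc, ← hp, ← Category.assoc, h', Category.assoc]
  · rw [← hq, ← M.subTm_comp, h', M.subTm_comp]

theorem Pulled.extI_hom_ext {Γ Δ Θ Ξ : M.Ob} {T : Tele M Γ Δ} {f : Θ ⟶ Γ} {P : Pulled T f}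
    (hP : ∀ s t : Ξ ⟶ P.ctx, s ≫ P.tele.proj = t ≫ P.tele.proj → s ≫ P.map = t ≫ P.map → s = t)
    (s t : Ξ ⟶ M.extI P.ctx)
    (h : s ≫ M.pI _ ≫ P.tele.proj = t ≫ M.pI _ ≫ P.tele.proj)
    (h' : s ≫ M.upI P.map = t ≫ M.upI P.map) : s = t := by
  have hp : M.upI P.map ≫ M.pI _ = M.pI _ ≫ P.map := M.pairI_p _ _
  have hq : M.subI (M.upI P.map) (M.qI _) = M.qI _ := M.pairI_q _ _
  apply M.hom_extI_ext
  · apply hP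
    · simpa only [Category.assoc] using h
    · rw [Category.assoc, Category.assoc, ← hp, ← Category.assoc, h', Category.assoc]
  · rw [← hq, ← M.subI_comp, h', M.subI_comp]

/-- The uniqueness half of the pullback property whose existence half is `Tele.lift`. -/
theorem Tele.pull_hom_ext {Γ Θ Ξ : M.Ob} (f : Θ ⟶ Γ) : ∀ {Δ : M.Ob} (T : Tele M Γ Δ)
    (s t : Ξ ⟶ (T.pull f).ctx), s ≫ (T.pull f).tele.proj = t ≫ (T.pull f).tele.proj →
      s ≫ (T.pull f).map = t ≫ (T.pull f).map → s = t
  | _, .nil, s, t, h, _ => (Category.comp_id s).symm.trans (h.trans (Category.comp_id t))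
  | _, .snoc T A, s, t, h, h' => Pulled.ext_hom_ext (pull_hom_ext f T) A s t h h'
  | _, .snocI T, s, t, h, h' => Pulled.extI_hom_ext (pull_hom_ext f T) s t h h'

/-- The extension of a pulled back telescope by a type. -/
def Pulled.snoc {Γ Δ Θ : M.Ob} {T : Tele M Γ Δ} {f : Θ ⟶ Γ} (P : Pulled T f) (A : M.Ty Δ) :
    Pulled (T.snoc A) f :=
  ⟨M.ext (M.subTy P.map A), .snoc P.tele _, M.up P.map A, by
    rw [Tele.proj, Tele.proj, Category.assoc, ← P.comm, CwF.up, ← Category.assoc, M.pair_p,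
      Category.assoc]⟩

/-- The extension of a pulled back telescope by the interval. -/
def Pulled.snocI {Γ Δ Θ : M.Ob} {T : Tele M Γ Δ} {f : Θ ⟶ Γ} (P : Pulled T f) :
    Pulled T.snocI f :=
  ⟨M.extI P.ctx, .snocI P.tele, M.upI P.map, by
    rw [Tele.proj, Tele.proj, Category.assoc, ← P.comm, CubAlg.upI, ← Category.assoc,
      CubAlg.pairI_p, Category.assoc]⟩

theorem Pulled.mk_snoc_congr {Γ Δ Θ X : M.Ob} {T : Tele M Γ Δ} {A : M.Ty Δ} {f : Θ ⟶ Γ}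
    (U : Tele M Θ X) {B B' : M.Ty X} (hB : B = B') {k : M.ext B ⟶ M.ext A}
    {k' : M.ext B' ⟶ M.ext A} (hk : HEq k k') (h : k ≫ (T.snoc A).proj = (U.snoc B).proj ≫ f)
    (h' : k' ≫ (T.snoc A).proj = (U.snoc B').proj ≫ f) :
    (⟨M.ext B, U.snoc B, k, h⟩ : Pulled (T.snoc A) f) = ⟨M.ext B', U.snoc B', k', h'⟩ := by
  subst hB; cases hk; rfl

theorem up_id_heq {Γ : M.Ob} (A : M.Ty Γ) : HEq (M.up (𝟙 Γ) A) (𝟙 (M.ext A)) := by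
  have : ∀ (A' : M.Ty Γ) (h : A' = A) (k : M.ext A' ⟶ M.ext A), k ≫ M.p A = M.p A' →
      M.subTm k (M.q A) = M.q A' → HEq k (𝟙 (M.ext A)) := by
    rintro _ rfl k hp hq
    apply heq_of_eq
    apply M.hom_ext_ext
    · rw [hp, Category.id_comp]
    · rw [hq, M.subTm_id]
  refine this _ (M.subTy_id A) _ ?_ ?_
  · rw [up, M.pair_p, Category.comp_id]
  · rw [up, M.pair_q]

theorem upI_id {Γ : M.Ob} : M.upI (𝟙 Γ) = 𝟙 (M.extI Γ) := by
  apply M.hom_extI_ext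
  · rw [CubAlg.upI, M.pairI_p, Category.comp_id, Category.id_comp]
  · rw [CubAlg.upI, M.pairI_q, M.subI_id]

theorem upI_comp {Θ Δ Γ : M.Ob} (g : Θ ⟶ Δ) (f : Δ ⟶ Γ) :
    M.upI (g ≫ f) = M.upI g ≫ M.upI f := by
  rw [CubAlg.upI, CubAlg.upI, CubAlg.pairI_upI, Category.assoc]

/-- Functoriality of telescope substitution is inherited from that of types. The equality includes
the comparison map, since the next type is substituted along it and the induction needs it. The
hypothesis `hf` accommodates `F.map (𝟙 c)`. -/
theorem Tele.pull_id {Γ : M.Ob} {f : Γ ⟶ Γ} (hf : f = 𝟙 Γ) : ∀ {Δ : M.Ob} (T : Tele M Γ Δ),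
    T.pull f = ⟨Δ, T, 𝟙 Δ, by rw [hf, Category.id_comp, Category.comp_id]⟩
  | _, .nil => by subst hf; rfl
  | _, .snoc T A => by
    change (T.pull f).snoc A = _
    rw [Tele.pull_id hf T]
    exact Pulled.mk_snoc_congr T (M.subTy_id A) (up_id_heq A) _ _
  | _, .snocI T => by
    change (T.pull f).snocI = _
    rw [Tele.pull_id hf T]
    have : ∀ (k : M.extI _ ⟶ M.extI _) (hk : k = 𝟙 _) h h',
      (⟨M.extI _, T.snocI, k, h⟩ : Pulled T.snocI f) = ⟨M.extI _, T.snocI, 𝟙 _, h'⟩ := by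
      rintro _ rfl _ _; rfl
    exact this _ upI_id _ _

theorem Tele.pull_comp {Γ Θ Ξ : M.Ob} {k : Ξ ⟶ Γ} (g : Ξ ⟶ Θ) (f : Θ ⟶ Γ) (hk : k = g ≫ f) :
    ∀ {Δ : M.Ob} (T : Tele M Γ Δ),
    T.pull k = ⟨((T.pull f).tele.pull g).ctx, ((T.pull f).tele.pull g).tele,
      ((T.pull f).tele.pull g).map ≫ (T.pull f).map, by
        rw [Category.assoc, (T.pull f).comm, ← Category.assoc, ((T.pull f).tele.pull g).comm,
          Category.assoc, hk]⟩
  | _, .nil => by subst hk; rfl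
  | _, .snoc T A => by
    change (T.pull k).snoc A = _
    rw [Tele.pull_comp g f hk T]
    refine Pulled.mk_snoc_congr _ (M.subTy_comp _ _ A) ?_ _ _
    -- `up_comp` differs from the wanted map by an `eqToHom` on the left, which heterogeneous
    -- equality ignores.
    refine HEq.trans ?_ (heq_of_eq (M.up_comp _ _ rfl A).symm)
    exact (eqToHom_comp_heq _ _).symm
  | _, .snocI T => by
    change (T.pull k).snocI = _
    rw [Tele.pull_comp g f hk T]
    have : ∀ {X : M.Ob} (U : Tele M Ξ X) (j j' : M.extI X ⟶ M.extI _) (_ : j = j') h h',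
      (⟨M.extI _, U.snocI, j, h⟩ : Pulled T.snocI k) = ⟨M.extI _, U.snocI, j', h'⟩ := by
      rintro _ _ _ _ rfl _ _; rfl
    exact this _ _ _ (upI_comp _ _) _ _

end CwF

/-! ### From pointed interpretations to sections -/

section Env

variable {βη : Prop} {S : CTTModel.{u, u} βη} {Q : CubAlg.{u, u}} {F : CubAlg.Hom Q S.toCubAlg}
  {D : DispModel.{u, w} F}

namespace InterpBase

variable (J : InterpBase D)

/-- `J.E` sends the square of a substituted telescope to a pullback: it preserves each context
extension, so an environment of the original telescope and one of the new base assemble variable by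
variable. Uniqueness is `env_pull_ext`. -/
theorem exists_env_pull {Γ Θ : S.Ob} {d : Q.Ob} (f : Θ ⟶ Γ) (θ : J.E Θ d) : ∀ {Δ : S.Ob}
    (T : CwF.Tele S.toCwF Γ Δ) (e : J.E Δ d), J.map T.proj e = J.map f θ →
      ∃ e' : J.E (T.pull f).ctx d, J.map (T.pull f).tele.proj e' = θ ∧
        J.map (T.pull f).map e' = e
  | _, .nil, e, h => by
    change J.map (𝟙 _) e = _ at h
    rw [J.map_id] at h
    exact ⟨θ, J.map_id θ, h.symm⟩
  | _, .snoc T A, e, h => by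
    change J.map (S.p A ≫ T.proj) e = _ at h
    rw [J.map_comp] at h
    obtain ⟨e', h₁, h₂⟩ := exists_env_pull f θ T _ h
    refine ⟨J.pair e' (S.subTy (T.pull f).map A) (J.tm (S.q A) e)
      (by rw [J.tyOf_tm, S.typ_q, J.ty_sub, J.ty_sub, h₂]), ?_, ?_⟩
    · change J.map (S.p _ ≫ (T.pull f).tele.proj) _ = _
      rw [J.map_comp, J.map_p, h₁]
    · change J.map (S.up (T.pull f).map A) _ = _
      rw [J.map_up_pair _ _ _ _ _ (by rw [J.tyOf_tm, S.typ_q, J.ty_sub, h₂])]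
      exact (J.pair_congr h₂ rfl _ _).trans (J.pair_eta A e)
  | _, .snocI T, e, h => by
    change J.map (S.pI _ ≫ T.proj) e = _ at h
    rw [J.map_comp] at h
    obtain ⟨e', h₁, h₂⟩ := exists_env_pull f θ T _ h
    refine ⟨J.pairI e' (J.int (S.qI _) e), ?_, ?_⟩
    · change J.map (S.pI _ ≫ (T.pull f).tele.proj) _ = _
      rw [J.map_comp, J.map_pI, h₁]
    · change J.map (S.upI (T.pull f).map) _ = _
      rw [J.map_upI_pairI, h₂, J.pairI_eta]

theorem pulled_ext_env_ext {Γ Δ Θ : S.Ob} {d : Q.Ob} {T : CwF.Tele S.toCwF Γ Δ} {f : Θ ⟶ Γ}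
    {P : CwF.Pulled T f}
    (hP : ∀ e e' : J.E P.ctx d, J.map P.tele.proj e = J.map P.tele.proj e' →
      J.map P.map e = J.map P.map e' → e = e')
    (A : S.Ty Δ) (e e' : J.E (S.ext (S.subTy P.map A)) d)
    (h : J.map (S.p _ ≫ P.tele.proj) e = J.map (S.p _ ≫ P.tele.proj) e')
    (h' : J.map (S.up P.map A) e = J.map (S.up P.map A) e') : e = e' := by
  have hp : S.up P.map A ≫ S.p A = S.p _ ≫ P.map := S.pair_p _ _ _ _
  have hq : S.subTm (S.up P.map A) (S.q A) = S.q _ := S.pair_q _ _ _ _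
  apply J.ext_env
  · apply hP
    · rwa [J.map_comp, J.map_comp] at h
    · rw [← J.map_comp, ← J.map_comp, ← hp, J.map_comp, J.map_comp, h']
  · rw [← hq, J.tm_sub, J.tm_sub, h']

theorem pulled_extI_env_ext {Γ Δ Θ : S.Ob} {d : Q.Ob} {T : CwF.Tele S.toCwF Γ Δ} {f : Θ ⟶ Γ}
    {P : CwF.Pulled T f}
    (hP : ∀ e e' : J.E P.ctx d, J.map P.tele.proj e = J.map P.tele.proj e' →
      J.map P.map e = J.map P.map e' → e = e')
    (e e' : J.E (S.extI P.ctx) d)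
    (h : J.map (S.pI _ ≫ P.tele.proj) e = J.map (S.pI _ ≫ P.tele.proj) e')
    (h' : J.map (S.upI P.map) e = J.map (S.upI P.map) e') : e = e' := by
  have hp : S.upI P.map ≫ S.pI _ = S.pI _ ≫ P.map := S.pairI_p _ _
  have hq : S.subI (S.upI P.map) (S.qI _) = S.qI _ := S.pairI_q _ _
  apply J.extI_env
  · apply hP
    · rwa [J.map_comp, J.map_comp] at h
    · rw [← J.map_comp, ← J.map_comp, ← hp, J.map_comp, J.map_comp, h']
  · rw [← hq, J.int_sub, J.int_sub, h']

theorem env_pull_ext {Γ Θ : S.Ob} {d : Q.Ob} (f : Θ ⟶ Γ) : ∀ {Δ : S.Ob}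
    (T : CwF.Tele S.toCwF Γ Δ) (e e' : J.E (T.pull f).ctx d),
      J.map (T.pull f).tele.proj e = J.map (T.pull f).tele.proj e' →
      J.map (T.pull f).map e = J.map (T.pull f).map e' → e = e'
  | _, .nil, e, e', h, _ => (J.map_id e).symm.trans (h.trans (J.map_id e'))
  | _, .snoc T A, e, e', h, h' => J.pulled_ext_env_ext (env_pull_ext f T) A e e' h h'
  | _, .snocI T, e, e', h, h' => J.pulled_extI_env_ext (env_pull_ext f T) e e' h h'

end InterpBase

/-- An interpretation with natural environments over the identity substitutions of the objects
`F(c)`. -/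
structure PointedInterp (D : DispModel.{u, w} F) extends Interp D where
  pt : ∀ c : Q.Ob, E (F.obj c) c
  sub_pt : ∀ c : Q.Ob, sub (pt c) = 𝟙 _
  map_pt : ∀ {d c : Q.Ob} (f : d ⟶ c), map (F.map f) (pt d) = res f (pt c)

namespace PointedInterp

variable (J : PointedInterp D)

/-- The environments of a telescope over a closing substitution `γ`, with their inclusion into the
environments of the total context. -/
def envWithIncl {c : Q.Ob} : ∀ {Δ : S.Ob} (_ : CwF.Tele S.toCwF (F.obj c) Δ) (_ : F.obj c ⟶ Δ),
    (R : Type w) × (R → J.E Δ c)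
  -- The only environment of the empty telescope is the chosen point.
  | _, .nil, _ => ⟨PUnit, fun _ => J.pt c⟩
  | _, .snoc T A, γ =>
    -- The inclusion is defined simultaneously because the condition on the new term refers to the
    -- type at the included environment. The condition on `tmb` keeps the result in the fibre over
    -- γ.
    ⟨(e : (envWithIncl T (γ ≫ S.p A)).1) × {a : D.Tm c //
        D.tyOf a = J.ty A ((envWithIncl T (γ ≫ S.p A)).2 e) ∧ D.tmb a = S.subTm γ (S.q A)},
      fun x => J.pair ((envWithIncl T (γ ≫ S.p A)).2 x.1) A x.2.1 x.2.2.1⟩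
  | _, .snocI T, γ =>
    ⟨(envWithIncl T (γ ≫ S.pI _)).1 × {i : D.I c // D.ib i = S.subI γ (S.qI _)},
      fun x => J.pairI ((envWithIncl T (γ ≫ S.pI _)).2 x.1) x.2.1⟩

variable {c : Q.Ob}

/-- The environments of a telescope over a closing substitution. -/
abbrev Env {Δ : S.Ob} (T : CwF.Tele S.toCwF (F.obj c) Δ) (γ : F.obj c ⟶ Δ) : Type w :=
  (J.envWithIncl T γ).1

/-- The inclusion into the environments of the total context. -/
abbrev incl {Δ : S.Ob} {T : CwF.Tele S.toCwF (F.obj c) Δ} {γ : F.obj c ⟶ Δ} (e : J.Env T γ) :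
    J.E Δ c :=
  (J.envWithIncl T γ).2 e

theorem sub_incl : ∀ {Δ : S.Ob} {T : CwF.Tele S.toCwF (F.obj c) Δ} {γ : F.obj c ⟶ Δ}
    (e : J.Env T γ), γ ≫ T.proj = 𝟙 _ → J.sub (J.incl e) = γ
  | _, .nil, γ, _, h => (J.sub_pt c).trans (h.symm.trans (Category.comp_id γ))
  | _, .snoc T A, γ, x, h => by
    change γ ≫ S.p A ≫ T.proj = _ at h
    rw [← Category.assoc] at h
    refine (J.sub_pair _ A x.2.1 x.2.2.1).trans ?_
    apply S.hom_ext_ext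
    · rw [S.pair_p]
      exact sub_incl x.1 h
    · rw [S.pair_q, x.2.2.2]
  | _, .snocI T, γ, x, h => by
    change γ ≫ S.pI _ ≫ T.proj = _ at h
    rw [← Category.assoc] at h
    refine (J.sub_pairI _ x.2.1).trans ?_
    apply S.hom_extI_ext
    · rw [S.pairI_p]
      exact sub_incl x.1 h
    · rw [S.pairI_q, x.2.2]

theorem map_proj_incl : ∀ {Δ : S.Ob} {T : CwF.Tele S.toCwF (F.obj c) Δ} {γ : F.obj c ⟶ Δ}
    (e : J.Env T γ), J.map T.proj (J.incl e) = J.pt c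
  | _, .nil, _, _ => J.map_id _
  | _, .snoc T A, γ, x => by
    refine (J.map_comp (S.p A) T.proj _).trans ?_
    refine (congrArg _ (J.map_p _ A x.2.1 x.2.2.1)).trans ?_
    exact map_proj_incl x.1
  | _, .snocI T, γ, x => by
    refine (J.map_comp (S.pI _) T.proj _).trans ?_
    refine (congrArg _ (J.map_pI _ x.2.1)).trans ?_
    exact map_proj_incl x.1

theorem incl_injective : ∀ {Δ : S.Ob} {T : CwF.Tele S.toCwF (F.obj c) Δ} {γ : F.obj c ⟶ Δ}
    {e e' : J.Env T γ}, J.incl e = J.incl e' → e = e'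
  | _, .nil, _, _, _, _ => rfl
  | _, .snoc T A, γ, x, y, h => by
    have hp := congrArg (J.map (S.p A)) h
    have hq := congrArg (J.tm (S.q A)) h
    refine Sigma.subtype_ext (incl_injective ?_) ?_
    · exact (J.map_p _ A x.2.1 x.2.2.1).symm.trans (hp.trans (J.map_p _ A y.2.1 y.2.2.1))
    · exact (J.tm_q _ A x.2.1 x.2.2.1).symm.trans (hq.trans (J.tm_q _ A y.2.1 y.2.2.1))
  | _, .snocI T, γ, x, y, h => by
    have hp := congrArg (J.map (S.pI _)) h
    have hq := congrArg (J.int (S.qI _)) h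
    refine Prod.ext (incl_injective ?_) (Subtype.ext ?_)
    · exact (J.map_pI _ x.2.1).symm.trans (hp.trans (J.map_pI _ y.2.1))
    · exact (J.int_qI _ x.2.1).symm.trans (hq.trans (J.int_qI _ y.2.1))

/-- With `sub_incl`, `map_proj_incl` and `incl_injective`, for closing substitutions this identifies
the recursive environments with those of the total context that lie over γ and project to the point.
Choices made from this existence statement are thus unique. -/
theorem exists_incl_eq : ∀ {Δ : S.Ob} (T : CwF.Tele S.toCwF (F.obj c) Δ) (γ : F.obj c ⟶ Δ)
    (e : J.E Δ c), J.sub e = γ → J.map T.proj e = J.pt c → ∃ e' : J.Env T γ, J.incl e' = e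
  | _, .nil, _, e, _, h => by
    change J.map (𝟙 _) e = _ at h
    rw [J.map_id] at h
    exact ⟨⟨⟩, h.symm⟩
  | _, .snoc T A, γ, e, hγ, h => by
    change J.map (S.p A ≫ T.proj) e = _ at h
    rw [J.map_comp] at h
    obtain ⟨e', he'⟩ := exists_incl_eq T (γ ≫ S.p A) (J.map (S.p A) e)
      (by rw [J.sub_map, hγ]) h
    refine ⟨⟨e', J.tm (S.q A) e, ?_, ?_⟩, ?_⟩
    · rw [J.tyOf_tm, S.typ_q, J.ty_sub]
      exact congrArg (J.ty A) he'.symm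
    · rw [J.tmb_tm, hγ]
    · exact (J.pair_congr he' rfl _ _).trans (J.pair_eta A e)
  | _, .snocI T, γ, e, hγ, h => by
    change J.map (S.pI _ ≫ T.proj) e = _ at h
    rw [J.map_comp] at h
    obtain ⟨e', he'⟩ := exists_incl_eq T (γ ≫ S.pI _) (J.map (S.pI _) e)
      (by rw [J.sub_map, hγ]) h
    refine ⟨⟨e', J.int (S.qI _) e, ?_⟩, ?_⟩
    · rw [J.ib_int, hγ]
    · exact (congrArg (fun e => J.pairI e _) he').trans (J.pairI_eta e)

/-- The environment of a telescope with a given image in the environments of the total context. -/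
noncomputable def mkEnv {Δ : S.Ob} (T : CwF.Tele S.toCwF (F.obj c) Δ) (γ : F.obj c ⟶ Δ)
    (e : J.E Δ c) (h : J.sub e = γ) (h' : J.map T.proj e = J.pt c) : J.Env T γ :=
  (J.exists_incl_eq T γ e h h').choose

theorem incl_mkEnv {Δ : S.Ob} (T : CwF.Tele S.toCwF (F.obj c) Δ) (γ : F.obj c ⟶ Δ)
    (e : J.E Δ c) (h : J.sub e = γ) (h' : J.map T.proj e = J.pt c) :
    J.incl (J.mkEnv T γ e h h') = e :=
  (J.exists_incl_eq T γ e h h').choose_spec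

/-- Reduces the heterogeneous laws for morphisms of telescopes to equalities in `J.E` at one
context. -/
theorem heq_of_incl_eq {Δ : S.Ob} {T : CwF.Tele S.toCwF (F.obj c) Δ} {γ γ' : F.obj c ⟶ Δ}
    (hγ : γ = γ') {e : J.Env T γ} {e' : J.Env T γ'} (h : J.incl e = J.incl e') : HEq e e' := by
  subst hγ
  exact heq_of_eq (J.incl_injective h)

/-- The closing substitution is a pairing whose projections compute only propositionally. With its
components as variables, the cast becomes trivial. -/
theorem incl_cast_snoc {Δ : S.Ob} {T : CwF.Tele S.toCwF (F.obj c) Δ} {A : S.Ty Δ}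
    {γ : F.obj c ⟶ Δ} {δ : F.obj c ⟶ S.ext A} (hδ : δ ≫ S.p A = γ) {a₀ : S.Tm (F.obj c)}
    (ha₀ : S.subTm δ (S.q A) = a₀) (e : J.Env T γ) (a : D.Tm c)
    (h : D.tyOf a = J.ty A (J.incl e)) (h' : D.tmb a = a₀)
    (hE : ((e : J.Env T γ) × {a : D.Tm c // D.tyOf a = J.ty A (J.incl e) ∧ D.tmb a = a₀}) =
      J.Env (T.snoc A) δ) :
    J.incl (cast hE ⟨e, a, h, h'⟩) = J.pair (J.incl e) A a h := by
  subst hδ ha₀; rfl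

theorem incl_cast_snocI {Δ : S.Ob} {T : CwF.Tele S.toCwF (F.obj c) Δ}
    {γ : F.obj c ⟶ Δ} {δ : F.obj c ⟶ S.extI Δ} (hδ : δ ≫ S.pI Δ = γ) {i₀ : S.I (F.obj c)}
    (hi₀ : S.subI δ (S.qI Δ) = i₀) (e : J.Env T γ) (i : D.I c) (h : D.ib i = i₀)
    (hE : (J.Env T γ × {i : D.I c // D.ib i = i₀}) = J.Env T.snocI δ) :
    J.incl (cast hE ⟨e, i, h⟩) = J.pairI (J.incl e) i := by
  subst hδ hi₀; rfl

/-! ## Restriction -/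

/-- Restricting in `J.E` changes the stage but keeps the context F(c).T, whereas an environment of
the telescope substituted along F(f) is required. The pullback property supplies it, with the point
at `d` as its base part. -/
theorem exists_env_restr {d c : Q.Ob} (f : d ⟶ c) (x : Closing F c) (e : J.Env x.tele x.sub) :
    ∃ e' : J.Env (x.restr f).tele (x.restr f).sub,
      J.map (x.restrMap f) (J.incl e') = J.res f (J.incl e) := by
  obtain ⟨e', h₁, h₂⟩ := J.exists_env_pull (F.map f) (J.pt d) x.tele (J.res f (J.incl e))
    (by rw [← J.res_map, J.map_proj_incl, J.map_pt])
  obtain ⟨e'', he''⟩ := J.exists_incl_eq (x.restr f).tele (x.restr f).sub e' (by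
    -- The closing substitution of the restricted telescope is pinned down by its two projections,
    -- so it suffices to compare these.
    apply CwF.Tele.pull_hom_ext (F.map f) x.tele
    · refine (J.sub_map _ _).symm.trans ((congrArg J.sub h₁).trans ?_)
      exact (J.sub_pt d).trans (x.restr f).sub_proj.symm
    · refine (J.sub_map _ _).symm.trans ((congrArg J.sub h₂).trans ?_)
      refine (J.sub_res _ _).trans ((congrArg _ (J.sub_incl _ x.sub_proj)).trans ?_)
      exact (x.tele.lift (F.map f) (𝟙 _) (F.map f ≫ x.sub) (by
        rw [Category.assoc, x.sub_proj, Category.comp_id, Category.id_comp])).2.2.symm) h₁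
  exact ⟨e'', (congrArg _ he'').trans h₂⟩

/-- The restriction of environments. -/
noncomputable def resEnv {d c : Q.Ob} (f : d ⟶ c) (x : Closing F c) (e : J.Env x.tele x.sub) :
    J.Env (x.restr f).tele (x.restr f).sub :=
  (J.exists_env_restr f x e).choose

theorem map_incl_resEnv {d c : Q.Ob} (f : d ⟶ c) (x : Closing F c) (e : J.Env x.tele x.sub) :
    J.map (x.restrMap f) (J.incl (J.resEnv f x e)) = J.res f (J.incl e) :=
  (J.exists_env_restr f x e).choose_spec

/-- Characterizes restriction by its image in the original context. As `P` is a variable,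
functoriality of telescope substitution can be fed in as `hP`; the closing substitutions need not be
compared beforehand, being recovered from the environments. -/
theorem resEnv_heq {d c : Q.Ob} (f : d ⟶ c) (x : Closing F c) (e : J.Env x.tele x.sub)
    {P : CwF.Pulled x.tele (F.map f)} (hP : x.tele.pull (F.map f) = P) {s : F.obj d ⟶ P.ctx}
    (hs : s ≫ P.tele.proj = 𝟙 _) (e' : J.Env P.tele s)
    (h : J.map P.map (J.incl e') = J.res f (J.incl e)) : HEq (J.resEnv f x e) e' := by
  subst hP
  have he : J.incl (J.resEnv f x e) = J.incl e' := by
    apply J.env_pull_ext (F.map f) x.tele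
    · exact (J.map_proj_incl _).trans (J.map_proj_incl _).symm
    · exact (J.map_incl_resEnv f x e).trans h.symm
  refine J.heq_of_incl_eq ?_ he
  exact (J.sub_incl (J.resEnv f x e) (x.restr f).sub_proj).symm.trans
    ((congrArg J.sub he).trans (J.sub_incl e' hs))

/-- The action of morphisms of telescopes on environments. -/
noncomputable def homEnv {c : Q.Ob} (x : Closing F c) {Δ : S.Ob}
    (T' : CwF.Tele S.toCwF (F.obj c) Δ) (σ : x.ctx ⟶ Δ) (hσ : σ ≫ T'.proj = x.tele.proj)
    (e : J.Env x.tele x.sub) : J.Env T' (x.sub ≫ σ) :=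
  J.mkEnv T' _ (J.map σ (J.incl e)) (by rw [J.sub_map, J.sub_incl _ x.sub_proj])
    (by rw [← J.map_comp, hσ, J.map_proj_incl])

theorem incl_homEnv {c : Q.Ob} (x : Closing F c) {Δ : S.Ob}
    (T' : CwF.Tele S.toCwF (F.obj c) Δ) (σ : x.ctx ⟶ Δ) (hσ : σ ≫ T'.proj = x.tele.proj)
    (e : J.Env x.tele x.sub) : J.incl (J.homEnv x T' σ hσ e) = J.map σ (J.incl e) :=
  J.incl_mkEnv _ _ _ _ _

/-! ## The section -/

open DispModel

theorem env_snoc_eq {Δ : S.Ob} {T : CwF.Tele S.toCwF (F.obj c) Δ} {A : S.Ty Δ}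
    {γ : F.obj c ⟶ Δ} {δ : F.obj c ⟶ S.ext A} (hδ : δ ≫ S.p A = γ) {a₀ : S.Tm (F.obj c)}
    (ha₀ : S.subTm δ (S.q A) = a₀) :
    J.Env (T.snoc A) δ =
      ((e : J.Env T γ) × {a : D.Tm c // D.tyOf a = J.ty A (J.incl e) ∧ D.tmb a = a₀}) := by
  subst hδ ha₀; rfl

theorem env_snocI_eq {Δ : S.Ob} {T : CwF.Tele S.toCwF (F.obj c) Δ}
    {γ : F.obj c ⟶ Δ} {δ : F.obj c ⟶ S.extI Δ} (hδ : δ ≫ S.pI Δ = γ) {i₀ : S.I (F.obj c)}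
    (hi₀ : S.subI δ (S.qI Δ) = i₀) :
    J.Env T.snocI δ = (J.Env T γ × {i : D.I c // D.ib i = i₀}) := by
  subst hδ hi₀; rfl

/-- The judgemental part of the section given by a pointed interpretation. -/
noncomputable def sconeSectionBase : SconeSectionBase D where
  Env x := J.Env x.tele x.sub
  res f x e := J.resEnv f x e
  res_id {c} x e := by
    -- The unrestricted environment itself is the candidate, over the telescope rewritten by
    -- `pull_id`.
    refine J.resEnv_heq (𝟙 c) x e (CwF.Tele.pull_id (F.map_id c) x.tele) x.sub_proj e ?_
    rw [J.map_id, J.res_id]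
  res_comp g f x e := by
    refine J.resEnv_heq (g ≫ f) x e (CwF.Tele.pull_comp _ _ (F.map_comp g f) x.tele)
      ((x.restr f).restr g).sub_proj (J.resEnv g (x.restr f) (J.resEnv f x e)) ?_
    refine (J.map_comp _ _ _).trans ?_
    refine (congrArg _ (J.map_incl_resEnv g (x.restr f) _)).trans ?_
    refine (J.res_map _ _ _).symm.trans ?_
    exact (congrArg _ (J.map_incl_resEnv f x e)).trans (J.res_comp _ _ _).symm
  hom x Δ T' σ hσ e := J.homEnv x T' σ hσ e
  hom_res f x Δ T' σ hσ e := by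
    -- The candidate is the image of the restricted environment under `restrHom`, whose square with
    -- the comparison maps turns the claim into naturality of `J.map` in the stage.
    refine J.resEnv_heq f (x.push T' σ hσ) _ rfl ?_ _ ?_
    · exact Closing.sub_proj (Closing.push (x.restr f) _ _ (restrHom f x.tele T' σ hσ).2.1)
    · refine (congrArg _ (J.incl_homEnv _ _ _ _ _)).trans ?_
      refine (J.map_comp _ _ _).symm.trans ?_
      refine (congrArg (fun k => J.map k _) (restrHom f x.tele T' σ hσ).2.2).trans ?_
      refine (J.map_comp _ _ _).trans ?_
      refine (congrArg _ (J.map_incl_resEnv f x e)).trans ?_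
      refine (J.res_map _ _ _).symm.trans ?_
      exact congrArg _ (J.incl_homEnv _ _ _ _ _).symm
  hom_id x e := by
    refine J.heq_of_incl_eq (Category.comp_id _) ?_
    rw [J.incl_homEnv, J.map_id]
  hom_comp x Δ Δ' T' T'' σ τ hσ hτ e := by
    refine J.heq_of_incl_eq (Category.assoc _ _ _).symm ?_
    refine (J.incl_homEnv _ _ _ _ _).trans ?_
    refine Eq.trans ?_ (J.incl_homEnv (x.push T' σ hσ) T'' τ hτ _).symm
    rw [J.map_comp]
    exact congrArg _ (J.incl_homEnv _ _ _ _ _).symm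
  ty x A e := J.ty A (J.incl e)
  tyb_ty x A e := by rw [J.tyb_ty, J.sub_incl _ x.sub_proj]
  ty_res f x A e := by
    rw [J.ty_res, J.ty_sub]
    exact congrArg _ (J.map_incl_resEnv f x e).symm
  ty_sub x Δ T' σ hσ A e := by
    rw [J.ty_sub]
    exact congrArg _ (J.incl_homEnv x T' σ hσ e).symm
  tm x a e := J.tm a (J.incl e)
  tyOf_tm x a e := J.tyOf_tm _ _
  tmb_tm x a e := by rw [J.tmb_tm, J.sub_incl _ x.sub_proj]
  tm_res f x a e := by
    rw [J.tm_res, J.tm_sub]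
    exact congrArg _ (J.map_incl_resEnv f x e).symm
  tm_sub x Δ T' σ hσ a e := by
    rw [J.tm_sub]
    exact congrArg _ (J.incl_homEnv x T' σ hσ e).symm
  int x i e := J.int i (J.incl e)
  ib_int x i e := by rw [J.ib_int, J.sub_incl _ x.sub_proj]
  int_res f x i e := by
    rw [J.int_res, J.int_sub]
    exact congrArg _ (J.map_incl_resEnv f x e).symm
  int_sub x Δ T' σ hσ i e := by
    rw [J.int_sub]
    exact congrArg _ (J.incl_homEnv x T' σ hσ e).symm
  env_nil c := rfl
  env_snoc x A a ha := J.env_snoc_eq (S.pair_p _ _ _ _) (S.pair_q _ _ _ _)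
  env_snocI x i := J.env_snocI_eq (S.pairI_p _ _) (S.pairI_q _ _)

theorem incl_pair (x : Closing F c) (A : S.Ty x.ctx) (e : J.Env x.tele x.sub) (a : D.Tm c)
    (ha : D.tyOf a = J.ty A (J.incl e)) :
    J.incl (J.sconeSectionBase.pair x A e a ha) = J.pair (J.incl e) A a ha :=
  J.incl_cast_snoc (S.pair_p _ _ _ _) (S.pair_q _ _ _ _) e a ha rfl _

theorem incl_pairI (x : Closing F c) (e : J.Env x.tele x.sub) (i : D.I c) :
    J.incl (J.sconeSectionBase.pairI x e i) = J.pairI (J.incl e) i :=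
  J.incl_cast_snocI (S.pairI_p _ _) (S.pairI_q _ _) e i rfl _

end PointedInterp

namespace Interp

variable (J : Interp D) {Γ : S.Ob} {c : Q.Ob} (e : J.E Γ c) {γ : F.obj c ⟶ Γ} (hγ : J.sub e = γ)

/-- The rules of `Interp` mention `J.sub e`, those of a section mention the closing substitution of
the telescope. They are equal by `sub_incl`, and a variable γ absorbs the difference for all
formers. -/
theorem ty_pi_of_sub (A : S.Ty Γ) (B : S.Ty (S.ext A)) :
    J.ty (S.pi A B) e = D.pi (S.subTy γ A) (J.ty A e) (by rw [J.tyb_ty, hγ])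
      (S.subTy (S.up γ A) B) (J.famTy e hγ A B) := by
  subst hγ; exact J.ty_pi A B e

theorem tm_lam_of_sub (A : S.Ty Γ) (b : S.Tm (S.ext A)) :
    J.tm (S.lam A b) e = D.lam (S.subTy γ A) (J.ty A e) (by rw [J.tyb_ty, hγ])
      (S.subTy (S.up γ A) (S.typ b)) (J.famTy e hγ A (S.typ b))
      (S.subTm (S.up γ A) b) (S.typ_sub _ _) (J.famTm e hγ A b) := by
  subst hγ; exact J.tm_lam A b e

theorem tm_app_of_sub (A : S.Ty Γ) (B : S.Ty (S.ext A)) (t a : S.Tm Γ)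
    (ht : S.typ t = S.pi A B) (ha : S.typ a = A) :
    J.tm (S.app A B t a ht ha) e = D.app (S.subTy γ A) (J.ty A e) (by rw [J.tyb_ty, hγ])
      (S.subTy (S.up γ A) B) (J.famTy e hγ A B) (J.tm t e) (J.tm a e)
      (by rw [J.tyOf_tm, ht, J.ty_pi_of_sub e hγ]) (by rw [J.tyOf_tm, ha]) := by
  subst hγ; exact J.tm_app A B t a ht ha e

theorem ty_path_of_sub (A : S.Ty (S.extI Γ)) (a b : S.Tm Γ)
    (ha : S.typ a = S.subTy (S.instI (S.i0 Γ)) A)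
    (hb : S.typ b = S.subTy (S.instI (S.i1 Γ)) A) :
    J.ty (S.path A a b ha hb) e = D.path (S.subTy (S.upI γ) A) (J.famITy e hγ A)
      (J.tm a e) (J.tm b e) (J.tyOf_end e hγ A a ha (J.int_i0 e))
      (J.tyOf_end e hγ A b hb (J.int_i1 e)) := by
  subst hγ; exact J.ty_path A a b ha hb e

theorem tm_papp_of_sub (A : S.Ty (S.extI Γ)) (a b : S.Tm Γ)
    (ha : S.typ a = S.subTy (S.instI (S.i0 Γ)) A)
    (hb : S.typ b = S.subTy (S.instI (S.i1 Γ)) A)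
    (t : S.Tm Γ) (ht : S.typ t = S.path A a b ha hb) (i : S.I Γ) :
    J.tm (S.papp A a b ha hb t ht i) e = D.papp (S.subTy (S.upI γ) A) (J.famITy e hγ A)
      (J.tm a e) (J.tm b e) (J.tyOf_end e hγ A a ha (J.int_i0 e))
      (J.tyOf_end e hγ A b hb (J.int_i1 e)) (J.tm t e)
      (by rw [J.tyOf_tm, ht, J.ty_path_of_sub e hγ]) (J.int i e) := by
  subst hγ; exact J.tm_papp A a b ha hb t ht i e

theorem tm_plam_of_sub (b : S.Tm (S.extI Γ)) :
    J.tm (S.plam b) e = D.plam (S.subTy (S.upI γ) (S.typ b))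
      (J.famITy e hγ (S.typ b)) (S.subTm (S.upI γ) b) (S.typ_sub _ _)
      (J.famITm e hγ b) := by
  subst hγ; exact J.tm_plam b e

end Interp

open DispModel in
/-- The section given by a pointed interpretation. -/
noncomputable def PointedInterp.sconeSection (J : PointedInterp D) : SconeSection D where
  toSconeSectionBase := J.sconeSectionBase
  hom_p x A e a ha := by
    refine J.heq_of_incl_eq (S.pair_p _ _ _ _) ?_
    refine (J.incl_homEnv (x.snoc A (D.tmb a) _) x.tele (S.p A) rfl _).trans ?_
    exact (congrArg _ (J.incl_pair x A e a ha)).trans (J.map_p _ _ _ _)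
  tm_q x A e a ha := (congrArg _ (J.incl_pair x A e a ha)).trans (J.tm_q _ _ _ _)
  hom_pI x e i := by
    refine J.heq_of_incl_eq (S.pairI_p _ _) ?_
    refine (J.incl_homEnv (x.snocI (D.ib i)) x.tele (S.pI _) rfl _).trans ?_
    exact (congrArg _ (J.incl_pairI x e i)).trans (J.map_pI _ _)
  int_qI x e i := (congrArg _ (J.incl_pairI x e i)).trans (J.int_qI _ _)
  int_i0 x e := J.int_i0 _
  int_i1 x e := J.int_i1 _
  bodyTy x A B e := J.famTy (J.incl e) (J.sub_incl e x.sub_proj) A B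
  bodyTy_val f x A B e a ha := by
    refine Eq.trans ?_ (J.ty_sub _ _ _).symm
    refine congrArg (J.ty B) (Eq.trans ?_ (congrArg _ (J.incl_pair (x.restr f) _ _ a _)).symm)
    -- Mapping the extended environment of the restricted telescope back to the original context
    -- replaces its first part by the restriction in `J.E` and keeps the last variable.
    refine Eq.trans ?_ (J.map_up_pair _ _ _ _ _ ?_).symm
    · exact J.pair_congr (J.map_incl_resEnv f x e).symm rfl _ _
    · exact ha.trans ((J.ty_res f A _).trans (congrArg (J.ty A) (J.map_incl_resEnv f x e).symm))
  bodyTm x A b e := J.famTm (J.incl e) (J.sub_incl e x.sub_proj) A b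
  bodyTm_val f x A b e a ha := by
    refine Eq.trans ?_ (J.tm_sub _ _ _).symm
    refine congrArg (J.tm b) (Eq.trans ?_ (congrArg _ (J.incl_pair (x.restr f) _ _ a _)).symm)
    refine Eq.trans ?_ (J.map_up_pair _ _ _ _ _ ?_).symm
    · exact J.pair_congr (J.map_incl_resEnv f x e).symm rfl _ _
    · exact ha.trans ((J.ty_res f A _).trans (congrArg (J.ty A) (J.map_incl_resEnv f x e).symm))
  bodyITy x A e := J.famITy (J.incl e) (J.sub_incl e x.sub_proj) A
  bodyITy_val f x A e i := by
    refine Eq.trans ?_ (J.ty_sub _ _ _).symm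
    refine congrArg (J.ty A) (Eq.trans ?_ (congrArg _ (J.incl_pairI (x.restr f) _ i)).symm)
    refine Eq.trans ?_ (J.map_upI_pairI _ _ _).symm
    exact congrArg (fun e => J.pairI e i) (J.map_incl_resEnv f x e).symm
  bodyITm x b e := J.famITm (J.incl e) (J.sub_incl e x.sub_proj) b
  bodyITm_val f x b e i := by
    refine Eq.trans ?_ (J.tm_sub _ _ _).symm
    refine congrArg (J.tm b) (Eq.trans ?_ (congrArg _ (J.incl_pairI (x.restr f) _ i)).symm)
    refine Eq.trans ?_ (J.map_upI_pairI _ _ _).symm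
    exact congrArg (fun e => J.pairI e i) (J.map_incl_resEnv f x e).symm
  ty_pi x A B e := J.ty_pi_of_sub _ (J.sub_incl e x.sub_proj) A B
  tm_lam x A b e := J.tm_lam_of_sub _ (J.sub_incl e x.sub_proj) A b
  tm_app x A B t a ht ha e := J.tm_app_of_sub _ (J.sub_incl e x.sub_proj) A B t a ht ha
  tyOf_end0 x A a ha e := J.tyOf_end _ (J.sub_incl e x.sub_proj) A a ha (J.int_i0 _)
  tyOf_end1 x A a ha e := J.tyOf_end _ (J.sub_incl e x.sub_proj) A a ha (J.int_i1 _)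
  ty_path x A a b ha hb e := J.ty_path_of_sub _ (J.sub_incl e x.sub_proj) A a b ha hb
  tm_papp x A a b ha hb t ht i e :=
    J.tm_papp_of_sub _ (J.sub_incl e x.sub_proj) A a b ha hb t ht i
  tm_plam x b e := J.tm_plam_of_sub _ (J.sub_incl e x.sub_proj) b

end Env

theorem mainTheorem5 {βη : Prop}
    {Q : CubAlg.{u, u}} (hQ : CubAlg.IsInitial.{u, u, max u (w + 1), u} Q)
    {S : CTTModel.{u, u} βη} (hS : CTTModel.IsInitial.{u, u, max u (w + 1), max u w} S)
    (F : CubAlg.Hom Q S.toCubAlg)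
    (D : DispModel.{u, w} F)
    (intD : ∀ {c : Q.Ob}, Q.I c → D.I c)
    (intD_over : ∀ {c : Q.Ob} (i : Q.I c), D.ib (intD i) = F.onI i)
    (intD_nat : ∀ {d c : Q.Ob} (f : d ⟶ c) (i : Q.I c), D.resI f (intD i) = intD (Q.subI f i))
    (intD_i0 : ∀ c : Q.Ob, intD (Q.i0 c) = D.i0 c)
    (intD_i1 : ∀ c : Q.Ob, intD (Q.i1 c) = D.i1 c) :
    ∃ s : DispModel.SconeSection D,
      ∀ {c : Q.Ob} (i : Q.I c) (e : s.Env (Closing.nil F c)),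
        s.int (Closing.nil F c) (F.onI i) e = intD i := by
  obtain ⟨J⟩ := hS.nonempty_interp D
  obtain ⟨pt, sub_pt, map_pt, int_pt⟩ :=
    hQ.exists_point J.toInterpBase intD intD_over intD_nat intD_i0 intD_i1
  -- Every environment of the empty telescope is included as the chosen point, so the last claim is
  -- by definition the equation built into the points.
  exact ⟨PointedInterp.sconeSection ⟨J, pt, sub_pt, map_pt⟩, fun i _ => int_pt i⟩
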